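/- **Setting.** Let $n,m\ge 0$ and let $M\subseteq\mathbb R^m$ be an embedded smooth submanifold (possibly with boundary), with tangent spaces $T_xM\subseteq\mathbb R^m$. Let $C_k(X)$ be the space of $k$-tuples of distinct points of $X$ (and similarly $C_I(X)$ for a finite index set $I$), and put $\underline n=\{1,\dots,n\}$. Let $$A_n[M]=M^{n}\times (S^{m-1})^{C_2(\underline n)}\times[0,\infty]^{C_3(\underline n)},$$ where $[0,\infty]$ carries the smooth structure given by the coordinate $t/(1+t)\in[0,1]$. Let $C_n[M]$ be the closure in $A_n[M]$ of the image of $C_n(M)$ under $$(x_i)\mapsto\Big((x_i),\ \big(\tfrac{x_i-x_j}{|x_i-x_j|}\big)_{(i,j)},\ \big(\tfrac{|x_i-x_j|}{|x_i-x_k|}\big)_{(i,j,k)}\Big).$$ **Trees.** An $f$-tree $T$ with $n$ leaves is a finite tree with a root $v_0$ in which no vertex other than the root has valence $2$, and whose univalent vertices other than the root (the leaves) are labelled bijectively by $\underline n$. Vertices that are neither the root nor a leaf are internal; they form the set $V^i(T)$. A vertex lies over the vertices on its path to the root. $E(v)$ is the set of edges at $v$ leading away from the root, $\#v=|E(v)|$,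 and, for a root edge $e\in E(v_0)$, $V(e)$ is the set of internal vertices lying over $e$ (including its upper endpoint, if that is internal). **Strata.** For $x=((x_i),(u_{ij}),(d_{ijk}))\in C_n[M]$ let $\mathcal P(x)$ be the collection of all sets $\{i\}\cup\{j : d_{ijk}=0\}$, with $i\neq k$ such that some such $j$ exists ($i,j,k$ distinct). Build a tree with a root, one vertex for each member of $\mathcal P(x)$ and $n$ labelled leaves: members are joined to the maximal members strictly contained in them, the root is joined to the maximal members, and the leaf $i$ is joined to the smallest member containing $i$, or to the root if there is none. Let $T(x)$ be this tree, except that when $n\ge2$ and all $x_i$ coincide a new root is added, joined by an edge to the old one. For an $f$-tree $T$ with $n$ leaves, $C_T(M)\subseteq C_n[M]$ is the subspace of all $x$ with $T(x)\cong T$ (as labelled rooted trees). **Infinitesimal configurations.** $IC_k(M)$ is the space of pairs $(x,(w_1,\dots,w_k))$ with $x\in M$ and $w_1,\dots,w_k$ distinct points of $T_xM$, modulo translations and positive scalings of $(w_1,\dots,w_k)$ in $T_xM$, with the quotient topology and smooth structure. For $e\in E(v_0)$, $IC_e(M)$ is the space of points $x\in M$ together with an element of $IC_{\#v}(M)$ over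 $x$ for each $v\in V(e)$ (so $IC_e(M)=M$ if $V(e)=\emptyset$). $D_T(M)\subseteq\prod_{e\in E(v_0)}IC_e(M)$ is the subspace of tuples whose underlying points $(x_e)_{e\in E(v_0)}$ are distinct. (At each $v$ the $\#v$ points are indexed by $E(v)$.) Let $\widetilde C_k(\mathbb R^m)$ be the quotient of $C_k(\mathbb R^m)$ by translations and positive scalings. **Theorem.** For every $f$-tree $T$ with $n$ leaves: 1. For every such $M$, $C_T(M)$, with the smooth structure it has as a subspace of $A_n[M]$, is diffeomorphic to $D_T(M)$. 2. For $M=\mathbb R^m$, the map sending an element of $D_T(\mathbb R^m)$ to its underlying points $(x_e)_{e\in E(v_0)}$ and, for each $v\in V^i(T)$, the class of its vectors at $v$ modulo translation and scaling, is a diffeomorphism $$D_T(\mathbb R^m)\;\cong\; C_{\#v_0}(\mathbb R^m)\times\prod_{v\in V^i(T)}\widetilde C_{\#v}(\mathbb R^m).$$ -/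

import Mathlib

open scoped ContDiff

/-! ### Smooth structures

A smooth structure on `X` is recorded by a family of Euclidean parameters: a relation
`Rep a x` ("the parameter `a` represents the point `x`") between a normed space and `X`, under
which each parameter represents at most one point and each point is represented.
A subset of a Euclidean space is parametrized by itself, a product by the product of the
parameters, a quotient by the parameters of the space it is a quotient of. -/

/-- A parametrization of the points of `X` by a subset of a real normed space. -/
class SmoothParam (X : Type) where
  Param : Type
  [normed : NormedAddCommGroup Param]
  [normedSpace : NormedSpace ℝ Param]
  Rep : Param → X → Prop
  rep_unique : ∀ {a x y}, Rep a x → Rep a y → x = y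
  rep_exists : ∀ x, ∃ a, Rep a x

attribute [instance, reducible] SmoothParam.normed SmoothParam.normedSpace

namespace SmoothParam

/-- A map is smooth if near each parameter it is induced by a `C^∞` map which is defined on a
neighbourhood in the ambient normed space. For subsets of Euclidean spaces this is the usual
notion (existence of local smooth extensions); for quotient manifolds (where the quotient map is
a submersion) it is smoothness with respect to the quotient manifold structure. -/
def IsSmooth {X Y : Type} [SmoothParam X] [SmoothParam Y] (f : X → Y) : Prop :=
  ∀ (x : X) (a : Param X), Rep a x →
    ∃ (U : Set (Param X)) (F : Param X → Param Y), IsOpen U ∧ a ∈ U ∧ ContDiffOn ℝ ∞ F U ∧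
      ∀ b ∈ U, ∀ y : X, Rep b y → Rep (F b) (f y)

/-- A diffeomorphism: a homeomorphism that is smooth in both directions. -/
def IsDiffeo {X Y : Type} [TopologicalSpace X] [TopologicalSpace Y]
    [SmoothParam X] [SmoothParam Y] (f : X ≃ₜ Y) : Prop :=
  IsSmooth f ∧ IsSmooth f.symm

/-- `X` and `Y` are diffeomorphic. -/
def Diffeomorphic (X Y : Type) [TopologicalSpace X] [TopologicalSpace Y]
    [SmoothParam X] [SmoothParam Y] : Prop :=
  ∃ f : X ≃ₜ Y, IsDiffeo f

/-- Euclidean space, parametrized by itself. -/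
noncomputable instance euclidean (m : ℕ) : SmoothParam (EuclideanSpace ℝ (Fin m)) where
  Param := EuclideanSpace ℝ (Fin m)
  Rep a x := a = x
  rep_unique h h' := h.symm.trans h'
  rep_exists x := ⟨x, rfl⟩

/-- The closed interval `[0, ∞]`, with the coordinate `t ↦ t / (1 + t)` that identifies it
with `[0, 1]`. -/
noncomputable instance ennreal : SmoothParam ENNReal where
  Param := ℝ
  Rep a t := a = (ENNReal.orderIsoUnitIntervalBirational t : ℝ)
  rep_unique h h' :=
    ENNReal.orderIsoUnitIntervalBirational.injective (Subtype.ext (h.symm.trans h'))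
  rep_exists _ := ⟨_, rfl⟩

/-- Subspaces. -/
noncomputable instance subtype {X : Type} [SmoothParam X] (p : X → Prop) : SmoothParam {x : X // p x} where
  Param := Param X
  Rep a x := Rep a x.1
  rep_unique h h' := Subtype.ext (rep_unique h h')
  rep_exists x := rep_exists x.1

/-- Binary products. -/
noncomputable instance prod {X Y : Type} [SmoothParam X] [SmoothParam Y] : SmoothParam (X × Y) where
  Param := Param X × Param Y
  Rep a x := Rep a.1 x.1 ∧ Rep a.2 x.2
  rep_unique h h' := Prod.ext (rep_unique h.1 h'.1) (rep_unique h.2 h'.2)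
  rep_exists x :=
    let ⟨a, ha⟩ := rep_exists x.1
    let ⟨b, hb⟩ := rep_exists x.2
    ⟨(a, b), ha, hb⟩

/-- Finite products. -/
noncomputable instance pi {ι : Type} [Finite ι] {X : ι → Type} [∀ i, SmoothParam (X i)] :
    SmoothParam (∀ i, X i) :=
  letI : Fintype ι := Fintype.ofFinite ι
  { Param := ∀ i, Param (X i)
    Rep := fun a x => ∀ i, Rep (a i) (x i)
    rep_unique := fun h h' => funext fun i => rep_unique (h i) (h' i)
    rep_exists := fun x => Classical.axiomOfChoice fun i => rep_exists (x i) }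

/-- Quotients. -/
noncomputable instance quotient {X : Type} [SmoothParam X] (s : Setoid X) : SmoothParam (Quotient s) where
  Param := Param X
  Rep a q := ∃ x : X, Quotient.mk s x = q ∧ Rep a x
  rep_unique := by
    rintro a _ _ ⟨x, rfl, hx⟩ ⟨y, rfl, hy⟩
    rw [rep_unique hx hy]
  rep_exists q := by
    obtain ⟨x, rfl⟩ := Quotient.exists_rep q
    obtain ⟨a, ha⟩ := rep_exists x
    exact ⟨a, x, rfl, ha⟩

end SmoothParam

/-! ### Submanifolds of Euclidean space -/

/-- Euclidean space `ℝ^m`. -/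
abbrev Euc (m : ℕ) : Type := EuclideanSpace ℝ (Fin m)

/-- `M` is an embedded smooth `d`-dimensional submanifold of `ℝ^m`, possibly with boundary: near
each of its points some diffeomorphism between open subsets of `ℝ^m` carries `M` to
`{y ∈ L | 0 ≤ ℓ y}`, with `L` a `d`-dimensional linear subspace. If `ℓ` vanishes on `L` this is
all of `L`, and otherwise it is a closed half-space of `L`. -/
def IsSmoothSubmanifold {m : ℕ} (d : ℕ) (M : Set (Euc m)) : Prop :=
  ∀ x ∈ M, ∃ (φ : OpenPartialHomeomorph (Euc m) (Euc m)) (L : Submodule ℝ (Euc m))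
    (ℓ : Euc m →ₗ[ℝ] ℝ),
    x ∈ φ.source ∧ ContDiffOn ℝ ∞ φ φ.source ∧ ContDiffOn ℝ ∞ φ.symm φ.target ∧
      Module.finrank ℝ L = d ∧ ∀ y ∈ φ.source, y ∈ M ↔ φ y ∈ L ∧ 0 ≤ ℓ (φ y)

/-- The tangent space of `M` at `x`, as a linear subspace of `ℝ^m`: the span of the limits of
rescaled secant vectors of `M` at `x`. -/
def tangentSpaceAt {m : ℕ} (M : Set (Euc m)) (x : Euc m) : Submodule ℝ (Euc m) :=
  Submodule.span ℝ (tangentConeAt ℝ M x)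

/-! ### Configuration spaces and the canonical compactification -/

/-- The space of configurations of distinct points of `X` indexed by `I`. -/
abbrev Conf (I X : Type) : Type := {x : I → X // Function.Injective x}

/-- `A_n[M] = M^n × (S^{m-1})^{C_2(n)} × [0,∞]^{C_3(n)}`. -/
abbrev CompactAmbient {m : ℕ} (n : ℕ) (M : Set (Euc m)) : Type :=
  (Fin n → M) × (Conf (Fin 2) (Fin n) → Metric.sphere (0 : Euc m) 1) ×
    (Conf (Fin 3) (Fin n) → ENNReal)

/-- The unit vector in the direction of `x - y`. -/
noncomputable def unitDir {m : ℕ} (x y : Euc m) (h : x ≠ y) : Metric.sphere (0 : Euc m) 1 :=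
  ⟨‖x - y‖⁻¹ • (x - y), by
    rw [mem_sphere_zero_iff_norm, norm_smul, norm_inv, norm_norm,
      inv_mul_cancel₀ (norm_ne_zero_iff.mpr (sub_ne_zero.mpr h))]⟩

/-- The map `α_n : C_n(M) → A_n[M]`, with components the inclusion, the directions
`π_ij = (x_i - x_j)/|x_i - x_j|` and the ratios `s_ijk = |x_i - x_j|/|x_i - x_k|`. -/
noncomputable def confEmbed {m : ℕ} (n : ℕ) (M : Set (Euc m)) (x : Conf (Fin n) M) :
    CompactAmbient n M :=
  (x.1,
   fun p => unitDir (x.1 (p.1 0)) (x.1 (p.1 1)) fun h =>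
     zero_ne_one (p.2 (x.2 (Subtype.ext h))),
   fun t => edist (x.1 (t.1 0)) (x.1 (t.1 1)) / edist (x.1 (t.1 0)) (x.1 (t.1 2)))

/-- The canonical compactification `C_n[M]`, the closure of the image of `α_n` in `A_n[M]`. -/
def canonicalCompactification {m : ℕ} (n : ℕ) (M : Set (Euc m)) : Set (CompactAmbient n M) :=
  closure (Set.range (confEmbed n M))

/-! ### Trees -/

/-- A finite graph with a root vertex and with `n` vertices labelled by `Fin n`. -/
structure RootedGraph (n : ℕ) where
  V : Type
  [finite : Finite V]
  graph : SimpleGraph V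
  root : V
  leaf : Fin n → V

attribute [instance] RootedGraph.finite

namespace RootedGraph

variable {n : ℕ}

/-- The number of edges at `v`. -/
noncomputable def valence (T : RootedGraph n) (v : T.V) : ℕ :=
  (T.graph.neighborSet v).ncard

/-- `T` is an `f`-tree with `n` leaves: a tree in which no vertex other than the root is
bivalent, and whose leaves (the univalent vertices other than the root) are labelled bijectively
by `Fin n`. -/
structure IsFTree (T : RootedGraph n) : Prop where
  isTree : T.graph.IsTree
  leaf_injective : Function.Injective T.leaf
  mem_range_leaf : ∀ v, v ∈ Set.range T.leaf ↔ v ≠ T.root ∧ T.valence v = 1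
  not_bivalent : ∀ v, v ≠ T.root → T.valence v ≠ 2

/-- Isomorphism of labelled rooted graphs. -/
def Iso (T T' : RootedGraph n) : Prop :=
  ∃ e : T.graph ≃g T'.graph, e T.root = T'.root ∧ ∀ i, e (T.leaf i) = T'.leaf i

/-- `v` lies over `w` if `w` is on the path from `v` to the root (in particular `v` lies over
itself). -/
def LiesOver (T : RootedGraph n) (v w : T.V) : Prop :=
  ∃ p : T.graph.Walk v T.root, p.IsPath ∧ w ∈ p.support

/-- The set `E(v)` of edges with initial vertex `v`, an edge being named by its terminal
vertex. -/
abbrev EdgesAt (T : RootedGraph n) (v : T.V) : Type :=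
  {c : T.V // T.graph.Adj v c ∧ T.LiesOver c v}

/-- Internal vertices are the vertices that are neither the root nor a leaf. -/
def IsInternal (T : RootedGraph n) (v : T.V) : Prop :=
  v ≠ T.root ∧ v ∉ Set.range T.leaf

/-- The set `V^i(T)` of internal vertices. -/
abbrev Internal (T : RootedGraph n) : Type := {v : T.V // T.IsInternal v}

/-- The set `V(e)` of internal vertices that lie over a root edge `e`. -/
abbrev InternalOver (T : RootedGraph n) (e : T.EdgesAt T.root) : Type :=
  {v : T.V // T.IsInternal v ∧ T.LiesOver v e.1}

/-- The tree of a parenthesization `P`: the vertices are a root (`none`), one vertex for each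
member of `P`, and `n` leaves. There is an edge from `B` to `A` if `A` is maximal among the
members of `P` strictly contained in `B`, from the root to each maximal member, and to the leaf
`i` from the smallest member containing `i`, or from the root if there is none. -/
def ofParenthesization (P : Set (Set (Fin n))) : RootedGraph n where
  V := Option (P ⊕ Fin n)
  graph := SimpleGraph.fromRel fun a b => match a, b with
    | none, some (Sum.inl A) => ∀ B ∈ P, A.1 ⊆ B → B = A.1
    | some (Sum.inl B), some (Sum.inl A) => A.1 ⊂ B.1 ∧ ¬∃ C ∈ P, A.1 ⊂ C ∧ C ⊂ B.1
    | none, some (Sum.inr i) => ∀ A ∈ P, i ∉ A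
    | some (Sum.inl A), some (Sum.inr i) => i ∈ A.1 ∧ ∀ B ∈ P, i ∈ B → A.1 ⊆ B
    | _, _ => False
  root := none
  leaf i := some (Sum.inr i)

/-- The parenthesization of an exclusion relation `R` (where `R i j k` says that `i` and `j`
exclude `k`): its members are the sets consisting of `i` and all `j` with `R i j k`, for those
`i` and `k` for which there is such a `j`. -/
def parenthesization (R : Fin n → Fin n → Fin n → Prop) : Set (Set (Fin n)) :=
  {A | ∃ i k, (∃ j, R i j k) ∧ A = insert i {j | R i j k}}

/-- The tree of an exclusion relation. -/
def ofExclusion (R : Fin n → Fin n → Fin n → Prop) : RootedGraph n :=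
  ofParenthesization (parenthesization R)

/-- Add a new root, joined by an edge to the old one. -/
def addRoot (T : RootedGraph n) : RootedGraph n where
  V := Option T.V
  graph := SimpleGraph.fromRel fun a b => match a, b with
    | none, some v => v = T.root
    | some v, some w => T.graph.Adj v w
    | _, _ => False
  root := none
  leaf i := some (T.leaf i)

end RootedGraph

/-! ### The strata `C_T(M)` -/

section Strata

variable {m n : ℕ} {M : Set (Euc m)}

/-- The exclusion relation of a point of `A_n[M]`: `(i, j), k` is in it if `d_ijk = 0`. -/
def exclusionOf (x : CompactAmbient n M) (i j k : Fin n) : Prop :=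
  ∃ h : Function.Injective ![i, j, k], x.2.2 ⟨![i, j, k], h⟩ = 0

open Classical in
/-- The tree `T(x)`. A new root is added when all the (at least two) points `x_i` coincide. -/
noncomputable def treeOf (x : CompactAmbient n M) : RootedGraph n :=
  if 2 ≤ n ∧ ∀ i j, x.1 i = x.1 j then (RootedGraph.ofExclusion (exclusionOf x)).addRoot
  else RootedGraph.ofExclusion (exclusionOf x)

/-- The stratum `C_T(M)`, the subspace of those `x` in `C_n[M]` with `T(x) = T`. -/
abbrev Stratum (T : RootedGraph n) (M : Set (Euc m)) : Type :=
  {x : CompactAmbient n M // x ∈ canonicalCompactification n M ∧ (treeOf x).Iso T}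

end Strata

/-! ### Infinitesimal configurations and `D_T(M)` -/

section InfinitesimalConfigurations

variable {m : ℕ}

/-- Configurations, indexed by `I`, of distinct points lying in one fiber of `TM`. -/
abbrev TangentConf (M : Set (Euc m)) (I : Type) : Type :=
  {p : M × (I → Euc m) // Function.Injective p.2 ∧ ∀ i, p.2 i ∈ tangentSpaceAt M p.1}

/-- The relation on `TangentConf M I` of lying in the same fiber and differing there by a
translation and a positive scaling. -/
def tangentConfSetoid (M : Set (Euc m)) (I : Type) : Setoid (TangentConf M I) where
  r p q := p.1.1 = q.1.1 ∧ ∃ s : ℝ, 0 < s ∧ ∃ w ∈ tangentSpaceAt M p.1.1,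
    ∀ i, q.1.2 i = s • p.1.2 i + w
  iseqv :=
    { refl := fun p => ⟨rfl, 1, one_pos, 0, Submodule.zero_mem _, fun i => by simp⟩
      symm := by
        rintro p q ⟨h, s, hs, w, hw, e⟩
        refine ⟨h.symm, s⁻¹, inv_pos.mpr hs, -(s⁻¹ • w), ?_, fun i => ?_⟩
        · rw [← h]
          exact Submodule.neg_mem _ (Submodule.smul_mem _ _ hw)
        · rw [e i, smul_add, smul_smul, inv_mul_cancel₀ hs.ne', one_smul, add_neg_cancel_right]
      trans := by
        rintro p q r ⟨h, s, hs, w, hw, e⟩ ⟨h', s', hs', w', hw', e'⟩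
        refine ⟨h.trans h', s' * s, mul_pos hs' hs, s' • w + w', ?_, fun i => ?_⟩
        · rw [← h] at hw'
          exact Submodule.add_mem _ (Submodule.smul_mem _ _ hw) hw'
        · rw [e' i, e i, smul_add, smul_smul, add_assoc] }

/-- The space `IC_I(M)` of infinitesimal configurations of points of `M` indexed by `I`. -/
abbrev InfConf (M : Set (Euc m)) (I : Type) : Type := Quotient (tangentConfSetoid M I)

/-- The projection of `IC_I(M)` onto `M`. -/
def InfConf.base {M : Set (Euc m)} {I : Type} (c : InfConf M I) : M :=
  Quotient.lift (s := tangentConfSetoid M I) (fun p : TangentConf M I => p.1.1)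
    (fun _ _ h => h.1) c

/-- The relation on configurations in `ℝ^m` of differing by a translation and a positive
scaling. -/
def confSetoid (m : ℕ) (I : Type) : Setoid (Conf I (Euc m)) where
  r x y := ∃ s : ℝ, 0 < s ∧ ∃ w : Euc m, ∀ i, y.1 i = s • x.1 i + w
  iseqv :=
    { refl := fun p => ⟨1, one_pos, 0, fun i => by simp⟩
      symm := by
        rintro p q ⟨s, hs, w, e⟩
        refine ⟨s⁻¹, inv_pos.mpr hs, -(s⁻¹ • w), fun i => ?_⟩
        rw [e i, smul_add, smul_smul, inv_mul_cancel₀ hs.ne', one_smul, add_neg_cancel_right]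
      trans := by
        rintro p q r ⟨s, hs, w, e⟩ ⟨s', hs', w', e'⟩
        refine ⟨s' * s, mul_pos hs' hs, s' • w + w', fun i => ?_⟩
        rw [e' i, e i, smul_add, smul_smul, add_assoc] }

/-- The space of configurations in `ℝ^m` modulo translation and scaling. -/
abbrev ConfModSim (m : ℕ) (I : Type) : Type := Quotient (confSetoid m I)

/-- The class modulo translation and scaling of the vectors in `ℝ^m` that make up an
infinitesimal configuration. -/
def InfConf.toConfModSim {M : Set (Euc m)} {I : Type} (c : InfConf M I) : ConfModSim m I :=
  Quotient.lift (s := tangentConfSetoid M I)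
    (fun p : TangentConf M I => Quotient.mk (confSetoid m I) ⟨p.1.2, p.2.1⟩)
    (fun _ _ h => Quotient.sound (s := confSetoid m I)
      (let ⟨_, s, hs, w, _, e⟩ := h; ⟨s, hs, w, e⟩)) c

variable {n : ℕ}

/-- The space `IC_e(M)` of points of `M` together with an infinitesimal configuration at that
point for each internal vertex lying over the root edge `e`. -/
abbrev InfConfOver (T : RootedGraph n) (M : Set (Euc m)) (e : T.EdgesAt T.root) : Type :=
  {p : M × (∀ v : T.InternalOver e, InfConf M (T.EdgesAt v.1)) // ∀ v, (p.2 v).base = p.1}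

/-- The space `D_T(M)`: a tuple of elements of the `IC_e(M)`, for the root edges `e` of `T`, that
sit over distinct points of `M`. -/
abbrev InfStratum (T : RootedGraph n) (M : Set (Euc m)) : Type :=
  {p : ∀ e : T.EdgesAt T.root, InfConfOver T M e //
    Function.Injective fun e => (p e).1.1}

end InfinitesimalConfigurations

open Filter Topology

/-!
A point of `C_T(M)` is a limit of configurations in which the points over each internal vertex `v`
of `T` collapse together, in such a way that all pairs of leaves that branch at `v` have distances
of the same order. Dividing the differences of the points over `v` by the distance between two
fixed leaves that branch at `v` therefore gives distinct vectors in the limit, one for each edge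
of `E(v)` and well defined up to translation and scaling. They are limits of rescaled secants of
`M`, hence tangent vectors, and they are rational expressions in the coordinates `u_ij` and
`d_ijk`.

Conversely, given distinct points and vectors, move each leaf from its point along `M` with
displacement the sum of the vectors on its path, the one at a vertex of depth `k` being scaled by
`ε ^ k`. As `ε` tends to zero, the differences of two leaves are governed by the vectors at the
vertex where they branch, so the configurations converge in `A_n[M]`: `u_ij` is the direction of
the difference of the two vectors where `i` and `j` branch, and `d_ijk` is the quotient of two
such lengths, or `0` or `∞`, according to which leaves branch first. These formulas are smooth and
inverse to the previous ones.

For `M = ℝ^m` all tangent spaces are `ℝ^m`, and the second diffeomorphism rearranges factors.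
-/

/-! ### Parametrized topologies -/

namespace SmoothParam

/-- The topology of `X` is the finest one for which the partially defined map from parameters to
points is continuous, and that map is open. A smooth map between such spaces is continuous. -/
class HasParamTopology (X : Type) [TopologicalSpace X] [SmoothParam X] : Prop where
  mem_nhds_iff : ∀ {x : X} {a : Param X}, Rep a x → ∀ {s : Set X},
    s ∈ 𝓝 x ↔ ∀ᶠ b in 𝓝 a, ∀ y : X, Rep b y → y ∈ s

theorem setOf_rep_mem_nhds {X : Type} [TopologicalSpace X] [SmoothParam X] [HasParamTopology X]
    {x : X} {a : Param X} (ha : Rep a x) {U : Set (Param X)} (hU : U ∈ 𝓝 a) :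
    {y | ∃ b ∈ U, Rep b y} ∈ 𝓝 x := by
  refine (HasParamTopology.mem_nhds_iff ha).2 ?_
  filter_upwards [hU] with b hb y hy using ⟨b, hb, hy⟩

theorem IsSmooth.continuous {X Y : Type} [TopologicalSpace X] [TopologicalSpace Y]
    [SmoothParam X] [SmoothParam Y] [HasParamTopology X] [HasParamTopology Y] {f : X → Y}
    (hf : IsSmooth f) : Continuous f := by
  rw [continuous_iff_continuousAt]
  intro x s hs
  obtain ⟨a, ha⟩ := rep_exists x
  obtain ⟨U, F, hU, haU, hF, hrep⟩ := hf x a ha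
  rw [HasParamTopology.mem_nhds_iff (hrep a haU x ha)] at hs
  have hFa : ContinuousAt F a := hF.continuousOn.continuousAt (hU.mem_nhds haU)
  refine (HasParamTopology.mem_nhds_iff ha).2 ?_
  filter_upwards [hFa.eventually hs, hU.mem_nhds haU] with b hb hbU y hy
  exact hb _ (hrep b hbU y hy)

theorem exists_isDiffeo_of_equiv {X Y : Type} [TopologicalSpace X] [TopologicalSpace Y]
    [SmoothParam X] [SmoothParam Y] [HasParamTopology X] [HasParamTopology Y] (f : X ≃ Y)
    (hf : IsSmooth f) (hf' : IsSmooth f.symm) : ∃ g : X ≃ₜ Y, IsDiffeo g ∧ ∀ x, g x = f x :=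
  ⟨⟨f, hf.continuous, hf'.continuous⟩, ⟨hf, hf'⟩, fun _ => rfl⟩

instance (m : ℕ) : HasParamTopology (EuclideanSpace ℝ (Fin m)) where
  mem_nhds_iff := by
    rintro x a rfl s
    exact ⟨fun h => mem_of_superset h fun b hb y (hy : b = y) => hy ▸ hb,
      fun h => mem_of_superset h fun b hb => hb b rfl⟩

instance : HasParamTopology ENNReal where
  mem_nhds_iff := by
    rintro x a rfl s
    have he : IsEmbedding fun t : ENNReal => (ENNReal.orderIsoUnitIntervalBirational t : ℝ) :=
      IsEmbedding.subtypeVal.comp ENNReal.orderIsoUnitIntervalBirational.toHomeomorph.isEmbedding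
    rw [he.nhds_eq_comap, mem_comap]
    constructor
    · rintro ⟨t, ht, hts⟩
      exact mem_of_superset ht fun b hb y (hy : b = _) => hts (by subst hy; exact hb)
    · exact fun h => ⟨_, h, fun y hy => hy y rfl⟩

instance {X : Type} [TopologicalSpace X] [SmoothParam X] [HasParamTopology X] (p : X → Prop) :
    HasParamTopology {x : X // p x} where
  mem_nhds_iff := by
    intro x a (ha : Rep (X := X) a x.1) s
    rw [IsEmbedding.subtypeVal.nhds_eq_comap, mem_comap]
    constructor
    · rintro ⟨t, ht, hts⟩
      filter_upwards [(HasParamTopology.mem_nhds_iff ha).1 ht] with b hb y hy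
      exact hts (hb y.1 hy)
    · intro h
      refine ⟨{y | ∀ hy : p y, ⟨y, hy⟩ ∈ s}, (HasParamTopology.mem_nhds_iff ha).2 ?_,
        fun y hy => hy y.2⟩
      filter_upwards [h] with b hb y hy hpy
      exact hb ⟨y, hpy⟩ hy

instance {X Y : Type} [TopologicalSpace X] [TopologicalSpace Y] [SmoothParam X] [SmoothParam Y]
    [HasParamTopology X] [HasParamTopology Y] : HasParamTopology (X × Y) where
  mem_nhds_iff := by
    rintro ⟨x, y⟩ ⟨a, b⟩ ⟨ha, hb⟩ s
    rw [mem_nhds_prod_iff]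
    constructor
    · rintro ⟨u, hu, v, hv, huv⟩
      have huv_param := ((HasParamTopology.mem_nhds_iff ha).1 hu).prod_nhds
        ((HasParamTopology.mem_nhds_iff hb).1 hv)
      refine huv_param.mono ?_
      rintro ⟨c, d⟩ hcd ⟨z, w⟩ hzw
      exact huv ⟨hcd.1 z hzw.1, hcd.2 w hzw.2⟩
    · intro h
      obtain ⟨U, hU, V, hV, hUV⟩ := mem_nhds_prod_iff.1 (show _ ∈ 𝓝 (a, b) from h)
      refine ⟨_, setOf_rep_mem_nhds ha hU, _, setOf_rep_mem_nhds hb hV, ?_⟩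
      rintro ⟨z, w⟩ ⟨⟨c, hc, hz⟩, ⟨d, hd, hw⟩⟩
      exact hUV (Set.mk_mem_prod hc hd) (z, w) ⟨hz, hw⟩

instance {ι : Type} [Finite ι] {X : ι → Type} [∀ i, TopologicalSpace (X i)]
    [∀ i, SmoothParam (X i)] [∀ i, HasParamTopology (X i)] : HasParamTopology (∀ i, X i) where
  mem_nhds_iff := by
    intro x a (ha : ∀ i, Rep (a i) (x i)) s
    constructor
    · intro hs
      rw [nhds_pi, mem_pi'] at hs
      obtain ⟨I, t, ht, hts⟩ := hs
      have hb : ∀ i, ∀ᶠ b : Param (∀ i, X i) in 𝓝 a, ∀ y : X i, Rep (b i) y → y ∈ t i := fun i =>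
        (continuous_apply (A := fun i => Param (X i)) i).continuousAt.eventually
          ((HasParamTopology.mem_nhds_iff (ha i)).1 (ht i))
      filter_upwards [eventually_all.2 hb] with b hb y hy
      exact hts fun i _ => hb i (y i) (hy i)
    · intro h
      obtain ⟨t, ht, hts⟩ : ∃ t : ∀ i, Set (Param (X i)), (∀ i, t i ∈ 𝓝 (a i)) ∧
          Set.univ.pi t ⊆ {b : Param (∀ i, X i) | ∀ y : ∀ i, X i, Rep b y → y ∈ s} := by
        obtain ⟨I, t, ht, hts⟩ := mem_pi'.1 (nhds_pi (A := fun i => Param (X i)) ▸ h)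
        exact ⟨t, ht, (Set.pi_mono' (fun _ _ => subset_rfl) (Set.subset_univ _)).trans hts⟩
      refine mem_of_superset
        (set_pi_mem_nhds Set.finite_univ fun i _ => setOf_rep_mem_nhds (ha i) (ht i)) ?_
      intro y hy
      choose b hbt hby using fun i => hy i trivial
      exact hts (fun i _ => hbt i) y hby

theorem hasParamTopology_quotient {X : Type} [TopologicalSpace X] [SmoothParam X]
    [HasParamTopology X] (s : Setoid X) (hs : IsOpenMap (Quotient.mk s)) :
    HasParamTopology (Quotient s) where
  mem_nhds_iff := by
    rintro _ a ⟨x, rfl, ha⟩ t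
    have hmap : 𝓝 (Quotient.mk s x) = map (Quotient.mk s) (𝓝 x) :=
      (hs.nhds_le x).antisymm continuous_quotient_mk'.continuousAt
    rw [hmap, mem_map, HasParamTopology.mem_nhds_iff ha]
    refine eventually_congr (Eventually.of_forall fun b => ⟨?_, ?_⟩)
    · rintro hb _ ⟨y, rfl, hy⟩
      exact hb y hy
    · exact fun hb y hy => hb _ ⟨y, rfl, hy⟩

theorem isSmooth_of_contDiff {X Y : Type} [SmoothParam X] [SmoothParam Y] {f : X → Y}
    (F : Param X → Param Y) (hF : ContDiff ℝ ∞ F) (h : ∀ b y, Rep b y → Rep (F b) (f y)) :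
    IsSmooth f :=
  fun _ _ _ => ⟨Set.univ, F, isOpen_univ, trivial, hF.contDiffOn, fun b _ y hy => h b y hy⟩

section Param

variable {X Y : Type} [SmoothParam X] [SmoothParam Y] {ι : Type} [Finite ι] {Z : ι → Type}
  [∀ i, SmoothParam (Z i)] {E : Type*} [NormedAddCommGroup E] [NormedSpace ℝ E] {U : Set E}

theorem contDiff_param_fst : ContDiff ℝ ∞ (fun b => b.1 : Param (X × Y) → Param X) :=
  contDiff_fst

theorem contDiff_param_snd : ContDiff ℝ ∞ (fun b => b.2 : Param (X × Y) → Param Y) :=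
  contDiff_snd

theorem contDiffOn_param_prod {F : E → Param X} {G : E → Param Y}
    (hF : ContDiffOn ℝ ∞ F U) (hG : ContDiffOn ℝ ∞ G U) :
    ContDiffOn ℝ ∞ (fun b => (F b, G b) : E → Param (X × Y)) U :=
  hF.prodMk hG

theorem contDiff_param_apply (i : ι) :
    ContDiff ℝ ∞ (fun b => b i : Param (∀ i, Z i) → Param (Z i)) := by
  let _ := Fintype.ofFinite ι
  exact (ContinuousLinearMap.proj (R := ℝ) (φ := fun i => Param (Z i)) i).contDiff

theorem contDiffOn_param_pi {F : E → ∀ i, Param (Z i)}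
    (h : ∀ i, ContDiffOn ℝ ∞ (fun b => F b i) U) :
    @ContDiffOn ℝ _ E _ _ (Param (∀ i, Z i)) _ _ ∞ F U := by
  let _ := Fintype.ofFinite ι
  exact contDiffOn_pi.2 h

theorem contDiff_param_pi {F : E → ∀ i, Param (Z i)} (h : ∀ i, ContDiff ℝ ∞ fun b => F b i) :
    @ContDiff ℝ _ E _ _ (Param (∀ i, Z i)) _ _ ∞ F := by
  let _ := Fintype.ofFinite ι
  exact contDiff_pi.2 h

end Param

/-- The coordinate `t / (1 + t)` on `[0, ∞]`, by which `[0, ∞]` is parametrized. -/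
noncomputable def birationalCoord (t : ENNReal) : ℝ :=
  (ENNReal.orderIsoUnitIntervalBirational t : ℝ)

theorem birationalCoord_zero : birationalCoord 0 = 0 := by
  simp [birationalCoord, ENNReal.orderIsoUnitIntervalBirational_apply_coe]

theorem birationalCoord_top : birationalCoord ⊤ = 1 := by
  simp [birationalCoord]

theorem birationalCoord_injective : Function.Injective birationalCoord :=
  Subtype.val_injective.comp ENNReal.orderIsoUnitIntervalBirational.injective

theorem birationalCoord_ofReal_div {s t : ℝ} (hs : 0 < s) (ht : 0 < t) :
    birationalCoord (ENNReal.ofReal (s / t)) = s / (s + t) := by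
  rw [birationalCoord, ENNReal.orderIsoUnitIntervalBirational_apply_coe,
    ← ENNReal.ofReal_inv_of_pos (div_pos hs ht), ← ENNReal.ofReal_one,
    ← ENNReal.ofReal_add (by positivity) zero_le_one, ENNReal.toReal_inv,
    ENNReal.toReal_ofReal (by positivity)]
  field_simp
  ring

theorem birationalCoord_ne_one {t : ENNReal} (ht : t ≠ ⊤) : birationalCoord t ≠ 1 :=
  birationalCoord_top ▸ birationalCoord_injective.ne ht

theorem toReal_eq_birationalCoord (t : ENNReal) :
    t.toReal = birationalCoord t / (1 - birationalCoord t) := by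
  by_cases ht : t = ⊤
  · simp [ht, birationalCoord_top]
  lift t to NNReal using ht
  rcases eq_or_ne t 0 with rfl | h0
  · simp [birationalCoord_zero]
  have ht_pos : 0 < (t : ℝ) := NNReal.coe_pos.2 (pos_iff_ne_zero.2 h0)
  have hcoord := birationalCoord_ofReal_div ht_pos one_pos
  rw [div_one, ENNReal.ofReal_coe_nnreal] at hcoord
  rw [hcoord, ENNReal.coe_toReal]
  field_simp
  ring

end SmoothParam

/-! ### The order on the vertices of a rooted tree -/

namespace RootedGraph

variable {n : ℕ} {T : RootedGraph n}

section Tree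

variable (hT : T.graph.IsTree)
include hT

theorem exists_isPath_root (v : T.V) : ∃ p : T.graph.Walk v T.root, p.IsPath :=
  (hT.existsUnique_path v T.root).exists

theorem liesOver_iff_mem_support {v w : T.V} {p : T.graph.Walk v T.root} (hp : p.IsPath) :
    T.LiesOver v w ↔ w ∈ p.support := by
  refine ⟨?_, fun h => ⟨p, hp, h⟩⟩
  rintro ⟨q, hq, h⟩
  rwa [(hT.existsUnique_path v T.root).unique hp hq]

theorem liesOver_refl (v : T.V) : T.LiesOver v v := by
  obtain ⟨p, hp⟩ := exists_isPath_root hT v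
  exact ⟨p, hp, p.start_mem_support⟩

theorem liesOver_root (v : T.V) : T.LiesOver v T.root := by
  obtain ⟨p, hp⟩ := exists_isPath_root hT v
  exact ⟨p, hp, p.end_mem_support⟩

theorem LiesOver.trans {u v w : T.V} (huv : T.LiesOver u v) (hvw : T.LiesOver v w) :
    T.LiesOver u w := by
  classical
  obtain ⟨p, hp, hv⟩ := huv
  rw [liesOver_iff_mem_support hT (hp.dropUntil hv)] at hvw
  exact ⟨p, hp, p.support_dropUntil_subset_support hv hvw⟩

theorem LiesOver.antisymm {u v : T.V} (huv : T.LiesOver u v) (hvu : T.LiesOver v u) : u = v := by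
  classical
  obtain ⟨p, hp, hv⟩ := huv
  rw [liesOver_iff_mem_support hT (hp.dropUntil hv)] at hvu
  by_contra hne
  have hu_tail : u ∈ (p.dropUntil v hv).support.tail :=
    ((SimpleGraph.Walk.mem_support_iff _).1 hvu).resolve_left hne
  have hnodup := hp.support_nodup
  rw [← p.take_spec hv, SimpleGraph.Walk.support_append, List.nodup_append] at hnodup
  exact hnodup.2.2 u (p.takeUntil v hv).start_mem_support u hu_tail rfl

theorem LiesOver.total {u v w : T.V} (huv : T.LiesOver u v) (huw : T.LiesOver u w) :
    T.LiesOver v w ∨ T.LiesOver w v := by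
  obtain ⟨p, hp, hv⟩ := id huv
  have hw := (liesOver_iff_mem_support hT hp).1 huw
  generalize hr : T.root = r at p
  induction p with
  | nil =>
    obtain rfl := List.mem_singleton.1 hv
    exact Or.inl huw
  | cons hab q ih =>
    subst hr
    rcases List.mem_cons.1 hv with rfl | hvq
    · exact Or.inl huw
    rcases List.mem_cons.1 hw with rfl | hwq
    · exact Or.inr huv
    exact ih ⟨q, hp.of_cons, hvq⟩ ⟨q, hp.of_cons, hwq⟩ rfl hp.of_cons hvq hwq

end Tree

/-- The vertex `c` is the terminal vertex of an edge with initial vertex `v`. -/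
def Child (T : RootedGraph n) (v c : T.V) : Prop := T.graph.Adj v c ∧ T.LiesOver c v

theorem Child.ne {v c : T.V} (h : T.Child v c) : v ≠ c := h.1.ne

section Tree

variable (hT : T.graph.IsTree)
include hT

theorem child_or_child_of_adj {v c : T.V} (h : T.graph.Adj v c) : T.Child v c ∨ T.Child c v := by
  classical
  obtain ⟨p, hp⟩ := exists_isPath_root hT v
  by_cases hc : c ∈ p.support
  · exact Or.inr ⟨h.symm, p, hp, hc⟩
  · exact Or.inl ⟨h, p.cons h.symm, hp.cons hc, by simp⟩

theorem Child.liesOver_iff {v c : T.V} (h : T.Child v c) {u : T.V} :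
    T.LiesOver c u ↔ u = c ∨ T.LiesOver v u := by
  obtain ⟨p, hp⟩ := exists_isPath_root hT v
  have hc : c ∉ p.support := fun hc => h.ne (LiesOver.antisymm hT ⟨p, hp, hc⟩ h.2)
  rw [liesOver_iff_mem_support hT (hp.cons hc (h := h.1.symm)), liesOver_iff_mem_support hT hp]
  simp

theorem exists_parent {v : T.V} (hv : v ≠ T.root) : ∃ u, T.Child u v := by
  obtain ⟨p, hp⟩ := exists_isPath_root hT v
  cases p with
  | nil => exact absurd rfl hv
  | cons h q => exact ⟨_, h.symm, _, hp, by simp⟩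

theorem exists_child_of_liesOver {u v : T.V} (h : T.LiesOver u v) (hne : u ≠ v) :
    ∃ c, T.Child v c ∧ T.LiesOver u c := by
  obtain ⟨p, hp, hv⟩ := h
  generalize hr : T.root = r at p
  induction p with
  | nil => exact absurd (List.mem_singleton.1 hv).symm hne
  | @cons a b c hab q ih =>
    subst hr
    have hba : T.Child b a := ⟨hab.symm, _, hp, by simp⟩
    rw [SimpleGraph.Walk.support_cons, List.mem_cons] at hv
    by_cases hbv : b = v
    · exact ⟨a, hbv ▸ hba, liesOver_refl hT a⟩
    · obtain ⟨c, hc, hbc⟩ := ih hbv rfl hp.of_cons (hv.resolve_left (Ne.symm hne))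
      exact ⟨c, hc, hba.2.trans hT hbc⟩

theorem Child.eq_of_liesOver {u v c c' : T.V} (h : T.Child v c) (h' : T.Child v c')
    (hc : T.LiesOver u c) (hc' : T.LiesOver u c') : c = c' := by
  rcases hc.total hT hc' with hcc | hcc
  · rcases (h.liesOver_iff hT).1 hcc with e | e
    · exact e.symm
    · exact absurd (e.antisymm hT h'.2) h'.ne
  · rcases (h'.liesOver_iff hT).1 hcc with e | e
    · exact e
    · exact absurd (e.antisymm hT h.2) h.ne

theorem Child.parent_unique {u v c : T.V} (hu : T.Child u c) (hv : T.Child v c) : u = v := by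
  have huv := ((hu.liesOver_iff hT).1 hv.2).resolve_left hv.ne
  have hvu := ((hv.liesOver_iff hT).1 hu.2).resolve_left hu.ne
  exact huv.antisymm hT hvu

theorem Child.ne_root {v c : T.V} (h : T.Child v c) : c ≠ T.root := by
  rintro rfl
  exact h.ne ((liesOver_root hT v).antisymm hT h.2)

omit hT in
/-- The vertices of a rooted tree, ordered so that `u ≤ v` if `u` lies over `v`; the root is the
greatest element. -/
abbrev vertexOrder (hT : T.graph.IsTree) : PartialOrder T.V where
  le u v := T.LiesOver u v
  le_refl := liesOver_refl hT
  le_trans _ _ _ huv hvw := huv.trans hT hvw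
  le_antisymm _ _ huv hvu := huv.antisymm hT hvu

theorem child_iff_covBy {v c : T.V} :
    letI := vertexOrder hT
    T.Child v c ↔ c ⋖ v := by
  let _ := vertexOrder hT
  refine ⟨fun h => ⟨lt_of_le_of_ne h.2 h.ne.symm, fun u hcu huv => ?_⟩, fun h => ?_⟩
  · have hvu : v ≤ u := ((h.liesOver_iff hT).1 hcu.le).resolve_left hcu.ne'
    exact huv.not_ge hvu
  · obtain ⟨d, hd, hcd⟩ := exists_child_of_liesOver hT h.le h.ne
    obtain rfl := (h.eq_or_eq hcd hd.2).resolve_right hd.ne.symm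
    exact hd

theorem exists_highest {P : T.V → Prop} {v : T.V} (hv : P v) :
    ∃ u, P u ∧ ∀ w, P w → T.LiesOver w u → w = u := by
  let _ := vertexOrder hT
  obtain ⟨u, hu⟩ := (Set.toFinite {u | P u}).exists_minimal ⟨v, hv⟩
  exact ⟨u, hu.1, fun w hw hwu => hwu.antisymm hT (hu.2 hw hwu)⟩

end Tree

section FTree

variable (hT : T.IsFTree)
include hT

theorem neighborSet_eq_insert {u v : T.V} (h : T.Child u v) :
    T.graph.neighborSet v = insert u {c | T.Child v c} := by
  ext c
  rw [SimpleGraph.mem_neighborSet, Set.mem_insert_iff, Set.mem_ofPred_eq]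
  constructor
  · intro hc
    rcases child_or_child_of_adj hT.isTree hc with e | e
    · exact Or.inr e
    · exact Or.inl (e.parent_unique hT.isTree h)
  · rintro (rfl | e)
    · exact h.1.symm
    · exact e.1

theorem valence_eq_ncard_child {u v : T.V} (h : T.Child u v) :
    T.valence v = {c | T.Child v c}.ncard + 1 := by
  rw [valence, neighborSet_eq_insert hT h, Set.ncard_insert_of_notMem]
  exact fun h' => h.ne (LiesOver.antisymm hT.isTree h'.2 h.2)

theorem leaf_ne_root (i : Fin n) : T.leaf i ≠ T.root :=
  ((hT.mem_range_leaf _).1 ⟨i, rfl⟩).1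

theorem not_child_leaf (i : Fin n) (c : T.V) : ¬T.Child (T.leaf i) c := by
  intro h
  obtain ⟨u, hu⟩ := exists_parent hT.isTree (leaf_ne_root hT i)
  have hval := ((hT.mem_range_leaf _).1 ⟨i, rfl⟩).2
  rw [valence_eq_ncard_child hT hu, Nat.add_eq_right, Set.ncard_eq_zero] at hval
  exact Set.eq_empty_iff_forall_notMem.1 hval c h

theorem liesOver_leaf_iff {i : Fin n} {v : T.V} : T.LiesOver v (T.leaf i) ↔ v = T.leaf i := by
  constructor
  · intro h
    by_contra hne
    obtain ⟨c, hc, -⟩ := exists_child_of_liesOver hT.isTree h hne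
    exact not_child_leaf hT i c hc
  · rintro rfl
    exact liesOver_refl hT.isTree _

theorem exists_leaf_liesOver {v : T.V} (hv : v ≠ T.root) : ∃ i, T.LiesOver (T.leaf i) v := by
  obtain ⟨u, huv, hu⟩ := exists_highest hT.isTree (P := fun u => T.LiesOver u v)
    (liesOver_refl hT.isTree v)
  have hur : u ≠ T.root := by
    rintro rfl
    exact hv ((liesOver_root hT.isTree v).antisymm hT.isTree huv)
  obtain ⟨w, hw⟩ := exists_parent hT.isTree hur
  have hchild : {c | T.Child u c} = ∅ := Set.eq_empty_iff_forall_notMem.2 fun c hc =>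
    hc.ne (hu c (hc.2.trans hT.isTree huv) hc.2).symm
  obtain ⟨i, hi⟩ := (hT.mem_range_leaf u).2
    ⟨hur, by rw [valence_eq_ncard_child hT hw, hchild, Set.ncard_empty]⟩
  exact ⟨i, hi ▸ huv⟩

theorem exists_children_of_isInternal {v : T.V} (hv : T.IsInternal v) :
    ∃ c c', T.Child v c ∧ T.Child v c' ∧ c ≠ c' := by
  obtain ⟨u, hu⟩ := exists_parent hT.isTree hv.1
  have hval := valence_eq_ncard_child hT hu
  have hval_ne_two := hT.not_bivalent v hv.1
  have hval_ne_one : T.valence v ≠ 1 := fun h => hv.2 ((hT.mem_range_leaf v).2 ⟨hv.1, h⟩)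
  have hcard : 1 < {c | T.Child v c}.ncard := by omega
  obtain ⟨a, b, ha, hb, hab⟩ := (Set.one_lt_ncard_iff (Set.toFinite _)).1 hcard
  exact ⟨a, b, ha, hb, hab⟩

theorem Child.root_or_isInternal {v c : T.V} (h : T.Child v c) : v = T.root ∨ T.IsInternal v := by
  refine or_iff_not_imp_left.2 fun hv => ⟨hv, ?_⟩
  rintro ⟨i, rfl⟩
  exact not_child_leaf hT i c h

end FTree

/-- The paths from the root to the leaves `i` and `j` separate at the vertex `v`, where they
continue to the children `c` and `c'` respectively. -/
structure SplitsAt (T : RootedGraph n) (i j : Fin n) (v c c' : T.V) : Prop where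
  child_left : T.Child v c
  child_right : T.Child v c'
  ne : c ≠ c'
  left_liesOver : T.LiesOver (T.leaf i) c
  right_liesOver : T.LiesOver (T.leaf j) c'

theorem SplitsAt.symm {i j : Fin n} {v c c' : T.V} (h : T.SplitsAt i j v c c') :
    T.SplitsAt j i v c' c :=
  ⟨h.child_right, h.child_left, h.ne.symm, h.right_liesOver, h.left_liesOver⟩

theorem SplitsAt.not_right_liesOver_left (hT : T.graph.IsTree) {i j : Fin n} {v c c' : T.V}
    (h : T.SplitsAt i j v c c') : ¬T.LiesOver (T.leaf j) c :=
  fun hjc => h.ne (h.child_left.eq_of_liesOver hT h.child_right hjc h.right_liesOver)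

theorem SplitsAt.leaf_ne (hT : T.graph.IsTree) {i j : Fin n} {v c c' : T.V}
    (h : T.SplitsAt i j v c c') : i ≠ j := by
  rintro rfl
  exact h.not_right_liesOver_left hT h.left_liesOver

theorem SplitsAt.left_liesOver_vertex (hT : T.graph.IsTree) {i j : Fin n} {v c c' : T.V}
    (h : T.SplitsAt i j v c c') : T.LiesOver (T.leaf i) v :=
  h.left_liesOver.trans hT h.child_left.2

theorem SplitsAt.right_liesOver_vertex (hT : T.graph.IsTree) {i j : Fin n} {v c c' : T.V}
    (h : T.SplitsAt i j v c c') : T.LiesOver (T.leaf j) v :=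
  h.symm.left_liesOver_vertex hT

theorem SplitsAt.vertex_eq_of_liesOver (hT : T.graph.IsTree) {i j : Fin n} {v c c' w d d' : T.V}
    (h : T.SplitsAt i j v c c') (h' : T.SplitsAt i j w d d') (hvw : T.LiesOver v w) : v = w := by
  by_contra hne
  obtain ⟨e, he, hve⟩ := exists_child_of_liesOver hT hvw hne
  have hed := he.eq_of_liesOver hT h'.child_left
    ((h.left_liesOver_vertex hT).trans hT hve) h'.left_liesOver
  have hed' := he.eq_of_liesOver hT h'.child_right
    ((h.right_liesOver_vertex hT).trans hT hve) h'.right_liesOver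
  exact h'.ne (hed.symm.trans hed')

theorem SplitsAt.unique (hT : T.graph.IsTree) {i j : Fin n} {v c c' w d d' : T.V}
    (h : T.SplitsAt i j v c c') (h' : T.SplitsAt i j w d d') : v = w ∧ c = d ∧ c' = d' := by
  obtain rfl : v = w := by
    rcases (h.left_liesOver_vertex hT).total hT (h'.left_liesOver_vertex hT) with hvw | hwv
    · exact h.vertex_eq_of_liesOver hT h' hvw
    · exact (h'.vertex_eq_of_liesOver hT h hwv).symm
  exact ⟨rfl, h.child_left.eq_of_liesOver hT h'.child_left h.left_liesOver h'.left_liesOver,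
    h.child_right.eq_of_liesOver hT h'.child_right h.right_liesOver h'.right_liesOver⟩

open Classical in
/-- For distinct `i` and `j`, the vertex next to the branching point of the leaves `i` and `j`, on
the way to `i`. If there is no branching point the value is the root. -/
noncomputable def branch (T : RootedGraph n) (i j : Fin n) : T.V :=
  if h : ∃ c v c', T.SplitsAt i j v c c' then h.choose else T.root

/-- Some vertex lies under the leaves `i` and `j` and not under the leaf `k`: seen from the root,
`i` and `j` separate from `k` before they separate from each other. -/
def Near (T : RootedGraph n) (i j k : Fin n) : Prop :=
  ∃ v, T.LiesOver (T.leaf i) v ∧ T.LiesOver (T.leaf j) v ∧ ¬T.LiesOver (T.leaf k) v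

theorem Near.not_near (hT : T.graph.IsTree) {i j k : Fin n} (h : T.Near i j k) :
    ¬T.Near i k j := by
  rintro ⟨w, hi, hk, hj⟩
  obtain ⟨v, hi', hj', hk'⟩ := h
  rcases hi.total hT hi' with h | h
  · exact hk' (hk.trans hT h)
  · exact hj (hj'.trans hT h)

theorem SplitsAt.branch_eq (hT : T.graph.IsTree) {i j : Fin n} {v c c' : T.V}
    (h : T.SplitsAt i j v c c') : T.branch i j = c := by
  have hex : ∃ c v c', T.SplitsAt i j v c c' := ⟨c, v, c', h⟩
  obtain ⟨w, d', hsplit⟩ := hex.choose_spec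
  rw [branch, dif_pos hex]
  exact (hsplit.unique hT h).2.1

section FTree

variable (hT : T.IsFTree)
include hT

theorem exists_splitsAt {i j : Fin n} (hij : i ≠ j) : ∃ v c c', T.SplitsAt i j v c c' := by
  obtain ⟨v, ⟨hi, hj⟩, hv⟩ := exists_highest hT.isTree
    (P := fun u => T.LiesOver (T.leaf i) u ∧ T.LiesOver (T.leaf j) u)
    ⟨liesOver_root hT.isTree _, liesOver_root hT.isTree _⟩
  have hne : ∀ k, v ≠ T.leaf k := by
    rintro k rfl
    exact hij (hT.leaf_injective
      (((liesOver_leaf_iff hT).1 hi).trans ((liesOver_leaf_iff hT).1 hj).symm))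
  obtain ⟨c, hc, hic⟩ := exists_child_of_liesOver hT.isTree hi (hne i).symm
  obtain ⟨c', hc', hjc⟩ := exists_child_of_liesOver hT.isTree hj (hne j).symm
  refine ⟨v, c, c', hc, hc', ?_, hic, hjc⟩
  rintro rfl
  exact hc.ne (hv c ⟨hic, hjc⟩ hc.2).symm

theorem exists_splitsAt_branch {i j : Fin n} (hij : i ≠ j) :
    ∃ v, T.SplitsAt i j v (T.branch i j) (T.branch j i) := by
  obtain ⟨v, c, c', h⟩ := exists_splitsAt hT hij
  exact ⟨v, by rwa [h.branch_eq hT.isTree, h.symm.branch_eq hT.isTree]⟩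

theorem near_iff_liesOver_branch {i j k : Fin n} (hik : i ≠ k) :
    T.Near i j k ↔ T.LiesOver (T.leaf j) (T.branch i k) := by
  obtain ⟨v, hv⟩ := exists_splitsAt_branch hT hik
  have hkv := hv.right_liesOver_vertex hT.isTree
  constructor
  · rintro ⟨w, hi, hj, hk⟩
    rcases hi.total hT.isTree (hv.left_liesOver_vertex hT.isTree) with hwv | hvw
    · have hne : w ≠ v := fun h => hk (h ▸ hkv)
      obtain ⟨c, hc, hwc⟩ := exists_child_of_liesOver hT.isTree hwv hne
      rw [hv.child_left.eq_of_liesOver hT.isTree hc hv.left_liesOver (hi.trans hT.isTree hwc)]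
      exact hj.trans hT.isTree hwc
    · exact absurd (hkv.trans hT.isTree hvw) hk
  · exact fun h => ⟨_, hv.left_liesOver, h, hv.not_right_liesOver_left hT.isTree⟩

theorem SplitsAt.near_of_liesOver {i j k : Fin n} {v w c c' d d' : T.V}
    (h : T.SplitsAt i j v c c') (h' : T.SplitsAt i k w d d') (hvw : T.LiesOver v w) (hne : v ≠ w) :
    T.Near i j k := by
  obtain ⟨e, he, hve⟩ := exists_child_of_liesOver hT.isTree hvw hne
  have hed := he.eq_of_liesOver hT.isTree h'.child_left
    ((h.left_liesOver_vertex hT.isTree).trans hT.isTree hve) h'.left_liesOver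
  rw [near_iff_liesOver_branch hT (h'.leaf_ne hT.isTree), h'.branch_eq hT.isTree, ← hed]
  exact (h.right_liesOver_vertex hT.isTree).trans hT.isTree hve

theorem branch_eq_or_near {i j k : Fin n} (hij : i ≠ j) (hik : i ≠ k) :
    T.branch i j = T.branch i k ∨ T.Near i j k ∨ T.Near i k j := by
  obtain ⟨v, hv⟩ := exists_splitsAt_branch hT hij
  obtain ⟨w, hw⟩ := exists_splitsAt_branch hT hik
  by_cases hvw : v = w
  · subst hvw
    exact Or.inl (hv.child_left.eq_of_liesOver hT.isTree hw.child_left hv.left_liesOver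
      hw.left_liesOver)
  · right
    rcases (hv.left_liesOver_vertex hT.isTree).total hT.isTree
      (hw.left_liesOver_vertex hT.isTree) with h | h
    · exact Or.inl (hv.near_of_liesOver hT hw h hvw)
    · exact Or.inr (hw.near_of_liesOver hT hv h (Ne.symm hvw))

theorem not_near_of_branch_eq {i j k : Fin n} (hij : i ≠ j) (hik : i ≠ k)
    (h : T.branch i j = T.branch i k) : ¬T.Near i j k := by
  rw [near_iff_liesOver_branch hT hik, ← h]
  obtain ⟨v, hv⟩ := exists_splitsAt_branch hT hij
  exact hv.not_right_liesOver_left hT.isTree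

end FTree

end RootedGraph

/-! ### Laminar families and their trees -/

namespace RootedGraph

variable {n : ℕ}

theorem Iso.symm {T T' : RootedGraph n} : T.Iso T' → T'.Iso T := by
  rintro ⟨e, hroot, hleaf⟩
  exact ⟨e.symm, by rw [← hroot]; exact e.symm_apply_apply _,
    fun i => by rw [← hleaf]; exact e.symm_apply_apply _⟩

theorem Iso.trans {T T' T'' : RootedGraph n} : T.Iso T' → T'.Iso T'' → T.Iso T'' := by
  rintro ⟨e, hroot, hleaf⟩ ⟨e', hroot', hleaf'⟩
  exact ⟨e.trans e', (congrArg e' hroot).trans hroot',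
    fun i => (congrArg e' (hleaf i)).trans (hleaf' i)⟩

theorem addRoot_adj_none_some {T : RootedGraph n} {v : T.V} :
    T.addRoot.graph.Adj (none : Option T.V) (some v : Option T.V) ↔ v = T.root := by
  simp [addRoot, SimpleGraph.fromRel_adj]

theorem addRoot_adj_some_some {T : RootedGraph n} {v w : T.V} :
    T.addRoot.graph.Adj (some v : Option T.V) (some w : Option T.V) ↔ T.graph.Adj v w := by
  simp only [addRoot, SimpleGraph.fromRel_adj, ne_eq, Option.some_inj, T.graph.adj_comm w v,
    or_self, and_iff_right_iff_imp]
  exact SimpleGraph.Adj.ne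

theorem addRoot_iso_of_equiv {T T' : RootedGraph n} (e : Option T.V ≃ T'.V)
    (hroot : e none = T'.root) (hleaf : ∀ i, e (some (T.leaf i)) = T'.leaf i)
    (hadj_root : ∀ v, T'.graph.Adj T'.root (e (some v)) ↔ v = T.root)
    (hadj : ∀ v w, T'.graph.Adj (e (some v)) (e (some w)) ↔ T.graph.Adj v w) :
    T.addRoot.Iso T' := by
  refine ⟨⟨e, ?_⟩, hroot, hleaf⟩
  rintro (_ | v) (_ | w)
  · exact iff_of_false (SimpleGraph.irrefl _) (SimpleGraph.irrefl _)
  · exact ((hroot ▸ hadj_root w).trans addRoot_adj_none_some.symm :)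
  · exact ((SimpleGraph.adj_comm ..).trans <| (hroot ▸ hadj_root v).trans <|
      addRoot_adj_none_some.symm.trans (SimpleGraph.adj_comm ..) :)
  · exact (hadj v w).trans addRoot_adj_some_some.symm

theorem Iso.addRoot {T T' : RootedGraph n} : T.Iso T' → T.addRoot.Iso T'.addRoot := by
  rintro ⟨e, hroot, hleaf⟩
  refine addRoot_iso_of_equiv (T' := T'.addRoot) e.toEquiv.optionCongr rfl
    (fun i => congrArg some (hleaf i)) (fun v => ?_) fun v w => ?_
  · exact addRoot_adj_none_some.trans (by rw [← hroot]; exact e.injective.eq_iff)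
  · exact addRoot_adj_some_some.trans e.map_adj_iff

theorem liesOver_map {T T' : RootedGraph n} (e : T.graph ≃g T'.graph)
    (hroot : e T.root = T'.root) {v w : T.V} (h : T.LiesOver v w) : T'.LiesOver (e v) (e w) := by
  obtain ⟨p, hp, hw⟩ := h
  refine ⟨(p.map e.toHom).copy rfl hroot, ?_, ?_⟩
  · rw [SimpleGraph.Walk.isPath_copy]
    exact hp.map e.injective
  · rw [SimpleGraph.Walk.support_copy, SimpleGraph.Walk.support_map]
    exact List.mem_map_of_mem hw

theorem liesOver_map_iff {T T' : RootedGraph n} (e : T.graph ≃g T'.graph)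
    (hroot : e T.root = T'.root) {v w : T.V} : T'.LiesOver (e v) (e w) ↔ T.LiesOver v w := by
  refine ⟨fun h => ?_, liesOver_map e hroot⟩
  have hsymm := liesOver_map e.symm (by rw [← hroot]; exact e.symm_apply_apply _) h
  rwa [show e.symm (e v) = v from e.symm_apply_apply v,
    show e.symm (e w) = w from e.symm_apply_apply w] at hsymm

/-- The Hasse diagram of a finite partial order with a greatest element, which is the root, as a
graph with labelled vertices. Trees are compared through this description: an order isomorphism is
an isomorphism of rooted trees. -/
def ofOrder {V : Type} [PartialOrder V] [OrderTop V] [Finite V] (leaf : Fin n → V) :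
    RootedGraph n where
  V := V
  graph := SimpleGraph.hasse V
  root := ⊤
  leaf := leaf

section OfOrder

variable {V W : Type} [PartialOrder V] [OrderTop V] [Finite V] [PartialOrder W] [OrderTop W]
  [Finite W]

theorem ofOrder_iso_of_orderIso (e : V ≃o W) {leaf : Fin n → V} {leaf' : Fin n → W}
    (h : ∀ i, e (leaf i) = leaf' i) : (ofOrder leaf).Iso (ofOrder leaf') :=
  ⟨⟨e.toEquiv, fun {v w} => by
    simp only [ofOrder, SimpleGraph.hasse_adj]
    exact or_congr (apply_covBy_apply_iff e) (apply_covBy_apply_iff e)⟩, e.map_top, h⟩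

theorem addRoot_ofOrder_iso (leaf : Fin n → V) :
    (ofOrder leaf).addRoot.Iso (ofOrder fun i => (leaf i : WithTop V)) := by
  have hadj_root (v : V) : ((⊤ : WithTop V) ⋖ v ∨ (v : WithTop V) ⋖ ⊤) ↔ v = ⊤ := by
    rw [or_iff_right not_top_covBy, WithTop.coe_covBy_top, isMax_iff_eq_top]
  have hadj (v w : V) : ((v : WithTop V) ⋖ w ∨ (w : WithTop V) ⋖ v) ↔ v ⋖ w ∨ w ⋖ v :=
    or_congr WithTop.coe_covBy_coe WithTop.coe_covBy_coe
  exact addRoot_iso_of_equiv (T := ofOrder leaf) (T' := ofOrder fun i => (leaf i : WithTop V))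
    (Equiv.refl _) rfl (fun _ => rfl) hadj_root hadj

theorem exists_isPath_hasse_top_support
    (h : ∀ u v w : V, u ≤ v → u ≤ w → v ≤ w ∨ w ≤ v) (v : V) :
    ∃ p : (SimpleGraph.hasse V).Walk v ⊤, p.IsPath ∧ ∀ w, w ∈ p.support ↔ v ≤ w := by
  induction v using WellFoundedGT.induction with
  | ind v ih =>
    rcases eq_or_ne v ⊤ with rfl | hv
    · exact ⟨.nil, .nil, fun w => by simp [top_le_iff]⟩
    obtain ⟨u, hvu⟩ := exists_covBy_of_wellFoundedLT (not_isMax_iff_ne_top.2 hv)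
    obtain ⟨p, hp, hsupp⟩ := ih u hvu.lt
    refine ⟨p.cons (SimpleGraph.hasse_adj.2 (Or.inl hvu)),
      hp.cons fun hv => hvu.lt.not_ge ((hsupp v).1 hv), fun w => ?_⟩
    rw [SimpleGraph.Walk.support_cons, List.mem_cons, hsupp]
    refine ⟨?_, fun hvw => ?_⟩
    · rintro (rfl | huw)
      · exact le_rfl
      · exact hvu.le.trans huw
    · rcases h v u w hvu.le hvw with huw | hwu
      · exact Or.inr huw
      · exact (hvu.eq_or_eq hvw hwu).imp_right fun e => e.ge

theorem liesOver_ofOrder_iff {leaf : Fin n → V} (hT : (ofOrder leaf).graph.IsTree)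
    (h : ∀ u v w : V, u ≤ v → u ≤ w → v ≤ w ∨ w ≤ v) {v w : V} :
    (ofOrder leaf).LiesOver v w ↔ v ≤ w := by
  obtain ⟨p, hp, hsupp⟩ := exists_isPath_hasse_top_support h v
  exact (liesOver_iff_mem_support hT hp).trans (hsupp w)

theorem liesOver_of_iso_ofOrder {T : RootedGraph n} (hT : T.graph.IsTree) {leaf : Fin n → V}
    (e : (ofOrder leaf).graph ≃g T.graph) (hroot : e (ofOrder leaf).root = T.root)
    (h : ∀ u v w : V, u ≤ v → u ≤ w → v ≤ w ∨ w ≤ v) {v w : V} :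
    T.LiesOver (e v) (e w) ↔ v ≤ w :=
  (liesOver_map_iff e hroot).trans (liesOver_ofOrder_iff (e.isTree_iff.2 hT) h)

end OfOrder

/-- A laminar family of clusters: a family of sets, each with at least two members, any two of
which are nested or disjoint. -/
structure IsLaminar (P : Set (Set (Fin n))) : Prop where
  nontrivial : ∀ {A}, A ∈ P → A.Nontrivial
  subset_or_subset : ∀ {A B i}, A ∈ P → B ∈ P → i ∈ A → i ∈ B → A ⊆ B ∨ B ⊆ A

/-- The sets of leaves that lie over the vertices, other than the root, of the tree of `P`: the
members of `P` and the singletons. -/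
def nodes (P : Set (Set (Fin n))) : Set (Set (Fin n)) := P ∪ Set.range singleton

/-- The tree of a family of clusters: its vertices are the members of the family, the singletons
(which are the leaves) and a root, ordered by inclusion. -/
abbrev clusterTree (P : Set (Set (Fin n))) : RootedGraph n :=
  ofOrder fun i => ((⟨{i}, Or.inr ⟨i, rfl⟩⟩ : nodes P) : WithTop (nodes P))

section Laminar

variable {P : Set (Set (Fin n))} (hP : IsLaminar P)
include hP

theorem IsLaminar.nonempty {A : Set (Fin n)} (hA : A ∈ nodes P) : A.Nonempty := by
  rcases hA with hA | ⟨i, rfl⟩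
  · exact (hP.nontrivial hA).nonempty
  · exact Set.singleton_nonempty i

theorem IsLaminar.nodes_subset_or_subset {A B : Set (Fin n)} {i : Fin n} (hA : A ∈ nodes P)
    (hB : B ∈ nodes P) (hiA : i ∈ A) (hiB : i ∈ B) : A ⊆ B ∨ B ⊆ A := by
  rcases hA with hA | ⟨j, rfl⟩
  · rcases hB with hB | ⟨j, rfl⟩
    · exact hP.subset_or_subset hA hB hiA hiB
    · obtain rfl := hiB
      exact Or.inr (Set.singleton_subset_iff.2 hiA)
  · obtain rfl := hiA
    exact Or.inl (Set.singleton_subset_iff.2 hiB)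

theorem IsLaminar.le_or_le (u v w : WithTop (nodes P)) (huv : u ≤ v) (huw : u ≤ w) :
    v ≤ w ∨ w ≤ v := by
  induction v with
  | top => exact Or.inr le_top
  | coe B =>
    induction w with
    | top => exact Or.inl le_top
    | coe C =>
      obtain ⟨A, rfl, hAB⟩ := WithTop.le_coe_iff.1 huv
      obtain ⟨i, hi⟩ := hP.nonempty A.2
      exact (hP.nodes_subset_or_subset B.2 C.2 (hAB hi) (WithTop.coe_le_coe.1 huw hi)).imp
        WithTop.coe_le_coe.2 WithTop.coe_le_coe.2

theorem IsLaminar.not_covBy_singleton {A : nodes P} {i : Fin n}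
    {hi : {i} ∈ nodes P} : ¬A ⋖ ⟨{i}, hi⟩ := fun h =>
  (hP.nonempty A.2).ne_empty (Set.ssubset_singleton_iff.1 h.lt)

theorem IsLaminar.covBy_iff {A B : nodes P} :
    A ⋖ B ↔ A.1 ⊂ B.1 ∧ ¬∃ C ∈ P, A.1 ⊂ C ∧ C ⊂ B.1 := by
  refine ⟨fun h => ⟨h.lt, ?_⟩, fun h => ⟨h.1, ?_⟩⟩
  · rintro ⟨C, hC, hAC, hCB⟩
    exact h.2 (c := ⟨C, Or.inl hC⟩) hAC hCB
  · rintro ⟨C, hC | ⟨i, rfl⟩⟩ hAC hCB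
    · exact h.2 ⟨C, hC, hAC, hCB⟩
    · exact (hP.nonempty A.2).ne_empty (Set.ssubset_singleton_iff.1 hAC)

theorem IsLaminar.singleton_covBy_iff {A : nodes P} (hA : A.1 ∈ P) {i : Fin n}
    {hi : {i} ∈ nodes P} : ⟨{i}, hi⟩ ⋖ A ↔ i ∈ A.1 ∧ ∀ B ∈ P, i ∈ B → A.1 ⊆ B := by
  have singleton_ssubset : ∀ {B}, B ∈ P → i ∈ B → {i} ⊂ B := fun hB hiB =>
    (Set.singleton_subset_iff.2 hiB).ssubset_of_ne fun h =>
      Set.not_nontrivial_singleton (h ▸ hP.nontrivial hB)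
  rw [hP.covBy_iff]
  refine ⟨fun ⟨hlt, h⟩ => ⟨hlt.subset rfl, fun B hB hiB => ?_⟩,
    fun ⟨hiA, h⟩ => ⟨singleton_ssubset hA hiA, ?_⟩⟩
  · refine (hP.subset_or_subset hA hB (hlt.subset rfl) hiB).elim id fun hBA => ?_
    by_contra hAB
    exact h ⟨B, hB, singleton_ssubset hB hiB, hBA, hAB⟩
  · rintro ⟨C, hC, hiC, hCA⟩
    exact hCA.not_subset (h C hC (hiC.subset rfl))

theorem IsLaminar.isMax_iff {A : nodes P} : IsMax A ↔ ∀ B ∈ P, A.1 ⊆ B → B = A.1 := by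
  refine ⟨fun h B hB hAB => Set.Subset.antisymm (h (b := ⟨B, Or.inl hB⟩) hAB) hAB,
    fun h => ?_⟩
  rintro ⟨B, hB | ⟨i, rfl⟩⟩ hAB
  · exact (h B hB hAB).le
  · exact ((hP.nonempty A.2).subset_singleton_iff.1 hAB).ge

theorem IsLaminar.isMax_singleton_iff {i : Fin n} {hi : {i} ∈ nodes P} :
    IsMax (⟨{i}, hi⟩ : nodes P) ↔ ∀ B ∈ P, i ∉ B := by
  rw [hP.isMax_iff]
  refine forall₂_congr fun B hB => ?_
  have hne : B ≠ {i} := fun h => Set.not_nontrivial_singleton (h ▸ hP.nontrivial hB)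
  rw [Set.singleton_subset_iff, imp_iff_not hne]

omit hP in
/-- The identification of the vertices of `ofParenthesization P` with those of `clusterTree P`. -/
def toClusterTree : Option (P ⊕ Fin n) → WithTop (nodes P)
  | none => ⊤
  | some (Sum.inl A) => (⟨A.1, Or.inl A.2⟩ : nodes P)
  | some (Sum.inr i) => (⟨{i}, Or.inr ⟨i, rfl⟩⟩ : nodes P)

theorem IsLaminar.bijective_toClusterTree : Function.Bijective (toClusterTree (P := P)) := by
  have hne : ∀ (A : P) (i : Fin n), A.1 ≠ {i} := fun A i h =>
    Set.not_nontrivial_singleton (h ▸ hP.nontrivial A.2)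
  constructor
  · rintro (_ | A | i) (_ | B | j) h
    all_goals simp only [toClusterTree, WithTop.coe_inj, WithTop.coe_ne_top, WithTop.top_ne_coe]
      at h
    · rfl
    · rw [Subtype.ext (Subtype.mk.inj h)]
    · exact absurd (Subtype.mk.inj h) (hne A j)
    · exact absurd (Subtype.mk.inj h).symm (hne B i)
    · rw [Set.singleton_injective (Subtype.mk.inj h)]
  · intro v
    induction v with
    | top => exact ⟨none, rfl⟩
    | coe A =>
      obtain ⟨A, hA | ⟨i, rfl⟩⟩ := A
      · exact ⟨some (Sum.inl ⟨A, hA⟩), rfl⟩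
      · exact ⟨some (Sum.inr i), rfl⟩

omit hP in
theorem fromRel_adj_iff_hasse_adj {V W : Type} [Preorder W] {r : V → V → Prop} {e : V → W}
    (h : ∀ a b, r a b ↔ e b ⋖ e a) {a b : V} :
    (SimpleGraph.fromRel r).Adj a b ↔ (SimpleGraph.hasse W).Adj (e a) (e b) := by
  rw [SimpleGraph.fromRel_adj, SimpleGraph.hasse_adj, h, h, or_comm, and_iff_right_iff_imp]
  rintro (hab | hba) rfl
  · exact hab.ne rfl
  · exact hba.ne rfl

theorem IsLaminar.ofParenthesization_adj {v w : Option (P ⊕ Fin n)} :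
    (ofParenthesization P).graph.Adj v w ↔
      (SimpleGraph.hasse (WithTop (nodes P))).Adj (toClusterTree v) (toClusterTree w) := by
  refine fromRel_adj_iff_hasse_adj fun v w => ?_
  rcases v with (_ | B | j) <;> rcases w with (_ | A | i)
  · exact iff_of_false id not_top_covBy
  · exact (WithTop.coe_covBy_top.trans (hP.isMax_iff (A := ⟨A.1, Or.inl A.2⟩))).symm
  · exact (WithTop.coe_covBy_top.trans hP.isMax_singleton_iff).symm
  · exact iff_of_false id not_top_covBy
  · exact (WithTop.coe_covBy_coe.trans
      (hP.covBy_iff (A := ⟨A.1, Or.inl A.2⟩) (B := ⟨B.1, Or.inl B.2⟩))).symm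
  · exact (WithTop.coe_covBy_coe.trans (hP.singleton_covBy_iff (A := ⟨B.1, Or.inl B.2⟩) B.2)).symm
  · exact iff_of_false id not_top_covBy
  · exact iff_of_false id fun h => hP.not_covBy_singleton (WithTop.coe_covBy_coe.1 h)
  · exact iff_of_false id fun h => hP.not_covBy_singleton (WithTop.coe_covBy_coe.1 h)

theorem IsLaminar.ofParenthesization_iso : (ofParenthesization P).Iso (clusterTree P) :=
  ⟨⟨Equiv.ofBijective _ hP.bijective_toClusterTree, hP.ofParenthesization_adj.symm⟩, rfl,
    fun _ => rfl⟩

omit hP in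
theorem addRoot_clusterTree_iso (huniv : Set.univ ∉ nodes P) :
    (clusterTree P).addRoot.Iso (clusterTree (insert Set.univ P)) := by
  let f (v : WithTop (nodes P)) : nodes (insert Set.univ P) :=
    v.recTopCoe ⟨Set.univ, Or.inl (Or.inl rfl)⟩ fun A => ⟨A.1, A.2.imp_left Or.inr⟩
  have le_iff (v w : WithTop (nodes P)) : f v ≤ f w ↔ v ≤ w := by
    induction w with
    | top => exact iff_of_true (Set.subset_univ _) le_top
    | coe B =>
      induction v with
      | top =>
        refine iff_of_false (fun h => huniv ?_) (WithTop.not_top_le_coe B)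
        exact Set.univ_subset_iff.1 (show Set.univ ⊆ B.1 from h) ▸ B.2
      | coe A => exact (WithTop.coe_le_coe (a := B) (b := A)).symm
  have surjective : Function.Surjective f := by
    rintro ⟨A, (rfl | hA) | hA⟩
    · exact ⟨⊤, rfl⟩
    · exact ⟨(⟨A, Or.inl hA⟩ : nodes P), rfl⟩
    · exact ⟨(⟨A, Or.inr hA⟩ : nodes P), rfl⟩
  have injective : Function.Injective f := fun v w (h : f v = f w) =>
    le_antisymm ((le_iff v w).1 h.le) ((le_iff w v).1 h.ge)
  let e : WithTop (nodes P) ≃o nodes (insert Set.univ P) :=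
    ⟨Equiv.ofBijective f ⟨injective, surjective⟩, fun {v w} => le_iff v w⟩
  exact (addRoot_ofOrder_iso _).trans (ofOrder_iso_of_orderIso e.withTopCongr fun _ => rfl)

theorem IsLaminar.insert_univ (hn : 2 ≤ n) : IsLaminar (insert Set.univ P) where
  nontrivial := by
    have := Fin.nontrivial_iff_two_le.2 hn
    rintro A (rfl | hA)
    · exact Set.nontrivial_univ
    · exact hP.nontrivial hA
  subset_or_subset := by
    rintro A B i (rfl | hA) (rfl | hB) hi hi'
    · exact Or.inl le_rfl
    · exact Or.inr (Set.subset_univ B)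
    · exact Or.inl (Set.subset_univ A)
    · exact hP.subset_or_subset hA hB hi hi'

omit hP in
theorem setOf_not_separated_eq {B : Set (Fin n)} {i j : Fin n} (hB : B ∈ P) (hi : i ∈ B)
    (hj : j ∈ B) (hmin : ∀ C ∈ P, i ∈ C → j ∈ C → B ⊆ C) :
    {k | ¬∃ C ∈ P, i ∈ C ∧ j ∈ C ∧ k ∉ C} = B := by
  ext k
  refine ⟨fun h => ?_, ?_⟩
  · by_contra hk
    exact h ⟨B, hB, hi, hj, hk⟩
  · rintro hk ⟨C, hC, hiC, hjC, hkC⟩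
    exact hkC (hmin C hC hiC hjC hk)

theorem IsLaminar.exists_le_of_joined {B : Set (Fin n)} {i j : Fin n} (hB : B ∈ P) (hi : i ∈ B)
    (hj : j ∈ B) :
    ∃ C ∈ P, i ∈ C ∧ j ∈ C ∧ ∀ D ∈ P, i ∈ D → j ∈ D → C ⊆ D := by
  obtain ⟨C, ⟨hC, hiC, hjC⟩, hmin⟩ :=
    (Set.toFinite {C | C ∈ P ∧ i ∈ C ∧ j ∈ C}).exists_minimal ⟨B, hB, hi, hj⟩
  exact ⟨C, hC, hiC, hjC, fun D hD hiD hjD =>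
    (hP.subset_or_subset hC hD hiC hiD).elim id (hmin ⟨hD, hiD, hjD⟩)⟩

theorem IsLaminar.exists_generators {A : Set (Fin n)} (hA : A ∈ P) :
    ∃ i ∈ A, ∃ j ∈ A, i ≠ j ∧ ∀ B ∈ P, i ∈ B → j ∈ B → A ⊆ B := by
  obtain ⟨i, hi⟩ := (hP.nontrivial hA).nonempty
  have hlt : {i} ⊂ A := (Set.singleton_subset_iff.2 hi).ssubset_of_ne fun h =>
    Set.not_nontrivial_singleton (h ▸ hP.nontrivial hA)
  obtain ⟨C, ⟨hC, hiC, hCA⟩, hmax⟩ :=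
    (Set.toFinite {C | C ∈ nodes P ∧ i ∈ C ∧ C ⊂ A}).exists_maximal
      ⟨{i}, Or.inr ⟨i, rfl⟩, rfl, hlt⟩
  obtain ⟨j, hjA, hjC⟩ := Set.exists_of_ssubset hCA
  refine ⟨i, hi, j, hjA, fun h => hjC (h ▸ hiC), fun B hB hiB hjB => ?_⟩
  refine (hP.subset_or_subset hA hB hi hiB).elim id fun hBA => ?_
  by_contra hAB
  have hBC : B ⊆ C := (hP.nodes_subset_or_subset (Or.inl hB) hC hiB hiC).elim id
    (hmax ⟨Or.inl hB, hiB, hBA, hAB⟩)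
  exact hjC (hBC hjB)

theorem IsLaminar.mem_iff {A : Set (Fin n)} :
    A ∈ P ↔ ∃ i j, i ≠ j ∧ (∃ B ∈ P, i ∈ B ∧ j ∈ B) ∧
      {k | ¬∃ B ∈ P, i ∈ B ∧ j ∈ B ∧ k ∉ B} = A := by
  constructor
  · intro hA
    obtain ⟨i, hi, j, hj, hij, hmin⟩ := hP.exists_generators hA
    exact ⟨i, j, hij, ⟨A, hA, hi, hj⟩, setOf_not_separated_eq hA hi hj hmin⟩
  · rintro ⟨i, j, -, ⟨B, hB, hi, hj⟩, rfl⟩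
    obtain ⟨C, hC, hiC, hjC, hmin⟩ := hP.exists_le_of_joined hB hi hj
    rwa [setOf_not_separated_eq hC hiC hjC hmin]

theorem IsLaminar.eq_iff {Q : Set (Set (Fin n))} (hQ : IsLaminar Q) :
    P = Q ↔
      (∀ i j k, i ≠ j →
        ((∃ B ∈ P, i ∈ B ∧ j ∈ B ∧ k ∉ B) ↔ ∃ B ∈ Q, i ∈ B ∧ j ∈ B ∧ k ∉ B)) ∧
      ∀ i j, i ≠ j → ((∃ B ∈ P, i ∈ B ∧ j ∈ B) ↔ ∃ B ∈ Q, i ∈ B ∧ j ∈ B) := by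
  refine ⟨?_, fun ⟨hsep, hjoin⟩ => ?_⟩
  · rintro rfl
    exact ⟨fun _ _ _ _ => Iff.rfl, fun _ _ _ => Iff.rfl⟩
  · ext A
    rw [hP.mem_iff, hQ.mem_iff]
    refine exists₂_congr fun i j => and_congr_right fun hij => ?_
    simp only [hsep i j _ hij, hjoin i j hij]

end Laminar

/-! ### Trees and their clusters -/

/-- The set of leaves that lie over a vertex. -/
def leafSet (T : RootedGraph n) (v : T.V) : Set (Fin n) := {i | T.LiesOver (T.leaf i) v}

/-- The sets of leaves over the internal vertices of a tree. They determine the tree. -/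
def clusters (T : RootedGraph n) : Set (Set (Fin n)) := T.leafSet '' {v | T.IsInternal v}

section Clusters

variable {T : RootedGraph n} (hT : T.IsFTree)
include hT

theorem leafSet_leaf (i : Fin n) : T.leafSet (T.leaf i) = {i} := by
  ext j
  rw [leafSet, Set.mem_ofPred_eq, liesOver_leaf_iff hT, hT.leaf_injective.eq_iff,
    Set.mem_singleton_iff]

theorem leafSet_nontrivial {v : T.V} (hv : T.IsInternal v) : (T.leafSet v).Nontrivial := by
  obtain ⟨c, c', hc, hc', hne⟩ := exists_children_of_isInternal hT hv
  obtain ⟨i, hi⟩ := exists_leaf_liesOver hT (hc.ne_root hT.isTree)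
  obtain ⟨j, hj⟩ := exists_leaf_liesOver hT (hc'.ne_root hT.isTree)
  exact ⟨i, hi.trans hT.isTree hc.2, j, hj.trans hT.isTree hc'.2,
    SplitsAt.leaf_ne hT.isTree ⟨hc, hc', hne, hi, hj⟩⟩

theorem isLaminar_clusters : IsLaminar T.clusters where
  nontrivial := by
    rintro _ ⟨v, hv, rfl⟩
    exact leafSet_nontrivial hT hv
  subset_or_subset := by
    rintro _ _ i ⟨v, -, rfl⟩ ⟨w, -, rfl⟩ hiv hiw
    refine (LiesOver.total hT.isTree hiv hiw).imp ?_ ?_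
    all_goals exact fun h j hj => LiesOver.trans hT.isTree hj h

theorem leafSet_mem_nodes {v : T.V} (hv : v ≠ T.root) : T.leafSet v ∈ nodes T.clusters := by
  by_cases hleaf : v ∈ Set.range T.leaf
  · obtain ⟨i, rfl⟩ := hleaf
    exact Or.inr ⟨i, (leafSet_leaf hT i).symm⟩
  · exact Or.inl ⟨v, ⟨hv, hleaf⟩, rfl⟩

theorem mem_clusters_iff {A : Set (Fin n)} {i j : Fin n} (hij : i ≠ j) (hi : i ∈ A) (hj : j ∈ A) :
    A ∈ T.clusters ↔ ∃ v ≠ T.root, T.leafSet v = A := by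
  refine ⟨fun ⟨v, hv, h⟩ => ⟨v, hv.1, h⟩, ?_⟩
  rintro ⟨v, hv, rfl⟩
  refine ⟨v, ⟨hv, ?_⟩, rfl⟩
  rintro ⟨k, rfl⟩
  rw [leafSet_leaf hT] at hi hj
  exact hij (hi.trans hj.symm)

theorem liesOver_iff_leafSet_subset {v w : T.V} (hv : v ≠ T.root) :
    T.LiesOver v w ↔ T.leafSet v ⊆ T.leafSet w := by
  refine ⟨fun h i hi => LiesOver.trans hT.isTree hi h, fun h => ?_⟩
  obtain ⟨i, hi⟩ := exists_leaf_liesOver hT hv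
  refine (hi.total hT.isTree (h hi)).elim id fun hwv => ?_
  by_cases hne : w = v
  · exact hne ▸ hwv
  obtain ⟨c, hc, hwc⟩ := exists_child_of_liesOver hT.isTree hwv hne
  have eq_c : ∀ {c'}, T.Child v c' → c' = c := fun {c'} hc' => by
    obtain ⟨j, hj⟩ := exists_leaf_liesOver hT (hc'.ne_root hT.isTree)
    exact hc'.eq_of_liesOver hT.isTree hc hj
      (LiesOver.trans hT.isTree (h (hj.trans hT.isTree hc'.2)) hwc)
  obtain ⟨c₁, c₂, hc₁, hc₂, hne⟩ := exists_children_of_isInternal hT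
    ((hc.root_or_isInternal hT).resolve_left hv)
  exact absurd ((eq_c hc₁).trans (eq_c hc₂).symm) hne

omit hT in
theorem iso_ofOrder {V : Type} [PartialOrder V] [OrderTop V] [Finite V] (hT : T.graph.IsTree)
    {e : T.V → V} (hsurj : Function.Surjective e) (he : ∀ v w, e v ≤ e w ↔ T.LiesOver v w)
    {leaf : Fin n → V} (hleaf : ∀ i, e (T.leaf i) = leaf i) : T.Iso (ofOrder leaf) := by
  let _ := vertexOrder hT
  let _ : OrderTop T.V := { top := T.root, le_top := liesOver_root hT }
  have hinj : Function.Injective e := fun v w h =>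
    LiesOver.antisymm hT ((he v w).1 h.le) ((he w v).1 h.ge)
  let e' : T.V ≃o V := ⟨Equiv.ofBijective e ⟨hinj, hsurj⟩, he _ _⟩
  have hadj (v w : T.V) : T.graph.Adj v w ↔ v ⋖ w ∨ w ⋖ v := by
    rw [← child_iff_covBy hT, ← child_iff_covBy hT]
    exact ⟨fun h => (child_or_child_of_adj hT h).symm, fun h => h.elim (·.1.symm) (·.1)⟩
  have hself : T.Iso (ofOrder T.leaf) :=
    ⟨⟨Equiv.refl T.V, (hadj _ _).symm⟩, rfl, fun _ => rfl⟩
  exact hself.trans (ofOrder_iso_of_orderIso e' hleaf)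

open Classical in
theorem iso_clusterTree_clusters : T.Iso (clusterTree T.clusters) := by
  let e (v : T.V) : WithTop (nodes T.clusters) :=
    if hv : v = T.root then ⊤ else (⟨T.leafSet v, leafSet_mem_nodes hT hv⟩ : nodes T.clusters)
  have e_root : e T.root = ⊤ := dif_pos rfl
  have e_of_ne {v : T.V} (hv : v ≠ T.root) :
      e v = (⟨T.leafSet v, leafSet_mem_nodes hT hv⟩ : nodes T.clusters) := dif_neg hv
  refine iso_ofOrder hT.isTree (e := e) (fun A => ?_) (fun v w => ?_) fun i => ?_
  · induction A with
    | top => exact ⟨T.root, e_root⟩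
    | coe A =>
      obtain ⟨_, ⟨v, hv, rfl⟩ | ⟨i, rfl⟩⟩ := A
      · exact ⟨v, e_of_ne hv.1⟩
      · refine ⟨T.leaf i, (e_of_ne (leaf_ne_root hT i)).trans ?_⟩
        simp only [leafSet_leaf hT]
  · by_cases hw : w = T.root
    · subst hw
      exact iff_of_true (e_root ▸ le_top) (liesOver_root hT.isTree v)
    by_cases hv : v = T.root
    · subst hv
      rw [e_root, e_of_ne hw, top_le_iff]
      exact iff_of_false WithTop.coe_ne_top fun h =>
        hw ((liesOver_root hT.isTree w).antisymm hT.isTree h)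
    · rw [e_of_ne hv, e_of_ne hw, WithTop.coe_le_coe, liesOver_iff_leafSet_subset hT hv]
      rfl
  · rw [e_of_ne (leaf_ne_root hT i)]
    simp only [leafSet_leaf hT]

theorem IsLaminar.eq_clusters_of_iso {P : Set (Set (Fin n))} (hP : IsLaminar P)
    (h : (clusterTree P).Iso T) : P = T.clusters := by
  obtain ⟨e, hroot, hleaf⟩ := h
  let e' : WithTop (nodes P) ≃ T.V := e.toEquiv
  have leafSet_e' (A : nodes P) : T.leafSet (e' A) = A.1 := by
    ext i
    let leaf_i : nodes P := ⟨{i}, Or.inr ⟨i, rfl⟩⟩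
    have h : T.LiesOver (e' leaf_i) (e' A) ↔ (leaf_i : WithTop (nodes P)) ≤ A :=
      liesOver_of_iso_ofOrder hT.isTree e hroot hP.le_or_le
    rw [show e' leaf_i = T.leaf i from hleaf i, WithTop.coe_le_coe] at h
    exact h.trans Set.singleton_subset_iff
  have e'_ne_root (A : nodes P) : e' A ≠ T.root := fun h =>
    WithTop.coe_ne_top (e'.injective (h.trans hroot.symm))
  ext A
  constructor
  · intro hA
    obtain ⟨i, hi, j, hj, hij⟩ := hP.nontrivial hA
    exact (mem_clusters_iff hT hij hi hj).2 ⟨_, e'_ne_root ⟨A, Or.inl hA⟩, leafSet_e' _⟩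
  · rintro ⟨v, hv, rfl⟩
    obtain ⟨B, rfl⟩ := e'.surjective v
    induction B with
    | top => exact absurd hroot hv.1
    | coe B =>
      obtain ⟨B, hB | ⟨i, rfl⟩⟩ := B
      · rwa [leafSet_e']
      · exact absurd ⟨i, (hleaf i).symm⟩ hv.2

theorem clusterTree_iso_iff {P : Set (Set (Fin n))} (hP : IsLaminar P) :
    (clusterTree P).Iso T ↔ P = T.clusters :=
  ⟨hP.eq_clusters_of_iso hT, fun h => h ▸ (iso_clusterTree_clusters hT).symm⟩

theorem exists_cluster_near_iff {i j k : Fin n} (hij : i ≠ j) :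
    (∃ A ∈ T.clusters, i ∈ A ∧ j ∈ A ∧ k ∉ A) ↔ T.Near i j k := by
  constructor
  · rintro ⟨_, ⟨v, -, rfl⟩, h⟩
    exact ⟨v, h⟩
  · rintro ⟨v, hi, hj, hk⟩
    have hv : v ≠ T.root := fun h => hk (h ▸ liesOver_root hT.isTree _)
    exact ⟨_, (mem_clusters_iff hT hij hi hj).2 ⟨v, hv, rfl⟩, hi, hj, hk⟩

theorem exists_cluster_mem_iff {i j : Fin n} (hij : i ≠ j) :
    (∃ A ∈ T.clusters, i ∈ A ∧ j ∈ A) ↔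
      ∃ v, v ≠ T.root ∧ i ∈ T.leafSet v ∧ j ∈ T.leafSet v := by
  constructor
  · rintro ⟨_, ⟨v, hv, rfl⟩, h⟩
    exact ⟨v, hv.1, h⟩
  · rintro ⟨v, hv, hi, hj⟩
    exact ⟨_, (mem_clusters_iff hT hij hi hj).2 ⟨v, hv, rfl⟩, hi, hj⟩

end Clusters

end RootedGraph

/-! ### The tree of an exclusion relation -/

/-- The properties of the relations `exclusionOf x`, with `R i j k` read as "the distance of `i`
and `j` is infinitely small compared with that of `i` and `k`". -/
structure IsExclusion {n : ℕ} (R : Fin n → Fin n → Fin n → Prop) : Prop where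
  ne : ∀ {i j k}, R i j k → i ≠ j ∧ i ≠ k ∧ j ≠ k
  symm : ∀ {i j k}, R i j k → R j i k
  left : ∀ {i j k l}, R i j k → R i l k → l ≠ j → R j l k
  trans : ∀ {i j k l}, R i j k → R i k l → R i j l
  of_not : ∀ {i j k l}, R i j k → ¬R i l k → l ≠ i → R i j l

namespace RootedGraph

variable {n : ℕ} {R : Fin n → Fin n → Fin n → Prop} (hR : IsExclusion R)
include hR

theorem parenthesization_subset_of_mem {a c k : Fin n} (hc : R a c k) :
    insert a {j | R a j k} ⊆ insert c {j | R c j k} := by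
  rintro j (rfl | hj)
  · exact Or.inr (hR.symm hc)
  · exact or_iff_not_imp_left.2 fun h => hR.left hc hj h

theorem exists_eq_insert_of_mem_parenthesization {A : Set (Fin n)} (hA : A ∈ parenthesization R)
    {c : Fin n} (hc : c ∈ A) : ∃ k, A = insert c {j | R c j k} := by
  obtain ⟨a, k, -, rfl⟩ := hA
  rcases hc with rfl | hc
  · exact ⟨k, rfl⟩
  · exact ⟨k, (parenthesization_subset_of_mem hR hc).antisymm
      (parenthesization_subset_of_mem hR (hR.symm hc))⟩

theorem insert_subset_insert_or {c k l : Fin n} :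
    insert c {j | R c j k} ⊆ insert c {j | R c j l} ∨
      insert c {j | R c j l} ⊆ insert c {j | R c j k} := by
  by_cases h : ∀ j, R c j k → R c j l
  · exact Or.inl (Set.insert_subset_insert h)
  · push Not at h
    obtain ⟨j, hjk, hjl⟩ := h
    refine Or.inr (Set.insert_subset_insert fun i hi => ?_)
    exact hR.trans (hR.of_not hi hjl (hR.ne hjk).1.symm) hjk

theorem isLaminar_parenthesization : IsLaminar (parenthesization R) where
  nontrivial := by
    rintro _ ⟨i, k, ⟨j, hj⟩, rfl⟩
    exact ⟨i, Or.inl rfl, j, Or.inr hj, (hR.ne hj).1⟩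
  subset_or_subset := by
    intro A B c hA hB hcA hcB
    obtain ⟨k, rfl⟩ := exists_eq_insert_of_mem_parenthesization hR hA hcA
    obtain ⟨l, rfl⟩ := exists_eq_insert_of_mem_parenthesization hR hB hcB
    exact insert_subset_insert_or hR

theorem univ_notMem_parenthesization : Set.univ ∉ parenthesization R := by
  rintro ⟨i, k, ⟨j, hj⟩, h⟩
  rcases h ▸ Set.mem_univ k with hk | hk
  · exact (hR.ne hj).2.1 hk.symm
  · exact (hR.ne hk).2.2 rfl

theorem exclusion_iff_exists {i j k : Fin n} (hij : i ≠ j) :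
    R i j k ↔ ∃ A ∈ parenthesization R, i ∈ A ∧ j ∈ A ∧ k ∉ A := by
  constructor
  · intro h
    refine ⟨_, ⟨i, k, ⟨j, h⟩, rfl⟩, Or.inl rfl, Or.inr h, ?_⟩
    rintro (hk | hk)
    · exact (hR.ne h).2.1 hk.symm
    · exact (hR.ne hk).2.2 rfl
  · rintro ⟨A, hA, hi, hj, hk⟩
    obtain ⟨l, rfl⟩ := exists_eq_insert_of_mem_parenthesization hR hA hi
    have hjl : R i j l := hj.resolve_left hij.symm
    exact hR.of_not hjl (fun h => hk (Or.inr h)) fun h => hk (Or.inl h)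

end RootedGraph

section TreeOf

open RootedGraph

variable {m n : ℕ} {M : Set (Euc m)} {x : CompactAmbient n M}

open Classical in
/-- The clusters of the tree `T(x)`: the members of the parenthesization, together with the set of
all indices if the (at least two) points `x_i` coincide. -/
def clustersOf (x : CompactAmbient n M) : Set (Set (Fin n)) :=
  if 2 ≤ n ∧ ∀ i j, x.1 i = x.1 j then insert Set.univ (parenthesization (exclusionOf x))
  else parenthesization (exclusionOf x)

theorem mem_clustersOf {A : Set (Fin n)} :
    A ∈ clustersOf x ↔ A ∈ parenthesization (exclusionOf x) ∨
      A = Set.univ ∧ 2 ≤ n ∧ ∀ i j, x.1 i = x.1 j := by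
  unfold clustersOf
  split_ifs with h
  · rw [and_iff_left h, Set.mem_insert_iff, or_comm]
  · rw [or_iff_left fun h' => h h'.2]

variable (hR : IsExclusion (exclusionOf x))
include hR

theorem isLaminar_clustersOf : IsLaminar (clustersOf x) := by
  unfold clustersOf
  split_ifs with h
  · exact (isLaminar_parenthesization hR).insert_univ h.1
  · exact isLaminar_parenthesization hR

theorem treeOf_iso_clusterTree : (treeOf x).Iso (clusterTree (clustersOf x)) := by
  have hlam := isLaminar_parenthesization hR
  unfold treeOf clustersOf
  split_ifs with h
  · have huniv : Set.univ ∉ nodes (parenthesization (exclusionOf x)) := by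
      have := Fin.nontrivial_iff_two_le.2 h.1
      rintro (h | ⟨i, hi⟩)
      · exact univ_notMem_parenthesization hR h
      · exact Set.not_nontrivial_singleton (hi ▸ Set.nontrivial_univ)
    exact hlam.ofParenthesization_iso.addRoot.trans (addRoot_clusterTree_iso huniv)
  · exact hlam.ofParenthesization_iso

theorem exclusionOf_iff_exists {i j k : Fin n} (hij : i ≠ j) :
    exclusionOf x i j k ↔ ∃ A ∈ clustersOf x, i ∈ A ∧ j ∈ A ∧ k ∉ A := by
  rw [exclusion_iff_exists hR hij]
  refine exists_congr fun A => and_congr_left fun h => ?_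
  rw [mem_clustersOf, or_iff_left]
  rintro ⟨rfl, -⟩
  exact h.2.2 (Set.mem_univ k)

theorem point_eq_iff_exists
    (hx : ∀ i j k, x.1 i ≠ x.1 k → x.1 i = x.1 j → i ≠ j → exclusionOf x i j k)
    (hx' : ∀ i j k, exclusionOf x i j k → x.1 i = x.1 j) {i j : Fin n} (hij : i ≠ j) :
    x.1 i = x.1 j ↔ ∃ A ∈ clustersOf x, i ∈ A ∧ j ∈ A := by
  constructor
  · intro h
    by_cases hall : ∀ k, x.1 i = x.1 k
    · have hn : 2 ≤ n := Fin.nontrivial_iff_two_le.1 ⟨i, j, hij⟩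
      exact ⟨Set.univ, mem_clustersOf.2 (Or.inr ⟨rfl, hn, fun k l => (hall k).symm.trans (hall l)⟩),
        Set.mem_univ i, Set.mem_univ j⟩
    · push Not at hall
      obtain ⟨k, hk⟩ := hall
      obtain ⟨A, hA, hi, hj, -⟩ := (exclusionOf_iff_exists hR hij).1 (hx i j k hk h hij)
      exact ⟨A, hA, hi, hj⟩
  · rintro ⟨A, hA, hi, hj⟩
    rcases mem_clustersOf.1 hA with hA | ⟨-, -, h⟩
    · obtain ⟨k, rfl⟩ := exists_eq_insert_of_mem_parenthesization hR hA hi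
      exact hx' i j k (hj.resolve_left hij.symm)
    · exact h i j

theorem treeOf_iso_iff {T : RootedGraph n} (hT : T.IsFTree)
    (hx : ∀ i j k, x.1 i ≠ x.1 k → x.1 i = x.1 j → i ≠ j → exclusionOf x i j k)
    (hx' : ∀ i j k, exclusionOf x i j k → x.1 i = x.1 j) :
    (treeOf x).Iso T ↔
      (∀ i j k, exclusionOf x i j k ↔ (i ≠ j ∧ i ≠ k ∧ j ≠ k) ∧ T.Near i j k) ∧
      ∀ i j, i ≠ j →
        (x.1 i = x.1 j ↔ ∃ v, v ≠ T.root ∧ i ∈ T.leafSet v ∧ j ∈ T.leafSet v) := by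
  have hiso : (treeOf x).Iso T ↔ (clusterTree (clustersOf x)).Iso T :=
    ⟨(treeOf_iso_clusterTree hR).symm.trans, (treeOf_iso_clusterTree hR).trans⟩
  rw [hiso, clusterTree_iso_iff hT (isLaminar_clustersOf hR),
    (isLaminar_clustersOf hR).eq_iff (isLaminar_clusters hT)]
  refine and_congr (forall₃_congr fun i j k => ?_) (forall₂_congr fun i j =>
    forall_congr' fun hij => ?_)
  · rcases eq_or_ne i j with rfl | hij
    · exact iff_of_true (fun h => absurd rfl h)
        (iff_of_false (fun h => (hR.ne h).1 rfl) fun h => h.1.1 rfl)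
    rw [forall_prop_of_true hij, ← exclusionOf_iff_exists hR hij, exists_cluster_near_iff hT hij,
      and_iff_right_of_imp]
    rintro ⟨v, hi, hj, hk⟩
    exact ⟨hij, fun h => hk (h ▸ hi), fun h => hk (h ▸ hj)⟩
  · rw [point_eq_iff_exists hR hx hx' hij, exists_cluster_mem_iff hT hij]

end TreeOf

/-! ### Charts and tangent vectors of submanifolds -/

theorem tendsto_smul_sub_of_hasStrictFDerivAt {E F α : Type*} [NormedAddCommGroup E]
    [NormedSpace ℝ E] [NormedAddCommGroup F] [NormedSpace ℝ F] {f : E → F} {f' : E →L[ℝ] F} {a : E}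
    (hf : HasStrictFDerivAt f f' a) {l : Filter α} {u v : α → E} {r : α → ℝ} {w : E}
    (hu : Tendsto u l (𝓝 a)) (hv : Tendsto v l (𝓝 a))
    (hw : Tendsto (fun t => r t • (u t - v t)) l (𝓝 w)) :
    Tendsto (fun t => r t • (f (u t) - f (v t))) l (𝓝 (f' w)) := by
  have remainder : (fun t => r t • (f (u t) - f (v t) - f' (u t - v t))) =o[l] fun _ => (1 : ℝ) :=
    ((Asymptotics.isBigO_refl r l).smul_isLittleO
      (hf.isLittleO.comp_tendsto (hu.prodMk_nhds hv))).trans_isBigO (hw.isBigO_one ℝ)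
  have sum_tendsto :=
    ((Asymptotics.isLittleO_one_iff ℝ).1 remainder).add ((f'.continuous.tendsto w).comp hw)
  rw [zero_add] at sum_tendsto
  refine sum_tendsto.congr fun t => ?_
  simp only [Function.comp_apply, map_smul, ← smul_add, sub_add_cancel]

section Manifold

variable {m d : ℕ} {M : Set (Euc m)}

/-- `φ` is a chart of `ℝ^m` that carries `M` to `{y ∈ L | 0 ≤ ℓ y}`, as in the definition of
`IsSmoothSubmanifold`. -/
structure IsSubmanifoldChart (M : Set (Euc m)) (φ : OpenPartialHomeomorph (Euc m) (Euc m))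
    (L : Submodule ℝ (Euc m)) (ℓ : Euc m →ₗ[ℝ] ℝ) : Prop where
  contDiffOn : ContDiffOn ℝ ∞ φ φ.source
  contDiffOn_symm : ContDiffOn ℝ ∞ φ.symm φ.target
  mem_iff : ∀ y ∈ φ.source, y ∈ M ↔ φ y ∈ L ∧ 0 ≤ ℓ (φ y)

theorem IsSmoothSubmanifold.exists_chart (hM : IsSmoothSubmanifold d M) {x : Euc m} (hx : x ∈ M) :
    ∃ (φ : OpenPartialHomeomorph (Euc m) (Euc m)) (L : Submodule ℝ (Euc m)) (ℓ : Euc m →ₗ[ℝ] ℝ),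
      IsSubmanifoldChart M φ L ℓ ∧ x ∈ φ.source := by
  obtain ⟨φ, L, ℓ, hx, hφ, hφ', -, mem_iff⟩ := hM x hx
  exact ⟨φ, L, ℓ, ⟨hφ, hφ', mem_iff⟩, hx⟩

namespace IsSubmanifoldChart

variable {φ : OpenPartialHomeomorph (Euc m) (Euc m)} {L : Submodule ℝ (Euc m)}
  {ℓ : Euc m →ₗ[ℝ] ℝ} (hφ : IsSubmanifoldChart M φ L ℓ) {x : Euc m} (hx : x ∈ φ.source)
include hφ hx

theorem hasStrictFDerivAt : HasStrictFDerivAt φ (fderiv ℝ φ x) x :=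
  (hφ.contDiffOn.contDiffAt (φ.open_source.mem_nhds hx)).hasStrictFDerivAt (by simp)

theorem hasStrictFDerivAt_symm : HasStrictFDerivAt φ.symm (fderiv ℝ φ.symm (φ x)) (φ x) :=
  (hφ.contDiffOn_symm.contDiffAt
    (φ.open_target.mem_nhds (φ.map_source hx))).hasStrictFDerivAt (by simp)

theorem fderiv_symm_fderiv (w : Euc m) : fderiv ℝ φ.symm (φ x) (fderiv ℝ φ x w) = w := by
  have deriv_comp :=
    (hφ.hasStrictFDerivAt_symm hx).hasFDerivAt.comp x (hφ.hasStrictFDerivAt hx).hasFDerivAt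
  have deriv_id := (hasFDerivAt_id (𝕜 := ℝ) x).congr_of_eventuallyEq (φ.eventually_left_inverse hx)
  exact DFunLike.congr_fun (deriv_comp.unique deriv_id) w

theorem fderiv_fderiv_symm (w : Euc m) : fderiv ℝ φ x (fderiv ℝ φ.symm (φ x) w) = w := by
  have hφx : HasFDerivAt φ (fderiv ℝ φ x) (φ.symm (φ x)) := by
    rw [φ.left_inv hx]
    exact (hφ.hasStrictFDerivAt hx).hasFDerivAt
  have deriv_comp := hφx.comp (φ x) (hφ.hasStrictFDerivAt_symm hx).hasFDerivAt
  have deriv_id := (hasFDerivAt_id (𝕜 := ℝ) (φ x)).congr_of_eventuallyEq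
    (φ.eventually_right_inverse (φ.map_source hx))
  exact DFunLike.congr_fun (deriv_comp.unique deriv_id) w

theorem fderiv_mem_of_secant {α : Type*} {l : Filter α} {u v : α → Euc m} {r : α → ℝ}
    {w : Euc m} (hu : Tendsto u l (𝓝 x)) (hv : Tendsto v l (𝓝 x))
    (hM : ∃ᶠ t in l, u t ∈ M ∧ v t ∈ M) (hw : Tendsto (fun t => r t • (u t - v t)) l (𝓝 w)) :
    fderiv ℝ φ x w ∈ L := by
  have hs := φ.open_source.mem_nhds hx
  refine L.closed_of_finiteDimensional.mem_of_frequently_of_tendsto ?_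
    (tendsto_smul_sub_of_hasStrictFDerivAt (hφ.hasStrictFDerivAt hx) hu hv hw)
  refine (hM.and_eventually ((hu.eventually hs).and (hv.eventually hs))).mono ?_
  rintro t ⟨⟨huM, hvM⟩, hus, hvs⟩
  exact L.smul_mem _ (L.sub_mem ((hφ.mem_iff _ hus).1 huM).1 ((hφ.mem_iff _ hvs).1 hvM).1)

theorem fderiv_mem_of_mem_tangentSpaceAt (hxM : x ∈ M) {w : Euc m} (hw : w ∈ tangentSpaceAt M x) :
    fderiv ℝ φ x w ∈ L := by
  suffices tangentSpaceAt M x ≤ L.comap (fderiv ℝ φ x).toLinearMap from this hw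
  refine Submodule.span_le.2 fun w hw => ?_
  obtain ⟨α, l, _, c, δ, hδ, hmem, hlim⟩ := exists_fun_of_mem_tangentConeAt hw
  refine hφ.fderiv_mem_of_secant hx (u := fun t => x + δ t) (v := fun _ => x) (r := c)
    ?_ tendsto_const_nhds (hmem.frequently.mono fun t ht => ⟨ht, hxM⟩) ?_
  · simpa using tendsto_const_nhds.add hδ
  · simpa using hlim

theorem mem_tangentConeAt_of_fderiv_mem (hxM : x ∈ M) {w : Euc m} (hw : fderiv ℝ φ x w ∈ L)
    (hℓ : 0 ≤ ℓ (fderiv ℝ φ x w)) : w ∈ tangentConeAt ℝ M x := by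
  have hxL := (hφ.mem_iff x hx).1 hxM
  let γ : ℝ → Euc m := fun t => φ x + t • fderiv ℝ φ x w
  have hγ : Tendsto γ (𝓝[>] 0) (𝓝 (φ x)) := by
    have : Continuous γ := by fun_prop
    simpa [γ] using (this.continuousWithinAt (s := Set.Ioi 0) (x := 0)).tendsto
  have hψ := hφ.hasStrictFDerivAt_symm hx
  have curve_tendsto : Tendsto (fun t => φ.symm (γ t) - x) (𝓝[>] 0) (𝓝 0) := by
    simpa [φ.left_inv hx] using (hψ.continuousAt.tendsto.comp hγ).sub_const x
  have slope_eq : ∀ᶠ t : ℝ in 𝓝[>] 0, fderiv ℝ φ x w = t⁻¹ • (γ t - φ x) := by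
    filter_upwards [self_mem_nhdsWithin] with t (ht : 0 < t)
    simp [γ, smul_smul, ht.ne']
  have slope_tendsto := tendsto_smul_sub_of_hasStrictFDerivAt hψ (r := fun t => t⁻¹)
    hγ (tendsto_const_nhds (x := φ x)) (tendsto_const_nhds.congr' slope_eq)
  rw [hφ.fderiv_symm_fderiv hx, φ.left_inv hx] at slope_tendsto
  refine mem_tangentConeAt_of_seq (𝓝[>] (0 : ℝ)) (fun t => t⁻¹) _ curve_tendsto ?_ slope_tendsto
  filter_upwards [hγ.eventually (φ.open_target.mem_nhds (φ.map_source hx)), self_mem_nhdsWithin]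
    with t ht (htpos : 0 < t)
  rw [add_sub_cancel, hφ.mem_iff _ (φ.map_target ht), φ.right_inv ht]
  refine ⟨L.add_mem hxL.1 (L.smul_mem _ hw), ?_⟩
  simp only [γ, map_add, map_smul, smul_eq_mul]
  exact add_nonneg hxL.2 (mul_nonneg htpos.le hℓ)

theorem mem_tangentSpaceAt_iff (hxM : x ∈ M) {w : Euc m} :
    w ∈ tangentSpaceAt M x ↔ fderiv ℝ φ x w ∈ L := by
  refine ⟨hφ.fderiv_mem_of_mem_tangentSpaceAt hx hxM, fun hw => ?_⟩
  rcases le_total 0 (ℓ (fderiv ℝ φ x w)) with h | h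
  · exact Submodule.subset_span (hφ.mem_tangentConeAt_of_fderiv_mem hx hxM hw h)
  · refine neg_mem_iff.1 (Submodule.subset_span
      (hφ.mem_tangentConeAt_of_fderiv_mem hx hxM (w := -w) ?_ ?_))
    · simpa using hw
    · simpa using h

end IsSubmanifoldChart

namespace IsSmoothSubmanifold

variable (hM : IsSmoothSubmanifold d M) {x : Euc m} (hx : x ∈ M)
include hM hx

theorem mem_tangentSpaceAt_of_secant {α : Type*} {l : Filter α} [l.NeBot] {u v : α → Euc m}
    {r : α → ℝ} {w : Euc m} (hu : Tendsto u l (𝓝 x)) (hv : Tendsto v l (𝓝 x))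
    (huM : ∀ t, u t ∈ M) (hvM : ∀ t, v t ∈ M)
    (hw : Tendsto (fun t => r t • (u t - v t)) l (𝓝 w)) : w ∈ tangentSpaceAt M x := by
  obtain ⟨φ, L, ℓ, hφ, hxs⟩ := hM.exists_chart hx
  exact (hφ.mem_tangentSpaceAt_iff hxs hx).2 (hφ.fderiv_mem_of_secant hxs hu hv
    (Frequently.of_forall fun t => ⟨huM t, hvM t⟩) hw)

theorem exists_tangent_extension {w : Euc m} (hw : w ∈ tangentSpaceAt M x) :
    ∃ W : Euc m → Euc m, ContinuousAt W x ∧ W x = w ∧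
      ∀ᶠ y in 𝓝 x, y ∈ M → W y ∈ tangentSpaceAt M y := by
  obtain ⟨φ, L, ℓ, hφ, hxs⟩ := hM.exists_chart hx
  refine ⟨fun y => fderiv ℝ φ.symm (φ y) (fderiv ℝ φ x w), ?_, hφ.fderiv_symm_fderiv hxs w, ?_⟩
  · have continuousAt_fderiv_symm : ContinuousAt (fderiv ℝ φ.symm) (φ x) :=
      (hφ.contDiffOn_symm.continuousOn_fderiv_of_isOpen φ.open_target (by simp)).continuousAt
        (φ.open_target.mem_nhds (φ.map_source hxs))
    exact (ContinuousAt.comp (f := φ) continuousAt_fderiv_symm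
      (φ.continuousAt hxs)).clm_apply continuousAt_const
  · filter_upwards [φ.open_source.mem_nhds hxs] with y hy hyM
    rw [hφ.mem_tangentSpaceAt_iff hy hyM, hφ.fderiv_fderiv_symm hy]
    exact (hφ.mem_tangentSpaceAt_iff hxs hx).1 hw

end IsSmoothSubmanifold

theorem exists_eventually_nonneg_add_smul {E : Type*} [NormedAddCommGroup E] [NormedSpace ℝ E]
    [FiniteDimensional ℝ E] (L : Submodule ℝ E) (ℓ : E →ₗ[ℝ] ℝ) :
    ∃ N ∈ L, ∀ τ : ℝ → E, (∀ ε, τ ε ∈ L) → (τ =o[𝓝[>] 0] fun ε : ℝ => ε) →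
      ∀ᶠ ε in 𝓝[>] (0 : ℝ), 0 ≤ ℓ (ε • N + τ ε) := by
  by_cases hℓL : ∀ v ∈ L, ℓ v = 0
  · refine ⟨0, L.zero_mem, fun τ hτ _ => Eventually.of_forall fun ε => ?_⟩
    rw [smul_zero, zero_add, hℓL _ (hτ ε)]
  · push Not at hℓL
    obtain ⟨v, hv, hne⟩ := hℓL
    refine ⟨(ℓ v)⁻¹ • v, L.smul_mem _ hv, fun τ _ ho => ?_⟩
    have ho' : (fun ε => ℓ (τ ε)) =o[𝓝[>] 0] fun ε : ℝ => ε :=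
      ((LinearMap.toContinuousLinearMap ℓ).isBigO_comp _ _).trans_isLittleO ho
    filter_upwards [ho'.bound one_pos, self_mem_nhdsWithin] with ε hε (hεpos : 0 < ε)
    rw [one_mul, Real.norm_eq_abs, Real.norm_eq_abs, abs_of_pos hεpos] at hε
    simp only [map_add, map_smul, smul_eq_mul, inv_mul_cancel₀ hne, mul_one]
    linarith [neg_le_of_abs_le hε]

/-- Near a boundary point the displacements `σ i` themselves may leave the half-space; pushing all
of them inwards by the same vector `ε • N`, which dominates `σ i ε`, does not change their
differences. -/
theorem IsSmoothSubmanifold.exists_curves (hM : IsSmoothSubmanifold d M) {x : Euc m} (hx : x ∈ M)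
    {ι : Type*} (σ : ι → ℝ → Euc m) (hσ : ∀ i ε, σ i ε ∈ tangentSpaceAt M x)
    (ho : ∀ i, σ i =o[𝓝[>] 0] fun ε : ℝ => ε) :
    ∃ y : ι → ℝ → Euc m, (∀ i, ∀ᶠ ε in 𝓝[>] 0, y i ε ∈ M) ∧
      (∀ i, Tendsto (y i) (𝓝[>] 0) (𝓝 x)) ∧
      ∀ (i j : ι) (r : ℝ → ℝ) (w : Euc m),
        Tendsto (fun ε => r ε • (σ i ε - σ j ε)) (𝓝[>] 0) (𝓝 w) →
        Tendsto (fun ε => r ε • (y i ε - y j ε)) (𝓝[>] 0) (𝓝 w) := by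
  obtain ⟨φ, L, ℓ, hφ, hxs⟩ := hM.exists_chart hx
  have hxL := (hφ.mem_iff x hxs).1 hx
  obtain ⟨N, hNL, hN⟩ := exists_eventually_nonneg_add_smul L ℓ
  let B := fderiv ℝ φ x
  have hB i ε : B (σ i ε) ∈ L := (hφ.mem_tangentSpaceAt_iff hxs hx).1 (hσ i ε)
  have hBo i : (fun ε => B (σ i ε)) =o[𝓝[>] 0] fun ε : ℝ => ε :=
    (B.isBigO_comp _ _).trans_isLittleO (ho i)
  let z : ι → ℝ → Euc m := fun i ε => φ x + (ε • N + B (σ i ε))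
  have hz i : Tendsto (z i) (𝓝[>] 0) (𝓝 (φ x)) := by
    have hid : Tendsto (fun ε : ℝ => ε) (𝓝[>] 0) (𝓝 0) := tendsto_id.mono_left nhdsWithin_le_nhds
    simpa using ((hid.smul_const N).add ((hBo i).trans_tendsto hid)).const_add (φ x)
  have hψ := hφ.hasStrictFDerivAt_symm hxs
  refine ⟨fun i ε => φ.symm (z i ε), fun i => ?_, fun i => ?_, fun i j r w h => ?_⟩
  · filter_upwards [hN _ (hB i) (hBo i),
      (hz i).eventually (φ.open_target.mem_nhds (φ.map_source hxs))] with ε hpos hε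
    rw [hφ.mem_iff _ (φ.map_target hε), φ.right_inv hε, map_add]
    exact ⟨L.add_mem hxL.1 (L.add_mem (L.smul_mem _ hNL) (hB i ε)), add_nonneg hxL.2 hpos⟩
  · simpa [Function.comp_def, φ.left_inv hxs] using hψ.continuousAt.tendsto.comp (hz i)
  · have hBw : Tendsto (fun ε => r ε • (z i ε - z j ε)) (𝓝[>] 0) (𝓝 (B w)) :=
      ((B.continuous.tendsto w).comp h).congr fun ε => by simp [z]
    simpa [B, hφ.fderiv_symm_fderiv hxs] using
      tendsto_smul_sub_of_hasStrictFDerivAt hψ (hz i) (hz j) hBw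

end Manifold

theorem isOpenMap_confSetoid_mk (m : ℕ) (I : Type) : IsOpenMap (Quotient.mk (confSetoid m I)) := by
  intro U hU
  refine isOpen_coinduced.2 (isOpen_iff_mem_nhds.2 ?_)
  rintro q ⟨p, hp, hpq⟩
  obtain ⟨s, hs, w, hpw⟩ := (confSetoid m I).symm (Quotient.exact hpq)
  let f : Conf I (Euc m) → Conf I (Euc m) := fun q => ⟨fun i => s • q.1 i + w, fun i j h =>
    q.2 (smul_right_injective _ hs.ne' (add_right_cancel h))⟩
  have hf : Continuous f := Continuous.subtype_mk (continuous_pi fun i =>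
    (((continuous_apply i).comp continuous_subtype_val).const_smul s).add_const w) _
  have hfq : f q = p := Subtype.ext (funext fun i => (hpw i).symm)
  filter_upwards [hf.continuousAt.preimage_mem_nhds (hU.mem_nhds (hfq ▸ hp))] with q' hq'
  exact ⟨f q', hq', Quotient.sound ((confSetoid m I).symm ⟨s, hs, w, fun i => rfl⟩)⟩

instance (m : ℕ) (I : Type) [Finite I] : SmoothParam.HasParamTopology (ConfModSim m I) :=
  SmoothParam.hasParamTopology_quotient _ (isOpenMap_confSetoid_mk m I)

namespace IsSmoothSubmanifold

variable {m d : ℕ} {M : Set (Euc m)} (hM : IsSmoothSubmanifold d M)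
include hM

theorem isOpenMap_tangentConfSetoid_mk (I : Type) :
    IsOpenMap (Quotient.mk (tangentConfSetoid M I)) := by
  intro U hU
  refine isOpen_coinduced.2 (isOpen_iff_mem_nhds.2 ?_)
  rintro q ⟨p, hp, hpq⟩
  obtain ⟨hbase, s, hs, w, hw, hpw⟩ := (tangentConfSetoid M I).symm (Quotient.exact hpq)
  obtain ⟨W, hW, hWw, hWT⟩ := hM.exists_tangent_extension q.1.1.2 hw
  obtain ⟨U', hU', rfl⟩ := isOpen_induced_iff.1 hU
  have base_tendsto : Tendsto (fun q : TangentConf M I => (q.1.1 : Euc m)) (𝓝 q) (𝓝 q.1.1) :=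
    (by fun_prop : Continuous fun q : TangentConf M I => (q.1.1 : Euc m)).continuousAt
  let f : TangentConf M I → M × (I → Euc m) := fun q => (q.1.1, fun i => s • q.1.2 i + W q.1.1)
  have hf : Tendsto f (𝓝 q) (𝓝 (f q)) := by
    refine Tendsto.prodMk_nhds ?_ (tendsto_pi_nhds.2 fun i => ?_)
    · exact (by fun_prop : Continuous fun q : TangentConf M I => q.1.1).continuousAt
    · have smul_continuous : Continuous fun q : TangentConf M I => s • q.1.2 i := by fun_prop
      exact smul_continuous.continuousAt.add (hW.tendsto.comp base_tendsto)
  have hfq : f q = p.1 := by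
    refine Prod.ext hbase (funext fun i => ?_)
    simp only [f, hWw, hpw]
  filter_upwards [hf.eventually (hU'.mem_nhds (hfq ▸ hp : f q ∈ U')), base_tendsto.eventually hWT]
    with q' hq' hWq'
  have hT := hWq' q'.1.1.2
  refine ⟨⟨f q', fun i j h => q'.2.1 (smul_right_injective _ hs.ne' (add_right_cancel h)),
    fun i => Submodule.add_mem _ (Submodule.smul_mem _ _ (q'.2.2 i)) hT⟩, hq', ?_⟩
  exact Quotient.sound ((tangentConfSetoid M I).symm ⟨rfl, s, hs, _, hT, fun i => rfl⟩)

theorem hasParamTopology_infConf (I : Type) [Finite I] :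
    SmoothParam.HasParamTopology (InfConf M I) :=
  SmoothParam.hasParamTopology_quotient _ (hM.isOpenMap_tangentConfSetoid_mk I)

theorem hasParamTopology_infStratum {n : ℕ} (T : RootedGraph n) :
    SmoothParam.HasParamTopology (InfStratum T M) := by
  have := fun I [Finite I] => hM.hasParamTopology_infConf I
  infer_instance

end IsSmoothSubmanifold

/-! ### Infinitesimal configurations in Euclidean space -/

namespace RootedGraph

variable {n : ℕ} {T : RootedGraph n}

theorem exists_rootEdge (hT : T.graph.IsTree) {v : T.V} (hv : v ≠ T.root) :
    ∃ e : T.EdgesAt T.root, T.LiesOver v e.1 := by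
  obtain ⟨c, hc, hvc⟩ := exists_child_of_liesOver hT (liesOver_root hT v) hv
  exact ⟨⟨c, hc⟩, hvc⟩

/-- The root edge over which a vertex other than the root lies. -/
noncomputable def rootEdge (hT : T.graph.IsTree) (v : T.V) (hv : v ≠ T.root) : T.EdgesAt T.root :=
  (exists_rootEdge hT hv).choose

theorem liesOver_rootEdge (hT : T.graph.IsTree) {v : T.V} (hv : v ≠ T.root) :
    T.LiesOver v (rootEdge hT v hv).1 :=
  (exists_rootEdge hT hv).choose_spec

theorem rootEdge_eq (hT : T.graph.IsTree) {v : T.V} (hv : v ≠ T.root) {e : T.EdgesAt T.root}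
    (h : T.LiesOver v e.1) : rootEdge hT v hv = e :=
  Subtype.ext (Child.eq_of_liesOver hT (rootEdge hT v hv).2 e.2 (liesOver_rootEdge hT hv) h)

/-- An internal vertex, as a vertex over its root edge. -/
noncomputable def Internal.over (hT : T.graph.IsTree) (v : T.Internal) :
    T.InternalOver (rootEdge hT v.1 v.2.1) :=
  ⟨v.1, v.2, liesOver_rootEdge hT v.2.1⟩

end RootedGraph

section Euclidean

open RootedGraph SmoothParam

variable {m n : ℕ} {T : RootedGraph n}

/-- The parameters of `D_T(M)`: a point for each root edge, and for each internal vertex a point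
and a family of vectors. -/
abbrev InfData (T : RootedGraph n) (m : ℕ) : Type :=
  ∀ e : T.EdgesAt T.root, Euc m × ∀ v : T.InternalOver e, Euc m × (T.EdgesAt v.1 → Euc m)

theorem contDiff_infData_base {M : Set (Euc m)} (e : T.EdgesAt T.root) :
    @ContDiff ℝ _ (Param (InfStratum T M)) _ _ (Euc m) _ _ ∞ fun b : InfData T m => (b e).1 :=
  (contDiff_param_fst (X := M) (Y := ∀ v : T.InternalOver e, InfConf M (T.EdgesAt v.1))).comp
    (contDiff_param_apply (Z := fun e => InfConfOver T M e) e)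

theorem contDiff_infData_vec {M : Set (Euc m)} (e : T.EdgesAt T.root) (v : T.InternalOver e)
    (c : T.EdgesAt v.1) : @ContDiff ℝ _ (Param (InfStratum T M)) _ _ (Euc m) _ _ ∞
      fun b : InfData T m => ((b e).2 v).2 c :=
  (contDiff_param_apply (Z := fun _ : T.EdgesAt v.1 => Euc m) c).comp
    ((contDiff_param_snd (X := M) (Y := T.EdgesAt v.1 → Euc m)).comp
      ((contDiff_param_apply (Z := fun v : T.InternalOver e => InfConf M (T.EdgesAt v.1)) v).comp
        ((contDiff_param_snd (X := M) (Y := ∀ v : T.InternalOver e, InfConf M (T.EdgesAt v.1))).comp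
          (contDiff_param_apply (Z := fun e => InfConfOver T M e) e))))

theorem tangentSpaceAt_univ (x : Euc m) : tangentSpaceAt (Set.univ : Set (Euc m)) x = ⊤ := by
  rw [tangentSpaceAt, tangentConeAt_univ, Submodule.span_univ]

theorem mem_tangentSpaceAt_univ (x w : Euc m) :
    w ∈ tangentSpaceAt (Set.univ : Set (Euc m)) x :=
  tangentSpaceAt_univ x ▸ Submodule.mem_top

theorem isSmoothSubmanifold_univ (m : ℕ) :
    IsSmoothSubmanifold m (Set.univ : Set (Euc m)) := fun x _ =>
  ⟨OpenPartialHomeomorph.refl _, ⊤, 0, trivial, contDiffOn_id, contDiffOn_id, by simp, by simp⟩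

/-- The infinitesimal configuration at a point of `ℝ^m` given by vectors modulo translation and
scaling. -/
def ConfModSim.toInfConf {I : Type} (x : (Set.univ : Set (Euc m))) (c : ConfModSim m I) :
    InfConf (Set.univ : Set (Euc m)) I :=
  Quotient.lift (s := confSetoid m I)
    (fun q => Quotient.mk (tangentConfSetoid Set.univ I)
      ⟨(x, q.1), q.2, fun _ => mem_tangentSpaceAt_univ _ _⟩)
    (fun _ _ ⟨s, hs, w, e⟩ => Quotient.sound (s := tangentConfSetoid Set.univ I)
      ⟨rfl, s, hs, w, mem_tangentSpaceAt_univ _ _, e⟩) c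

theorem ConfModSim.base_toInfConf {I : Type} (x : (Set.univ : Set (Euc m))) (c : ConfModSim m I) :
    (c.toInfConf x).base = x := by
  induction c using Quotient.inductionOn
  rfl

theorem ConfModSim.toConfModSim_toInfConf {I : Type} (x : (Set.univ : Set (Euc m)))
    (c : ConfModSim m I) : (c.toInfConf x).toConfModSim = c := by
  induction c using Quotient.inductionOn
  rfl

theorem InfConf.toInfConf_toConfModSim {I : Type} (c : InfConf (Set.univ : Set (Euc m)) I) :
    ConfModSim.toInfConf c.base c.toConfModSim = c := by
  induction c using Quotient.inductionOn
  rfl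

theorem toConfModSim_congr {M : Set (Euc m)} (p : InfStratum T M) {e e' : T.EdgesAt T.root}
    (h : e' = e) (v : T.InternalOver e) (hv : T.IsInternal v.1 ∧ T.LiesOver v.1 e'.1) :
    ((p.1 e').1.2 ⟨v.1, hv⟩).toConfModSim = ((p.1 e).1.2 v).toConfModSim := by
  subst h
  rfl

/-- The underlying points and the classes of vectors that make up an element of `D_T(ℝ^m)`. -/
noncomputable def infStratumUnivEquiv (hT : T.graph.IsTree) :
    InfStratum T (Set.univ : Set (Euc m)) ≃
      Conf (T.EdgesAt T.root) (Euc m) × (∀ v : T.Internal, ConfModSim m (T.EdgesAt v.1)) where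
  toFun p := (⟨fun e => (p.1 e).1.1, fun _ _ h => p.2 (Subtype.ext h)⟩, fun v =>
    ((p.1 (rootEdge hT v.1 v.2.1)).1.2 (Internal.over hT v)).toConfModSim)
  invFun q := ⟨fun e => ⟨(⟨q.1.1 e, trivial⟩, fun v =>
    ConfModSim.toInfConf ⟨q.1.1 e, trivial⟩ (q.2 ⟨v.1, v.2.1⟩)),
      fun _ => ConfModSim.base_toInfConf _ _⟩, fun _ _ h => q.1.2 (Subtype.ext_iff.1 h)⟩
  left_inv p := by
    refine Subtype.ext (funext fun e => Subtype.ext (Prod.ext rfl (funext fun v => ?_)))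
    refine Eq.trans ?_ (InfConf.toInfConf_toConfModSim _)
    rw [(p.1 e).2 v]
    exact congrArg (ConfModSim.toInfConf _)
      (toConfModSim_congr p (rootEdge_eq hT v.2.1.1 v.2.2) v _)
  right_inv q := Prod.ext rfl (funext fun v => ConfModSim.toConfModSim_toInfConf _ _)

theorem infStratumUnivEquiv_snd (hT : T.graph.IsTree)
    (p : InfStratum T (Set.univ : Set (Euc m))) (e : T.EdgesAt T.root) (v : T.InternalOver e) :
    (infStratumUnivEquiv hT p).2 ⟨v.1, v.2.1⟩ = ((p.1 e).1.2 v).toConfModSim :=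
  toConfModSim_congr p (rootEdge_eq hT v.2.1.1 v.2.2) v _

theorem isSmooth_infStratumUnivEquiv (hT : T.graph.IsTree) :
    IsSmooth (infStratumUnivEquiv (m := m) hT) := by
  refine isSmooth_of_contDiff (fun b : InfData T m => (fun e => (b e).1, fun v : T.Internal =>
    ((b (rootEdge hT v.1 v.2.1)).2 (Internal.over hT v)).2)) ?_ fun b y hy => ?_
  · exact ContDiff.prodMk (contDiff_param_pi (Z := fun _ : T.EdgesAt T.root => Euc m)
      contDiff_infData_base)
      (contDiff_param_pi (Z := fun v : T.Internal => ConfModSim m (T.EdgesAt v.1)) fun v =>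
        contDiff_param_pi (Z := fun _ : T.EdgesAt v.1 => Euc m) fun c =>
          contDiff_infData_vec _ (Internal.over hT v) c)
  · refine ⟨fun e => (hy e).1, fun v => ?_⟩
    obtain ⟨q, hq, -, hvec⟩ := (hy (rootEdge hT v.1 v.2.1)).2 (Internal.over hT v)
    exact ⟨⟨q.1.2, q.2.1⟩, congrArg InfConf.toConfModSim hq, hvec⟩

theorem isSmooth_infStratumUnivEquiv_symm (hT : T.graph.IsTree) :
    IsSmooth (infStratumUnivEquiv (m := m) hT).symm := by
  refine isSmooth_of_contDiff (fun b : (T.EdgesAt T.root → Euc m) ×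
      ∀ v : T.Internal, T.EdgesAt v.1 → Euc m => fun e => (b.1 e, fun v : T.InternalOver e =>
        (b.1 e, b.2 ⟨v.1, v.2.1⟩))) ?_ ?_
  · have base e : ContDiff ℝ ∞ fun b : Param (Conf (T.EdgesAt T.root) (Euc m) ×
        (∀ v : T.Internal, ConfModSim m (T.EdgesAt v.1))) => (b.1 : T.EdgesAt T.root → Euc m) e :=
      (contDiff_param_apply (Z := fun _ : T.EdgesAt T.root => Euc m) e).comp
        (contDiff_param_fst (X := Conf (T.EdgesAt T.root) (Euc m))
          (Y := ∀ v : T.Internal, ConfModSim m (T.EdgesAt v.1)))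
    refine contDiff_param_pi (Z := fun e => InfConfOver T (Set.univ : Set (Euc m)) e)
      fun e => ContDiff.prodMk (base e) (contDiff_param_pi
        (Z := fun v : T.InternalOver e => InfConf (Set.univ : Set (Euc m)) (T.EdgesAt v.1))
          fun v => ContDiff.prodMk (base e) ?_)
    exact (contDiff_param_apply (Z := fun v : T.Internal => ConfModSim m (T.EdgesAt v.1))
      ⟨v.1, v.2.1⟩).comp (contDiff_param_snd (X := Conf (T.EdgesAt T.root) (Euc m))
        (Y := ∀ v : T.Internal, ConfModSim m (T.EdgesAt v.1)))
  · rintro b y ⟨hbase, hvec⟩ e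
    refine ⟨hbase e, fun v => ?_⟩
    obtain ⟨q, hq, hqvec⟩ := hvec ⟨v.1, v.2.1⟩
    exact ⟨⟨(⟨y.1.1 e, trivial⟩, q.1), q.2, fun _ => mem_tangentSpaceAt_univ _ _⟩,
      congrArg (ConfModSim.toInfConf _) hq, hbase e, hqvec⟩

theorem exists_isDiffeo_infStratum_univ (hT : T.graph.IsTree) (m : ℕ) :
    ∃ Φ : InfStratum T (Set.univ : Set (Euc m)) ≃ₜ
        Conf (T.EdgesAt T.root) (Euc m) × (∀ v : T.Internal, ConfModSim m (T.EdgesAt v.1)),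
      IsDiffeo Φ ∧
      ∀ (p : InfStratum T (Set.univ : Set (Euc m))) (e : T.EdgesAt T.root),
        (Φ p).1.1 e = ((p.1 e).1.1 : Euc m) ∧
        ∀ v : T.InternalOver e, (Φ p).2 ⟨v.1, v.2.1⟩ = ((p.1 e).1.2 v).toConfModSim := by
  have := (isSmoothSubmanifold_univ m).hasParamTopology_infStratum T
  obtain ⟨g, hg, hgf⟩ := exists_isDiffeo_of_equiv (infStratumUnivEquiv (m := m) hT)
    (isSmooth_infStratumUnivEquiv hT) (isSmooth_infStratumUnivEquiv_symm hT)
  refine ⟨g, hg, fun p e => ?_⟩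
  rw [hgf]
  exact ⟨rfl, infStratumUnivEquiv_snd hT p e⟩

end Euclidean

/-! ### Limits of configurations -/

section Coordinates

variable {m n : ℕ} {M : Set (Euc m)}

theorem injective_pair_iff {i j : Fin n} : Function.Injective ![i, j] ↔ i ≠ j := by
  simp [Function.Injective, Fin.forall_fin_two, eq_comm]

theorem injective_triple_iff {i j k : Fin n} :
    Function.Injective ![i, j, k] ↔ i ≠ j ∧ i ≠ k ∧ j ≠ k := by
  simp [Function.Injective, Fin.forall_fin_succ, eq_comm]
  tauto

theorem eq_pair (p : Conf (Fin 2) (Fin n)) : p.1 = ![p.1 0, p.1 1] := by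
  ext a
  fin_cases a <;> rfl

theorem eq_triple (p : Conf (Fin 3) (Fin n)) : p.1 = ![p.1 0, p.1 1, p.1 2] := by
  ext a
  fin_cases a <;> rfl

/-- The direction `u_ij` of a point of `A_n[M]`; zero if `i = j`. -/
noncomputable def dirOf (x : CompactAmbient n M) (i j : Fin n) : Euc m :=
  if h : i ≠ j then (x.2.1 ⟨![i, j], injective_pair_iff.2 h⟩ : Euc m) else 0

/-- The ratio `d_ijk` of a point of `A_n[M]`; one if the indices are not distinct. -/
noncomputable def ratioOf (x : CompactAmbient n M) (i j k : Fin n) : ENNReal :=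
  if h : i ≠ j ∧ i ≠ k ∧ j ≠ k then x.2.2 ⟨![i, j, k], injective_triple_iff.2 h⟩ else 1

theorem dirOf_conf (x : CompactAmbient n M) (p : Conf (Fin 2) (Fin n)) :
    dirOf x (p.1 0) (p.1 1) = x.2.1 p := by
  rw [dirOf, dif_pos (injective_pair_iff.1 (eq_pair p ▸ p.2))]
  exact congrArg (fun p => (x.2.1 p : Euc m)) (Subtype.ext (eq_pair p).symm)

theorem ratioOf_conf (x : CompactAmbient n M) (p : Conf (Fin 3) (Fin n)) :
    ratioOf x (p.1 0) (p.1 1) (p.1 2) = x.2.2 p := by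
  rw [ratioOf, dif_pos (injective_triple_iff.1 (eq_triple p ▸ p.2))]
  exact congrArg x.2.2 (Subtype.ext (eq_triple p).symm)

theorem exclusionOf_iff {x : CompactAmbient n M} {i j k : Fin n} :
    exclusionOf x i j k ↔ (i ≠ j ∧ i ≠ k ∧ j ≠ k) ∧ ratioOf x i j k = 0 := by
  constructor
  · rintro ⟨h, hzero⟩
    have hne := injective_triple_iff.1 h
    exact ⟨hne, by rw [ratioOf, dif_pos hne, hzero]⟩
  · rintro ⟨hne, hzero⟩
    rw [ratioOf, dif_pos hne] at hzero
    exact ⟨_, hzero⟩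

/-- The difference of two points of a configuration. -/
def diff (y : Conf (Fin n) M) (i j : Fin n) : Euc m := (y.1 i : Euc m) - y.1 j

theorem diff_ne_zero (y : Conf (Fin n) M) {i j : Fin n} (h : i ≠ j) : diff y i j ≠ 0 :=
  sub_ne_zero.2 fun e => h (y.2 (Subtype.ext e))

theorem diff_self (y : Conf (Fin n) M) (i : Fin n) : diff y i i = 0 := sub_self _

theorem diff_sub_diff (y : Conf (Fin n) M) (i j k : Fin n) :
    diff y i j - diff y i k = diff y k j :=
  sub_sub_sub_cancel_left _ _ _

theorem neg_diff (y : Conf (Fin n) M) (i j : Fin n) : -diff y i j = diff y j i :=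
  neg_sub _ _

theorem edist_div_edist (y : Conf (Fin n) M) {i j k : Fin n} (h : i ≠ k) :
    edist (y.1 i) (y.1 j) / edist (y.1 i) (y.1 k) =
      ENNReal.ofReal (‖diff y i j‖ / ‖diff y i k‖) := by
  rw [ENNReal.ofReal_div_of_pos (norm_pos_iff.2 (diff_ne_zero y h)), edist_dist, edist_dist,
    Subtype.dist_eq, Subtype.dist_eq, dist_eq_norm, dist_eq_norm]
  rfl

theorem tendsto_confEmbed_iff {α : Type*} {l : Filter α} {y : α → Conf (Fin n) M}
    {x : CompactAmbient n M} : Tendsto (fun t => confEmbed n M (y t)) l (𝓝 x) ↔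
      (∀ i, Tendsto (fun t => ((y t).1 i : Euc m)) l (𝓝 (x.1 i))) ∧
      (∀ i j, i ≠ j → Tendsto (fun t => ‖diff (y t) i j‖⁻¹ • diff (y t) i j) l (𝓝 (dirOf x i j))) ∧
      ∀ i j k, i ≠ j → i ≠ k → j ≠ k →
        Tendsto (fun t => ENNReal.ofReal (‖diff (y t) i j‖ / ‖diff (y t) i k‖)) l
          (𝓝 (ratioOf x i j k)) := by
  rw [Prod.tendsto_iff, Prod.tendsto_iff, tendsto_pi_nhds, tendsto_pi_nhds, tendsto_pi_nhds]
  refine and_congr (forall_congr' fun i => tendsto_subtype_rng) (and_congr ?_ ?_)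
  · simp only [tendsto_subtype_rng]
    constructor
    · intro h i j hij
      rw [dirOf, dif_pos hij]
      exact h ⟨![i, j], injective_pair_iff.2 hij⟩
    · intro h p
      rw [← dirOf_conf]
      exact h _ _ fun e => zero_ne_one (p.2 e)
  · constructor
    · intro h i j k hij hik hjk
      rw [ratioOf, dif_pos ⟨hij, hik, hjk⟩]
      refine (h ⟨![i, j, k], injective_triple_iff.2 ⟨hij, hik, hjk⟩⟩).congr fun t => ?_
      exact edist_div_edist (y t) hik
    · intro h p
      obtain ⟨hij, hik, hjk⟩ := injective_triple_iff.1 (eq_triple p ▸ p.2)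
      rw [← ratioOf_conf]
      exact (h _ _ _ hij hik hjk).congr fun t => (edist_div_edist (y t) hik).symm

theorem exists_tendsto_of_mem_canonicalCompactification {x : CompactAmbient n M}
    (hx : x ∈ canonicalCompactification n M) :
    ∃ l : Filter (Conf (Fin n) M), l.NeBot ∧ Tendsto (confEmbed n M) l (𝓝 x) :=
  ⟨comap (confEmbed n M) (𝓝 x),
    comap_neBot_iff_frequently.2 (mem_closure_iff_frequently.1 hx), tendsto_comap⟩

section Limit

variable {α : Type*} {l : Filter α} {y : α → Conf (Fin n) M} {x : CompactAmbient n M}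
  (hy : Tendsto (fun t => confEmbed n M (y t)) l (𝓝 x)) {i j k : Fin n}
include hy

theorem tendsto_point (i : Fin n) : Tendsto (fun t => ((y t).1 i : Euc m)) l (𝓝 (x.1 i)) :=
  (tendsto_confEmbed_iff.1 hy).1 i

theorem tendsto_diff (i j : Fin n) :
    Tendsto (fun t => diff (y t) i j) l (𝓝 ((x.1 i : Euc m) - x.1 j)) :=
  (tendsto_point hy i).sub (tendsto_point hy j)

theorem tendsto_dir (i j : Fin n) :
    Tendsto (fun t => ‖diff (y t) i j‖⁻¹ • diff (y t) i j) l (𝓝 (dirOf x i j)) := by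
  by_cases hij : i = j
  · subst hij
    simpa [dirOf, diff_self] using tendsto_const_nhds
  · exact (tendsto_confEmbed_iff.1 hy).2.1 i j hij

theorem tendsto_ratio (hij : i ≠ j) (hik : i ≠ k) :
    Tendsto (fun t => ENNReal.ofReal (‖diff (y t) i j‖ / ‖diff (y t) i k‖)) l
      (𝓝 (ratioOf x i j k)) := by
  by_cases hjk : j = k
  · subst hjk
    have norm_ne_zero t : ‖diff (y t) i j‖ ≠ 0 := norm_ne_zero_iff.2 (diff_ne_zero _ hij)
    simpa [ratioOf, div_self (norm_ne_zero _)] using tendsto_const_nhds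
  · exact (tendsto_confEmbed_iff.1 hy).2.2 i j k hij hik hjk

theorem tendsto_ratio_toReal (hij : i ≠ j) (hik : i ≠ k) (h : ratioOf x i j k ≠ ⊤) :
    Tendsto (fun t => ‖diff (y t) i j‖ / ‖diff (y t) i k‖) l (𝓝 (ratioOf x i j k).toReal) :=
  ((ENNReal.tendsto_toReal h).comp (tendsto_ratio hy hij hik)).congr fun _ =>
    ENNReal.toReal_ofReal (by positivity)

variable [l.NeBot]

theorem ratioOf_swap (hij : i ≠ j) (hik : i ≠ k) : ratioOf x i k j = (ratioOf x i j k)⁻¹ := by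
  refine tendsto_nhds_unique (tendsto_ratio hy hik hij) ?_
  refine ((continuous_inv.tendsto _).comp (tendsto_ratio hy hij hik)).congr fun t => ?_
  have hj := norm_pos_iff.2 (diff_ne_zero (y t) hij)
  have hk := norm_pos_iff.2 (diff_ne_zero (y t) hik)
  rw [Function.comp_apply, ← ENNReal.ofReal_inv_of_pos (div_pos hj hk), inv_div]

theorem isBigO_diff (hij : i ≠ j) (hik : i ≠ k) (h : ratioOf x i k j ≠ 0) :
    (fun t => diff (y t) i j) =O[l] fun t => diff (y t) i k := by
  have ratio_ne_top : ratioOf x i j k ≠ ⊤ := by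
    rw [ratioOf_swap hy hik hij]
    exact ENNReal.inv_ne_top.2 h
  refine (Asymptotics.isBigO_of_div_tendsto_nhds (Eventually.of_forall fun t ht => ?_) _
    (tendsto_ratio_toReal hy hij hik ratio_ne_top)).of_norm_norm
  exact absurd ht (norm_ne_zero_iff.2 (diff_ne_zero _ hik))

theorem ratioOf_eq_zero_iff (hij : i ≠ j) (hik : i ≠ k) :
    ratioOf x i j k = 0 ↔ (fun t => diff (y t) i j) =o[l] fun t => diff (y t) i k := by
  rw [← Asymptotics.isLittleO_norm_norm, Asymptotics.isLittleO_iff_tendsto fun t ht =>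
    absurd ht (norm_ne_zero_iff.2 (diff_ne_zero _ hik))]
  constructor
  · intro h
    simpa [h] using tendsto_ratio_toReal hy hij hik (by simp [h])
  · intro h
    refine tendsto_nhds_unique (tendsto_ratio hy hij hik) ?_
    rw [← ENNReal.ofReal_zero]
    exact (ENNReal.continuous_ofReal.tendsto 0).comp h

theorem exclusionOf_iff_isLittleO : exclusionOf x i j k ↔
    i ≠ j ∧ i ≠ k ∧ (fun t => diff (y t) i j) =o[l] fun t => diff (y t) i k := by
  rw [exclusionOf_iff]
  constructor
  · rintro ⟨⟨hij, hik, -⟩, hzero⟩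
    exact ⟨hij, hik, (ratioOf_eq_zero_iff hy hij hik).1 hzero⟩
  · rintro ⟨hij, hik, ho⟩
    have hzero := (ratioOf_eq_zero_iff hy hij hik).2 ho
    refine ⟨⟨hij, hik, ?_⟩, hzero⟩
    rintro rfl
    simp [ratioOf] at hzero

theorem isBigO_diff_of_not_exclusionOf (hik : i ≠ k) (h : ¬exclusionOf x i k j) :
    (fun t => diff (y t) i j) =O[l] fun t => diff (y t) i k := by
  by_cases hij : i = j
  · subst hij
    simpa only [diff_self] using Asymptotics.isBigO_zero _ _
  · refine isBigO_diff hy hij hik fun hzero => h ?_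
    exact (exclusionOf_iff_isLittleO hy).2 ⟨hik, hij, (ratioOf_eq_zero_iff hy hik hij).1 hzero⟩

theorem isBigO_diff_of_exclusionOf (h : exclusionOf x i j k) :
    (fun t => diff (y t) i k) =O[l] fun t => diff (y t) j k :=
  ((exclusionOf_iff_isLittleO hy).1 h).2.2.right_isBigO_sub.congr (fun _ => rfl) fun t =>
    diff_sub_diff (y t) i k j

theorem isExclusion_exclusionOf : IsExclusion (exclusionOf x) := by
  have isLittleO {i j k} (h : exclusionOf x i j k) :
      (fun t => diff (y t) i j) =o[l] fun t => diff (y t) j k :=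
    ((exclusionOf_iff_isLittleO hy).1 h).2.2.trans_isBigO (isBigO_diff_of_exclusionOf hy h)
  refine ⟨fun h => (exclusionOf_iff.1 h).1, fun {i j k} h => ?_, fun {i j k p} h h' hpj => ?_,
    fun {i j k p} h h' => ?_, fun {i j k p} h h' hpi => ?_⟩
  · obtain ⟨⟨hij, -, hjk⟩, -⟩ := exclusionOf_iff.1 h
    refine (exclusionOf_iff_isLittleO hy).2 ⟨hij.symm, hjk, ?_⟩
    simpa only [← neg_diff _ i j, Asymptotics.isLittleO_neg_left] using isLittleO h
  · obtain ⟨⟨-, -, hjk⟩, -⟩ := exclusionOf_iff.1 h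
    refine (exclusionOf_iff_isLittleO hy).2 ⟨hpj.symm, hjk, ?_⟩
    have hp := ((exclusionOf_iff_isLittleO hy).1 h').2.2.trans_isBigO
      (isBigO_diff_of_exclusionOf hy h)
    simpa only [diff_sub_diff] using hp.sub (isLittleO h)
  · rw [exclusionOf_iff_isLittleO hy] at h h' ⊢
    exact ⟨h.1, h'.2.1, h.2.2.trans h'.2.2⟩
  · have hO := isBigO_diff_of_not_exclusionOf hy hpi.symm h'
    rw [exclusionOf_iff_isLittleO hy] at h ⊢
    exact ⟨h.1, hpi.symm, h.2.2.trans_isBigO hO⟩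

theorem exclusionOf_of_eq_of_ne (hik : x.1 i ≠ x.1 k) (hij : x.1 i = x.1 j) (hne : i ≠ j) :
    exclusionOf x i j k := by
  have hik' : i ≠ k := fun e => hik (e ▸ rfl)
  refine (exclusionOf_iff_isLittleO hy).2 ⟨hne, hik', ?_⟩
  have limit_ne_zero : (x.1 i : Euc m) - x.1 k ≠ 0 :=
    sub_ne_zero.2 fun e => hik (Subtype.ext e)
  refine (Asymptotics.isLittleO_of_tendsto (fun t ht => ?_) ?_).of_norm_norm
  · exact absurd ht (norm_ne_zero_iff.2 (diff_ne_zero _ hik'))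
  · simpa [Pi.div_def, hij] using
      (tendsto_diff hy i j).norm.div (tendsto_diff hy i k).norm (norm_ne_zero_iff.2 limit_ne_zero)

theorem eq_of_exclusionOf (h : exclusionOf x i j k) : x.1 i = x.1 j := by
  have diff_isLittleO : (fun t => diff (y t) i j) =o[l] fun _ => (1 : ℝ) :=
    ((exclusionOf_iff_isLittleO hy).1 h).2.2.trans_isBigO ((tendsto_diff hy i k).isBigO_one ℝ)
  exact Subtype.ext (sub_eq_zero.1 (tendsto_nhds_unique (tendsto_diff hy i j)
    ((Asymptotics.isLittleO_one_iff ℝ).1 diff_isLittleO)))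

theorem treeOf_iso_iff_of_tendsto {T : RootedGraph n} (hT : T.IsFTree) :
    (treeOf x).Iso T ↔
      (∀ i j k, exclusionOf x i j k ↔ (i ≠ j ∧ i ≠ k ∧ j ≠ k) ∧ T.Near i j k) ∧
      ∀ i j, i ≠ j → (x.1 i = x.1 j ↔ ∃ v, v ≠ T.root ∧ i ∈ T.leafSet v ∧ j ∈ T.leafSet v) :=
  treeOf_iso_iff (isExclusion_exclusionOf hy) hT
    (fun _ _ _ => exclusionOf_of_eq_of_ne hy) fun _ _ _ => eq_of_exclusionOf hy

end Limit

end Coordinates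

/-! ### Data that represent elements of `D_T(M)` -/

namespace RootedGraph

variable {n : ℕ} {T : RootedGraph n}

/-- The vertex next to the root on the way to a leaf. -/
noncomputable def trunk (hT : T.IsFTree) (i : Fin n) : T.V :=
  (rootEdge hT.isTree (T.leaf i) (leaf_ne_root hT i)).1

theorem child_trunk (hT : T.IsFTree) (i : Fin n) : T.Child T.root (trunk hT i) :=
  (rootEdge hT.isTree (T.leaf i) (leaf_ne_root hT i)).2

theorem liesOver_trunk (hT : T.IsFTree) (i : Fin n) : T.LiesOver (T.leaf i) (trunk hT i) :=
  liesOver_rootEdge hT.isTree (leaf_ne_root hT i)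

theorem trunk_eq (hT : T.IsFTree) {i : Fin n} {c : T.V} (hc : T.Child T.root c)
    (h : T.LiesOver (T.leaf i) c) : trunk hT i = c :=
  (child_trunk hT i).eq_of_liesOver hT.isTree hc (liesOver_trunk hT i) h

end RootedGraph

section InfData

open RootedGraph SmoothParam

variable {m n : ℕ} {T : RootedGraph n} {M : Set (Euc m)}

namespace InfData

open Classical in
/-- The point or vector at the upper endpoint `c` of an edge; zero if `c` is the root. -/
noncomputable def vec (b : InfData T m) (c : T.V) : Euc m :=
  if h : T.Child T.root c then (b ⟨c, h⟩).1
  else if h : ∃ (e : T.EdgesAt T.root) (v : T.InternalOver e), T.Child v.1 c then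
    ((b h.choose).2 h.choose_spec.choose).2 ⟨c, h.choose_spec.choose_spec⟩
  else 0

theorem vec_root (b : InfData T m) (e : T.EdgesAt T.root) : b.vec e.1 = (b e).1 := by
  have hc : T.Child T.root e.1 := e.2
  rw [vec, dif_pos hc]

theorem vector_congr (hT : T.graph.IsTree) (b : InfData T m) {e e' : T.EdgesAt T.root}
    (v : T.InternalOver e) (v' : T.InternalOver e') {c : T.V} (h : T.Child v.1 c)
    (h' : T.Child v'.1 c) : ((b e).2 v).2 ⟨c, h⟩ = ((b e').2 v').2 ⟨c, h'⟩ := by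
  obtain ⟨v, hv⟩ := v
  obtain ⟨v', hv'⟩ := v'
  obtain rfl : v = v' := h.parent_unique hT h'
  obtain rfl : e = e' := (rootEdge_eq hT hv.1.1 hv.2).symm.trans (rootEdge_eq hT hv.1.1 hv'.2)
  rfl

theorem vec_internal (hT : T.graph.IsTree) (b : InfData T m) (e : T.EdgesAt T.root)
    (v : T.InternalOver e) (c : T.EdgesAt v.1) : b.vec c.1 = ((b e).2 v).2 c := by
  have hroot : ¬T.Child T.root c.1 := fun h => v.2.1.1 (Child.parent_unique hT c.2 h)
  have hinternal : ∃ (e : T.EdgesAt T.root) (v : T.InternalOver e), T.Child v.1 c.1 :=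
    ⟨e, v, c.2⟩
  rw [vec, dif_neg hroot, dif_pos hinternal]
  exact vector_congr hT b _ _ _ _

theorem vec_of_isInternal (hT : T.graph.IsTree) (b : InfData T m) {v : T.V} (hv : T.IsInternal v)
    (c : T.EdgesAt v) :
    b.vec c.1 = ((b (rootEdge hT v hv.1)).2 (Internal.over hT ⟨v, hv⟩)).2 c :=
  vec_internal hT b _ (Internal.over hT ⟨v, hv⟩) c

theorem contDiff_vec (c : T.V) :
    @ContDiff ℝ _ (Param (InfStratum T M)) _ _ (Euc m) _ _ ∞ fun b : InfData T m => b.vec c := by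
  by_cases hroot : T.Child T.root c
  · simp only [vec, dif_pos hroot]
    exact contDiff_infData_base _
  by_cases hinternal : ∃ (e : T.EdgesAt T.root) (v : T.InternalOver e), T.Child v.1 c
  · simp only [vec, dif_neg hroot, dif_pos hinternal]
    exact contDiff_infData_vec _ _ _
  · simp only [vec, dif_neg hroot, dif_neg hinternal]
    exact contDiff_const

/-- The difference of the vectors towards the leaves `i` and `j` where these branch. -/
noncomputable def gap (b : InfData T m) (i j : Fin n) : Euc m :=
  b.vec (T.branch i j) - b.vec (T.branch j i)

theorem gap_eq (hT : T.graph.IsTree) (b : InfData T m) {i j : Fin n} {v c c' : T.V}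
    (h : T.SplitsAt i j v c c') : b.gap i j = b.vec c - b.vec c' := by
  rw [gap, h.branch_eq hT, h.symm.branch_eq hT]

/-- The data that represent an element of `D_T(M)`. -/
structure IsValid (b : InfData T m) (M : Set (Euc m)) : Prop where
  mem : ∀ e, (b e).1 ∈ M
  base_injective : Function.Injective fun e => (b e).1
  base_eq : ∀ e v, ((b e).2 v).1 = (b e).1
  injective : ∀ e v, Function.Injective ((b e).2 v).2
  mem_tangent : ∀ e v c, ((b e).2 v).2 c ∈ tangentSpaceAt M (b e).1

theorem isValid_of_rep {b : InfData T m} {p : InfStratum T M}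
    (h : Rep (X := InfStratum T M) b p) : b.IsValid M := by
  have base_eq e : (b e).1 = (p.1 e).1.1.1 := (h e).1
  have exists_tangentConf e v : ∃ q : TangentConf M (T.EdgesAt v.1),
      ((b e).2 v).1 = q.1.1 ∧ (q.1.1 : Euc m) = (b e).1 ∧ ((b e).2 v).2 = q.1.2 := by
    obtain ⟨q, hq, hqbase, hqvec⟩ := (h e).2 v
    refine ⟨q, hqbase, ?_, funext hqvec⟩
    rw [base_eq, ← (p.1 e).2 v, ← hq]
    rfl
  refine ⟨fun e => base_eq e ▸ (p.1 e).1.1.2, fun e e' he => ?_, fun e v => ?_, fun e v => ?_,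
    fun e v c => ?_⟩
  · exact p.2 (Subtype.ext ((base_eq e).symm.trans (he.trans (base_eq e'))))
  · obtain ⟨q, hq, hq', -⟩ := exists_tangentConf e v
    exact hq.trans hq'
  · obtain ⟨q, -, -, hq⟩ := exists_tangentConf e v
    exact hq ▸ q.2.1
  · obtain ⟨q, -, hqbase, hq⟩ := exists_tangentConf e v
    rw [hq, ← hqbase]
    exact q.2.2 c

/-- The element of `D_T(M)` that is represented by given data. -/
def toInfStratum (b : InfData T m) (hb : b.IsValid M) : InfStratum T M :=
  ⟨fun e => ⟨(⟨(b e).1, hb.mem e⟩, fun v => Quotient.mk (tangentConfSetoid M (T.EdgesAt v.1))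
    ⟨(⟨(b e).1, hb.mem e⟩, ((b e).2 v).2), hb.injective e v, hb.mem_tangent e v⟩), fun _ => rfl⟩,
    fun _ _ h => hb.base_injective (Subtype.ext_iff.1 h)⟩

theorem rep_toInfStratum (b : InfData T m) (hb : b.IsValid M) :
    Rep (X := InfStratum T M) b (b.toInfStratum hb) :=
  fun e => ⟨rfl, fun v => ⟨⟨(⟨(b e).1, hb.mem e⟩, ((b e).2 v).2), hb.injective e v,
    hb.mem_tangent e v⟩, rfl, hb.base_eq e v, fun _ => rfl⟩⟩

theorem toInfStratum_eq_iff {b b' : InfData T m} (hb : b.IsValid M) (hb' : b'.IsValid M) :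
    b.toInfStratum hb = b'.toInfStratum hb' ↔ (∀ e, (b e).1 = (b' e).1) ∧
      ∀ e v, ∃ s : ℝ, 0 < s ∧ ∃ w, ∀ c, ((b' e).2 v).2 c = s • ((b e).2 v).2 c + w := by
  constructor
  · intro h
    refine ⟨fun e => congrArg (fun p : InfStratum T M => ((p.1 e).1.1 : Euc m)) h, fun e v => ?_⟩
    obtain ⟨-, s, hs, w, -, hw⟩ :=
      Quotient.exact (congrArg (fun p : InfStratum T M => (p.1 e).1.2 v) h)
    exact ⟨s, hs, w, hw⟩
  · rintro ⟨base_eq, hvec⟩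
    refine Subtype.ext (funext fun e => Subtype.ext (Prod.ext (Subtype.ext (base_eq e))
      (funext fun v => Quotient.sound ?_)))
    obtain ⟨s, hs, w, hw⟩ := hvec e v
    refine ⟨Subtype.ext (base_eq e), s, hs, ?_⟩
    rcases isEmpty_or_nonempty (T.EdgesAt v.1) with hI | ⟨⟨c⟩⟩
    · exact ⟨0, Submodule.zero_mem _, isEmptyElim⟩
    · refine ⟨w, ?_, hw⟩
      have mem_tangent := hb'.mem_tangent e v c
      rw [← base_eq e] at mem_tangent
      have := Submodule.sub_mem _ mem_tangent (Submodule.smul_mem _ s (hb.mem_tangent e v c))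
      rwa [hw, add_sub_cancel_left] at this

theorem toInfStratum_of_rep {b : InfData T m} {p : InfStratum T M}
    (h : Rep (X := InfStratum T M) b p) : b.toInfStratum (isValid_of_rep h) = p :=
  rep_unique (X := InfStratum T M) (rep_toInfStratum b _) h

namespace IsValid

variable {b : InfData T m} (hb : b.IsValid M)
include hb

theorem vec_mem {c : T.V} (hc : T.Child T.root c) : b.vec c ∈ M :=
  vec_root b ⟨c, hc⟩ ▸ hb.mem _

theorem vec_ne (hT : T.IsFTree) {v c c' : T.V} (hc : T.Child v c) (hc' : T.Child v c')
    (hne : c ≠ c') : b.vec c ≠ b.vec c' := by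
  rcases hc.root_or_isInternal hT with rfl | hv
  · rw [vec_root b ⟨c, hc⟩, vec_root b ⟨c', hc'⟩]
    exact fun h => hne (Subtype.ext_iff.1 (hb.base_injective h))
  · rw [vec_of_isInternal hT.isTree b hv ⟨c, hc⟩, vec_of_isInternal hT.isTree b hv ⟨c', hc'⟩]
    exact fun h => hne (Subtype.ext_iff.1 (hb.injective _ _ h))

theorem gap_ne_zero (hT : T.IsFTree) {i j : Fin n} (hij : i ≠ j) : b.gap i j ≠ 0 := by
  obtain ⟨v, h⟩ := exists_splitsAt_branch hT hij
  exact sub_ne_zero.2 (hb.vec_ne hT h.child_left h.child_right h.ne)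

theorem vec_mem_tangent (hT : T.graph.IsTree) {e v c : T.V} (he : T.Child T.root e)
    (hv : T.IsInternal v) (hve : T.LiesOver v e) (hc : T.Child v c) :
    b.vec c ∈ tangentSpaceAt M (b.vec e) := by
  rw [vec_root b ⟨e, he⟩, vec_internal hT b ⟨e, he⟩ ⟨v, hv, hve⟩ ⟨c, hc⟩]
  exact hb.mem_tangent _ _ _

end IsValid

open Classical in
/-- The ratio `d_ijk` of the point of `C_n[M]` that corresponds to given data. -/
noncomputable def ratio (b : InfData T m) (i j k : Fin n) : ENNReal :=
  if T.branch i j = T.branch i k then ENNReal.ofReal (‖b.gap i j‖ / ‖b.gap i k‖)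
  else if T.Near i j k then 0 else ⊤

/-- The point of `A_n[M]` that corresponds to given data. -/
noncomputable def toAmbient (hT : T.IsFTree) (b : InfData T m) (hb : b.IsValid M) :
    CompactAmbient n M :=
  (fun i => ⟨b.vec (trunk hT i), hb.vec_mem (child_trunk hT i)⟩,
   fun p => ⟨‖b.gap (p.1 0) (p.1 1)‖⁻¹ • b.gap (p.1 0) (p.1 1), by
    rw [mem_sphere_zero_iff_norm, norm_smul, norm_inv, norm_norm, inv_mul_cancel₀]
    exact norm_ne_zero_iff.2 (hb.gap_ne_zero hT fun e => zero_ne_one (p.2 e))⟩,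
   fun q => b.ratio (q.1 0) (q.1 1) (q.1 2))

theorem dirOf_toAmbient (hT : T.IsFTree) {b : InfData T m} (hb : b.IsValid M) {i j : Fin n}
    (hij : i ≠ j) : dirOf (b.toAmbient hT hb) i j = ‖b.gap i j‖⁻¹ • b.gap i j := by
  rw [dirOf, dif_pos hij]
  rfl

theorem ratioOf_toAmbient (hT : T.IsFTree) {b : InfData T m} (hb : b.IsValid M) {i j k : Fin n}
    (hij : i ≠ j) (hik : i ≠ k) (hjk : j ≠ k) :
    ratioOf (b.toAmbient hT hb) i j k = b.ratio i j k := by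
  rw [ratioOf, dif_pos ⟨hij, hik, hjk⟩]
  rfl

variable {α : Type*} {l : Filter α} {b : InfData T m}

/-- At the vertex `v` the differences of the points over it, suitably rescaled, converge to the
differences of the vectors at the vertex. -/
def IsLimitAt (b : InfData T m) (y : α → Fin n → Euc m) (l : Filter α) (v : T.V) : Prop :=
  ∃ r : α → ℝ, (∀ᶠ t in l, 0 < r t) ∧
    ∀ c₁ c₂ i j, T.Child v c₁ → T.Child v c₂ → T.LiesOver (T.leaf i) c₁ →
      T.LiesOver (T.leaf j) c₂ →
        Tendsto (fun t => r t • (y t i - y t j)) l (𝓝 (b.vec c₁ - b.vec c₂))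

/-- Families of points converge to the given data: the points themselves converge to those at the
root edges, and the rescaled differences converge at each internal vertex. -/
structure IsLimit (hT : T.IsFTree) (b : InfData T m) (y : α → Fin n → Euc m) (l : Filter α) :
    Prop where
  point : ∀ i, Tendsto (fun t => y t i) l (𝓝 (b.vec (trunk hT i)))
  isLimitAt_of_isInternal : ∀ v, T.IsInternal v → b.IsLimitAt y l v

section IsLimitAt

variable {y : α → Fin n → Euc m} {v c c' c'' : T.V} {i j k : Fin n}

theorem IsLimitAt.eventually_ne (h : b.IsLimitAt y l v) (hsplit : T.SplitsAt i j v c c')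
    (hne : b.vec c ≠ b.vec c') : ∀ᶠ t in l, y t i ≠ y t j := by
  obtain ⟨r, -, hlim⟩ := h
  filter_upwards [(hlim _ _ i j hsplit.child_left hsplit.child_right hsplit.left_liesOver
    hsplit.right_liesOver).eventually_ne (sub_ne_zero.2 hne)] with t ht heq
  exact ht (by rw [heq, sub_self, smul_zero])

theorem inv_norm_smul_smul {r : ℝ} (hr : 0 < r) (z : Euc m) :
    ‖r • z‖⁻¹ • r • z = ‖z‖⁻¹ • z := by
  rw [norm_smul, Real.norm_of_nonneg hr.le, smul_smul, mul_inv_rev, inv_mul_cancel_right₀ hr.ne']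

theorem IsLimitAt.tendsto_dir (h : b.IsLimitAt y l v) (hsplit : T.SplitsAt i j v c c')
    (hne : b.vec c ≠ b.vec c') :
    Tendsto (fun t => ‖y t i - y t j‖⁻¹ • (y t i - y t j)) l
      (𝓝 (‖b.vec c - b.vec c'‖⁻¹ • (b.vec c - b.vec c'))) := by
  obtain ⟨r, hr, hlim⟩ := h
  have hij := hlim _ _ i j hsplit.child_left hsplit.child_right hsplit.left_liesOver
    hsplit.right_liesOver
  refine ((hij.norm.inv₀ (norm_ne_zero_iff.2 (sub_ne_zero.2 hne))).smul hij).congr' ?_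
  filter_upwards [hr] with t ht using inv_norm_smul_smul ht _

theorem IsLimitAt.tendsto_norm_div_norm (h : b.IsLimitAt y l v) (hsplit : T.SplitsAt i k v c c'')
    (hne : b.vec c ≠ b.vec c'') (hc' : T.Child v c') (hj : T.LiesOver (T.leaf j) c') :
    Tendsto (fun t => ‖y t i - y t j‖ / ‖y t i - y t k‖) l
      (𝓝 (‖b.vec c - b.vec c'‖ / ‖b.vec c - b.vec c''‖)) := by
  obtain ⟨r, hr, hlim⟩ := h
  have hij := hlim _ _ i j hsplit.child_left hc' hsplit.left_liesOver hj
  have hik := hlim _ _ i k hsplit.child_left hsplit.child_right hsplit.left_liesOver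
    hsplit.right_liesOver
  refine (hij.norm.div hik.norm (norm_ne_zero_iff.2 (sub_ne_zero.2 hne))).congr' ?_
  filter_upwards [hr] with t ht
  rw [Pi.div_apply, norm_smul, norm_smul, mul_div_mul_left _ _ (norm_ne_zero_iff.2 ht.ne')]

end IsLimitAt

namespace IsLimit

variable {hT : T.IsFTree} {i j k : Fin n}

section Points

variable {y : α → Fin n → Euc m}

theorem isLimitAt (h : b.IsLimit hT y l) {v d : T.V} (hv : T.Child v d) : b.IsLimitAt y l v := by
  rcases hv.root_or_isInternal hT with rfl | hv
  · refine ⟨fun _ => 1, Eventually.of_forall fun _ => one_pos, fun c c' i j hc hc' hi hj => ?_⟩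
    simp only [one_smul, ← trunk_eq hT hc hi, ← trunk_eq hT hc' hj]
    exact (h.point i).sub (h.point j)
  · exact h.isLimitAt_of_isInternal v hv

theorem comp (h : b.IsLimit hT y l) {β : Type*} {l' : Filter β} {g : β → α}
    (hg : Tendsto g l' l) : b.IsLimit hT (fun t => y (g t)) l' := by
  refine ⟨fun i => (h.point i).comp hg, fun v hv => ?_⟩
  obtain ⟨r, hr, hlim⟩ := h.isLimitAt_of_isInternal v hv
  exact ⟨fun t => r (g t), hg.eventually hr, fun c c' i j hc hc' hi hj =>
    (hlim c c' i j hc hc' hi hj).comp hg⟩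

variable (h : b.IsLimit hT y l) (hb : b.IsValid M)
include h hb

theorem eventually_injective : ∀ᶠ t in l, Function.Injective (y t) := by
  have eventually_ne i j (hij : i ≠ j) : ∀ᶠ t in l, y t i ≠ y t j := by
    obtain ⟨v, hv⟩ := exists_splitsAt_branch hT hij
    exact (h.isLimitAt hv.child_left).eventually_ne hv
      (hb.vec_ne hT hv.child_left hv.child_right hv.ne)
  filter_upwards [eventually_all.2 fun i => eventually_all.2 fun j =>
    eventually_imp_distrib_left.2 (eventually_ne i j)] with t ht i j heq
  by_contra hij
  exact ht i j hij heq

theorem tendsto_dir (hij : i ≠ j) :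
    Tendsto (fun t => ‖y t i - y t j‖⁻¹ • (y t i - y t j)) l
      (𝓝 (‖b.gap i j‖⁻¹ • b.gap i j)) := by
  obtain ⟨v, hv⟩ := exists_splitsAt_branch hT hij
  exact (h.isLimitAt hv.child_left).tendsto_dir hv
    (hb.vec_ne hT hv.child_left hv.child_right hv.ne)

theorem tendsto_norm_div_norm_of_near (hik : i ≠ k) (hnear : T.Near i j k) :
    Tendsto (fun t => ‖y t i - y t j‖ / ‖y t i - y t k‖) l (𝓝 0) := by
  obtain ⟨v, hv⟩ := exists_splitsAt_branch hT hik
  simpa using (h.isLimitAt hv.child_left).tendsto_norm_div_norm hv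
    (hb.vec_ne hT hv.child_left hv.child_right hv.ne) hv.child_left
    ((near_iff_liesOver_branch hT hik).1 hnear)

theorem tendsto_norm_div_norm_of_branch_eq (hij : i ≠ j) (hik : i ≠ k)
    (hbr : T.branch i j = T.branch i k) :
    Tendsto (fun t => ‖y t i - y t j‖ / ‖y t i - y t k‖) l
      (𝓝 (‖b.gap i j‖ / ‖b.gap i k‖)) := by
  obtain ⟨v, hv⟩ := exists_splitsAt_branch hT hij
  obtain ⟨w, hw⟩ := exists_splitsAt_branch hT hik
  obtain rfl : v = w := hv.child_left.parent_unique hT.isTree (hbr ▸ hw.child_left)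
  have := (h.isLimitAt hw.child_left).tendsto_norm_div_norm hw
    (hb.vec_ne hT hw.child_left hw.child_right hw.ne) hv.child_right hv.right_liesOver
  rwa [gap, hbr]

end Points

variable {y : α → Conf (Fin n) M}

theorem tendsto_ratio (h : b.IsLimit hT (fun t i => (y t).1 i) l) (hb : b.IsValid M)
    (hij : i ≠ j) (hik : i ≠ k) :
    Tendsto (fun t => ENNReal.ofReal (‖diff (y t) i j‖ / ‖diff (y t) i k‖)) l
      (𝓝 (b.ratio i j k)) := by
  by_cases hbr : T.branch i j = T.branch i k
  · rw [ratio, if_pos hbr]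
    exact ENNReal.tendsto_ofReal (h.tendsto_norm_div_norm_of_branch_eq hb hij hik hbr)
  rw [ratio, if_neg hbr]
  rcases (branch_eq_or_near hT hij hik).resolve_left hbr with hnear | hnear
  · rw [if_pos hnear, ← ENNReal.ofReal_zero]
    exact ENNReal.tendsto_ofReal (h.tendsto_norm_div_norm_of_near hb hik hnear)
  · rw [if_neg (hnear.not_near hT.isTree), ← ENNReal.inv_zero, ← ENNReal.ofReal_zero]
    refine ((continuous_inv.tendsto _).comp (ENNReal.tendsto_ofReal
      (h.tendsto_norm_div_norm_of_near hb hij hnear))).congr fun t => ?_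
    have hj := norm_pos_iff.2 (diff_ne_zero (y t) hij)
    have hk := norm_pos_iff.2 (diff_ne_zero (y t) hik)
    exact (ENNReal.ofReal_inv_of_pos (div_pos hk hj)).symm.trans (by rw [inv_div])

theorem tendsto_confEmbed (h : b.IsLimit hT (fun t i => (y t).1 i) l) (hb : b.IsValid M) :
    Tendsto (fun t => confEmbed n M (y t)) l (𝓝 (b.toAmbient hT hb)) := by
  refine tendsto_confEmbed_iff.2 ⟨h.point, fun i j hij => ?_, fun i j k hij hik hjk => ?_⟩
  · rw [dirOf_toAmbient hT hb hij]
    exact h.tendsto_dir hb hij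
  · rw [ratioOf_toAmbient hT hb hij hik hjk]
    exact h.tendsto_ratio hb hij hik

end IsLimit

end InfData

end InfData

/-! ### Configurations that converge to given data -/

namespace RootedGraph

variable {n : ℕ} {T : RootedGraph n}

/-- The number of vertices on the path from a vertex to the root, both included. -/
noncomputable def depth (T : RootedGraph n) (v : T.V) : ℕ := {w | T.LiesOver v w}.ncard

theorem depth_pos (hT : T.graph.IsTree) (v : T.V) : 0 < T.depth v :=
  (Set.ncard_pos (Set.toFinite _)).2 ⟨v, liesOver_refl hT v⟩

theorem LiesOver.depth_le (hT : T.graph.IsTree) {v w : T.V} (h : T.LiesOver v w) :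
    T.depth w ≤ T.depth v :=
  Set.ncard_le_ncard (fun _ hu => h.trans hT hu) (Set.toFinite _)

theorem Child.depth_eq (hT : T.graph.IsTree) {v c : T.V} (hc : T.Child v c) :
    T.depth c = T.depth v + 1 := by
  have hinsert : {w | T.LiesOver c w} = insert c {w | T.LiesOver v w} :=
    Set.ext fun w => hc.liesOver_iff hT
  have hnotMem : c ∉ {w | T.LiesOver v w} := fun h => hc.ne (LiesOver.antisymm hT h hc.2)
  rw [depth, hinsert, Set.ncard_insert_of_notMem hnotMem]
  rfl

@[elab_as_elim]
theorem LiesOver.induction (hT : T.graph.IsTree) {w : T.V} {p : ∀ u, T.LiesOver u w → Prop}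
    (base : p w (liesOver_refl hT w))
    (step : ∀ v c (hv : T.LiesOver v w) (hc : T.Child v c), p v hv → p c (hc.2.trans hT hv))
    (u : T.V) (hu : T.LiesOver u w) : p u hu := by
  induction hk : T.depth u using Nat.strong_induction_on generalizing u with
  | _ k ih =>
    obtain rfl | hne := eq_or_ne w u
    · exact base
    have hroot : u ≠ T.root := by
      rintro rfl
      exact hne ((liesOver_root hT w).antisymm hT hu)
    obtain ⟨v, hv⟩ := exists_parent hT hroot
    have hvw := ((hv.liesOver_iff hT).1 hu).resolve_left hne
    have hlt : T.depth v < k := by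
      rw [← hk, hv.depth_eq hT]
      exact Nat.lt_succ_self _
    exact step v u hvw hv (ih _ hlt v hvw rfl)

end RootedGraph

section Curves

open RootedGraph SmoothParam

variable {m n d : ℕ} {T : RootedGraph n} {M : Set (Euc m)}

namespace InfData

/-- The displacement of the vertex `u` from the point of `M` at the root edge `e` at time `ε`: the
sum of the vectors on the way from `e` to `u`, each scaled by the power of `ε` that corresponds to
its depth. -/
noncomputable def displacement (b : InfData T m) (e u : T.V) (ε : ℝ) : Euc m :=
  ∑ᶠ c ∈ {c | T.LiesOver u c ∧ T.LiesOver c e ∧ c ≠ e}, ε ^ T.depth c • b.vec c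

theorem displacement_self (hT : T.graph.IsTree) (b : InfData T m) (e : T.V) (ε : ℝ) :
    b.displacement e e ε = 0 := by
  have hempty : {c | T.LiesOver e c ∧ T.LiesOver c e ∧ c ≠ e} = ∅ :=
    Set.eq_empty_of_forall_notMem fun c ⟨hec, hce, hne⟩ => hne (hce.antisymm hT hec)
  rw [displacement, hempty, finsum_mem_empty]

theorem displacement_of_child (hT : T.graph.IsTree) (b : InfData T m) {e v c : T.V}
    (hve : T.LiesOver v e) (hc : T.Child v c) (ε : ℝ) :
    b.displacement e c ε = b.displacement e v ε + ε ^ T.depth c • b.vec c := by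
  have hvc : ¬T.LiesOver v c := fun h => hc.ne (h.antisymm hT hc.2)
  have hinsert : {w | T.LiesOver c w ∧ T.LiesOver w e ∧ w ≠ e} =
      insert c {w | T.LiesOver v w ∧ T.LiesOver w e ∧ w ≠ e} := by
    ext w
    simp only [Set.mem_ofPred_eq, Set.mem_insert_iff, hc.liesOver_iff hT, or_and_right]
    refine or_congr_left ⟨And.left, ?_⟩
    rintro rfl
    exact ⟨rfl, hc.2.trans hT hve, fun h => hvc (h ▸ hve)⟩
  rw [displacement, hinsert, finsum_mem_insert _ (fun h => hvc h.1) (Set.toFinite _), add_comm]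
  rfl

theorem displacement_mem (hT : T.IsFTree) {b : InfData T m} (hb : b.IsValid M) {e u : T.V}
    (he : T.Child T.root e) (hu : T.LiesOver u e) (ε : ℝ) :
    b.displacement e u ε ∈ tangentSpaceAt M (b.vec e) := by
  induction u, hu using LiesOver.induction hT.isTree with
  | base =>
    rw [displacement_self hT.isTree]
    exact Submodule.zero_mem _
  | step v c hve hc ih =>
    have hv : T.IsInternal v := (hc.root_or_isInternal hT).resolve_left <| by
      rintro rfl
      exact he.ne (hve.antisymm hT.isTree he.2)
    rw [displacement_of_child hT.isTree b hve hc]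
    exact Submodule.add_mem _ ih
      (Submodule.smul_mem _ _ (hb.vec_mem_tangent hT.isTree he hv hve hc))

theorem displacement_sub_isLittleO (hT : T.graph.IsTree) (b : InfData T m) {e c u : T.V}
    (hce : T.LiesOver c e) (hu : T.LiesOver u c) :
    (fun ε => b.displacement e u ε - b.displacement e c ε) =o[𝓝[>] 0]
      fun ε : ℝ => ε ^ T.depth c := by
  induction u, hu using LiesOver.induction hT with
  | base =>
    simp only [sub_self]
    exact Asymptotics.isLittleO_zero _ _
  | step v w hvc hw ih =>
    have hdepth : T.depth c < T.depth w := by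
      rw [hw.depth_eq hT]
      exact Nat.lt_succ_of_le (hvc.depth_le hT)
    have hpow : (fun ε : ℝ => ε ^ T.depth w • b.vec w) =o[𝓝[>] 0] fun ε => ε ^ T.depth c := by
      have hconst := Asymptotics.isBigO_const_const (b.vec w) (one_ne_zero' ℝ) (𝓝[>] (0 : ℝ))
      simpa using
        ((Asymptotics.isLittleO_pow_pow hdepth).mono nhdsWithin_le_nhds).smul_isBigO hconst
    simpa only [displacement_of_child hT b (hvc.trans hT hce) hw, add_sub_right_comm]
      using ih.add hpow

theorem displacement_isLittleO (hT : T.graph.IsTree) (b : InfData T m) {e u : T.V}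
    (he : T.Child T.root e) (hu : T.LiesOver u e) :
    b.displacement e u =o[𝓝[>] 0] fun ε : ℝ => ε := by
  have hdepth : 1 < T.depth e := by
    rw [he.depth_eq hT]
    exact Nat.succ_lt_succ (depth_pos hT T.root)
  have := (displacement_sub_isLittleO hT b (liesOver_refl hT e) hu).trans
    ((Asymptotics.isLittleO_pow_id hdepth).mono nhdsWithin_le_nhds)
  simpa only [displacement_self hT, sub_zero] using this

theorem tendsto_displacement_sub (hT : T.graph.IsTree) (b : InfData T m) {e v c u : T.V}
    (hve : T.LiesOver v e) (hc : T.Child v c) (hu : T.LiesOver u c) :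
    Tendsto (fun ε : ℝ => (ε ^ (T.depth v + 1))⁻¹ •
      (b.displacement e u ε - b.displacement e v ε)) (𝓝[>] 0) (𝓝 (b.vec c)) := by
  have hlittleO := displacement_sub_isLittleO hT b (hc.2.trans hT hve) hu
  rw [hc.depth_eq hT] at hlittleO
  have hsum := hlittleO.tendsto_inv_smul_nhds_zero.add_const (b.vec c)
  rw [zero_add] at hsum
  refine hsum.congr' ?_
  filter_upwards [self_mem_nhdsWithin] with ε (hε : 0 < ε)
  rw [displacement_of_child hT b hve hc, hc.depth_eq hT, ← sub_sub, smul_sub _ (_ - _),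
    inv_smul_smul₀ (pow_pos hε _).ne', sub_add_cancel]

theorem tendsto_displacement_sub_displacement (hT : T.graph.IsTree) (b : InfData T m)
    {e v c c' u u' : T.V} (hve : T.LiesOver v e) (hc : T.Child v c) (hc' : T.Child v c')
    (hu : T.LiesOver u c) (hu' : T.LiesOver u' c') :
    Tendsto (fun ε : ℝ => (ε ^ (T.depth v + 1))⁻¹ •
      (b.displacement e u ε - b.displacement e u' ε)) (𝓝[>] 0) (𝓝 (b.vec c - b.vec c')) := by
  refine ((tendsto_displacement_sub hT b hve hc hu).sub
    (tendsto_displacement_sub hT b hve hc' hu')).congr fun ε => ?_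
  rw [← smul_sub, sub_sub_sub_cancel_right]

theorem exists_curve (hM : IsSmoothSubmanifold d M) (hT : T.IsFTree) {b : InfData T m}
    (hb : b.IsValid M) : ∃ y : ℝ → Fin n → Euc m,
      (∀ᶠ ε in 𝓝[>] 0, ∀ i, y ε i ∈ M) ∧ b.IsLimit hT y (𝓝[>] 0) := by
  have displaced (e : T.EdgesAt T.root) :=
    hM.exists_curves (hb.vec_mem e.2) (fun u : {u // T.LiesOver u e.1} => b.displacement e.1 u.1)
      (fun u => displacement_mem hT hb e.2 u.2)
      (fun u => displacement_isLittleO hT.isTree b e.2 u.2)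
  choose y hyM hylim hydiff using displaced
  let Y i := y ⟨trunk hT i, child_trunk hT i⟩ ⟨T.leaf i, liesOver_trunk hT i⟩
  have hY {e : T.EdgesAt T.root} {i} (hi : T.LiesOver (T.leaf i) e.1) :
      Y i = y e ⟨T.leaf i, hi⟩ := by
    obtain rfl : e = ⟨trunk hT i, child_trunk hT i⟩ := Subtype.ext (trunk_eq hT e.2 hi).symm
    rfl
  refine ⟨fun ε i => Y i ε, eventually_all.2 fun i => hyM _ _, fun i => hylim _ _, fun v hv => ?_⟩
  refine ⟨fun ε => (ε ^ (T.depth v + 1))⁻¹, ?_, fun c c' i j hc hc' hi hj => ?_⟩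
  · filter_upwards [self_mem_nhdsWithin] with ε hε using inv_pos.2 (pow_pos hε _)
  · have hve := liesOver_rootEdge hT.isTree hv.1
    simp only [hY ((hi.trans hT.isTree hc.2).trans hT.isTree hve),
      hY ((hj.trans hT.isTree hc'.2).trans hT.isTree hve)]
    exact hydiff _ _ _ _ _ (tendsto_displacement_sub_displacement hT.isTree b hve hc hc' hi hj)

theorem exists_isLimit (hM : IsSmoothSubmanifold d M) (hT : T.IsFTree) {b : InfData T m}
    (hb : b.IsValid M) : ∃ (α : Type) (l : Filter α) (y : α → Conf (Fin n) M),
      l.NeBot ∧ b.IsLimit hT (fun t i => (y t).1 i) l := by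
  obtain ⟨y, hyM, hy⟩ := exists_curve hM hT hb
  let α := {ε : ℝ // (∀ i, y ε i ∈ M) ∧ Function.Injective (y ε)}
  refine ⟨α, comap Subtype.val (𝓝[>] 0), fun ε => ⟨fun i => ⟨y ε.1 i, ε.2.1 i⟩,
    fun i j h => ε.2.2 (Subtype.ext_iff.1 h)⟩, ?_, hy.comp tendsto_comap⟩
  rw [comap_neBot_iff]
  intro t ht
  obtain ⟨ε, hε, hεt⟩ := ((hyM.and (hy.eventually_injective hb)).and ht).exists
  exact ⟨⟨ε, hε⟩, hεt⟩

end InfData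

end Curves

/-! ### Data of the points of `C_T(M)` -/

section DataOf

open RootedGraph SmoothParam

variable {m n d : ℕ} {T : RootedGraph n} {M : Set (Euc m)}

namespace RootedGraph

/-- A chosen leaf over the upper endpoint of an edge. -/
noncomputable def edgeLeaf (hT : T.IsFTree) {v : T.V} (c : T.EdgesAt v) : Fin n :=
  (exists_leaf_liesOver hT (Child.ne_root hT.isTree c.2)).choose

theorem liesOver_edgeLeaf (hT : T.IsFTree) {v : T.V} (c : T.EdgesAt v) :
    T.LiesOver (T.leaf (edgeLeaf hT c)) c.1 :=
  (exists_leaf_liesOver hT (Child.ne_root hT.isTree c.2)).choose_spec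

theorem splitsAt_edgeLeaf (hT : T.IsFTree) {v : T.V} {c c' : T.EdgesAt v} (hne : c ≠ c') :
    T.SplitsAt (edgeLeaf hT c) (edgeLeaf hT c') v c.1 c'.1 :=
  ⟨c.2, c'.2, fun h => hne (Subtype.ext h), liesOver_edgeLeaf hT c, liesOver_edgeLeaf hT c'⟩

theorem exists_edges_of_isInternal (hT : T.IsFTree) {v : T.V} (hv : T.IsInternal v) :
    ∃ c c' : T.EdgesAt v, c ≠ c' := by
  obtain ⟨c, c', hc, hc', hne⟩ := exists_children_of_isInternal hT hv
  exact ⟨⟨c, hc⟩, ⟨c', hc'⟩, fun h => hne (Subtype.ext_iff.1 h)⟩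

/-- The edge at an internal vertex whose vector is normalized to zero. -/
noncomputable def baseEdge (hT : T.IsFTree) {v : T.V} (hv : T.IsInternal v) : T.EdgesAt v :=
  (exists_edges_of_isInternal hT hv).choose

/-- The edge at an internal vertex whose vector is normalized to length one. -/
noncomputable def scaleEdge (hT : T.IsFTree) {v : T.V} (hv : T.IsInternal v) : T.EdgesAt v :=
  (exists_edges_of_isInternal hT hv).choose_spec.choose

/-- The leaf at which the vectors at an internal vertex are based. -/
noncomputable def baseLeaf (hT : T.IsFTree) {v : T.V} (hv : T.IsInternal v) : Fin n :=
  edgeLeaf hT (baseEdge hT hv)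

/-- The leaf that determines the scale of the vectors at an internal vertex. -/
noncomputable def scaleLeaf (hT : T.IsFTree) {v : T.V} (hv : T.IsInternal v) : Fin n :=
  edgeLeaf hT (scaleEdge hT hv)

theorem splitsAt_baseLeaf_scaleLeaf (hT : T.IsFTree) {v : T.V} (hv : T.IsInternal v) :
    T.SplitsAt (baseLeaf hT hv) (scaleLeaf hT hv) v (baseEdge hT hv).1 (scaleEdge hT hv).1 :=
  splitsAt_edgeLeaf hT (exists_edges_of_isInternal hT hv).choose_spec.choose_spec

theorem baseLeaf_ne_scaleLeaf (hT : T.IsFTree) {v : T.V} (hv : T.IsInternal v) :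
    baseLeaf hT hv ≠ scaleLeaf hT hv :=
  (splitsAt_baseLeaf_scaleLeaf hT hv).leaf_ne hT.isTree

end RootedGraph

/-- Data that represent the element of `D_T(M)` corresponding to a point of `C_T(M)`: the point at
a root edge is the common position of the leaves over it, and the vectors at an internal vertex are
the positions of the leaves over it as seen from `baseLeaf`, in units of the distance between
`baseLeaf` and `scaleLeaf`. -/
noncomputable def dataOf (hT : T.IsFTree) (x : CompactAmbient n M) : InfData T m := fun e =>
  (x.1 (edgeLeaf hT e), fun v => (x.1 (edgeLeaf hT e), fun c =>
    (ratioOf x (baseLeaf hT v.2.1) (edgeLeaf hT c) (scaleLeaf hT v.2.1)).toReal •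
      dirOf x (edgeLeaf hT c) (baseLeaf hT v.2.1)))

theorem vec_dataOf (hT : T.IsFTree) (x : CompactAmbient n M) {v : T.V} (hv : T.IsInternal v)
    (c : T.EdgesAt v) : (dataOf hT x).vec c.1 =
      (ratioOf x (baseLeaf hT hv) (edgeLeaf hT c) (scaleLeaf hT hv)).toReal •
        dirOf x (edgeLeaf hT c) (baseLeaf hT hv) :=
  InfData.vec_of_isInternal hT.isTree _ hv c

section Limit

variable {α : Type*} {l : Filter α} {y : α → Conf (Fin n) M} {x : CompactAmbient n M}
  (hT : T.IsFTree) (hy : Tendsto (fun t => confEmbed n M (y t)) l (𝓝 x)) [l.NeBot]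
  (hx : (treeOf x).Iso T)
include hT hy hx

theorem eq_of_liesOver {e : T.V} (he : e ≠ T.root) {i j : Fin n}
    (hi : T.LiesOver (T.leaf i) e) (hj : T.LiesOver (T.leaf j) e) : x.1 i = x.1 j := by
  by_cases hij : i = j
  · rw [hij]
  · exact (((treeOf_iso_iff_of_tendsto hy hT).1 hx).2 i j hij).2 ⟨e, he, hi, hj⟩

theorem exclusionOf_iff_near {i j k : Fin n} :
    exclusionOf x i j k ↔ (i ≠ j ∧ i ≠ k ∧ j ≠ k) ∧ T.Near i j k :=
  ((treeOf_iso_iff_of_tendsto hy hT).1 hx).1 i j k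

theorem isBigO_diff_left {v c c' c'' : T.V} {i j k : Fin n} (h : T.SplitsAt i k v c c')
    (hc : T.Child v c'') (hj : T.LiesOver (T.leaf j) c'') :
    (fun t => diff (y t) i j) =O[l] fun t => diff (y t) i k := by
  refine isBigO_diff_of_not_exclusionOf hy (h.leaf_ne hT.isTree) fun hex => ?_
  obtain ⟨-, w, hwi, hwk, hwj⟩ := (exclusionOf_iff_near hT hy hx).1 hex
  have hjv := hj.trans hT.isTree hc.2
  have hkc := h.not_right_liesOver_left hT.isTree
  rcases hwi.total hT.isTree h.left_liesOver with hwc | hcw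
  · exact hkc (hwk.trans hT.isTree hwc)
  · rcases (h.child_left.liesOver_iff hT.isTree).1 hcw with rfl | hvw
    · exact hkc hwk
    · exact hwj (hjv.trans hT.isTree hvw)

theorem isBigO_diff_of_splitsAt {v c c' d d' : T.V} {i j k p : Fin n}
    (h : T.SplitsAt k p v d d') (hc : T.Child v c) (hc' : T.Child v c')
    (hi : T.LiesOver (T.leaf i) c) (hj : T.LiesOver (T.leaf j) c') :
    (fun t => diff (y t) i j) =O[l] fun t => diff (y t) k p :=
  ((isBigO_diff_left hT hy hx h hc' hj).sub (isBigO_diff_left hT hy hx h hc hi)).congr_left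
    fun t => diff_sub_diff (y t) k j i

theorem isLittleO_diff_left {v c c' : T.V} {i j k : Fin n} (h : T.SplitsAt i k v c c')
    (hj : T.LiesOver (T.leaf j) c) :
    (fun t => diff (y t) i j) =o[l] fun t => diff (y t) i k := by
  by_cases hij : i = j
  · subst hij
    simpa only [diff_self] using Asymptotics.isLittleO_zero _ _
  have hjk : T.SplitsAt j k v c c' := ⟨h.child_left, h.child_right, h.ne, hj, h.right_liesOver⟩
  have hkc := h.not_right_liesOver_left hT.isTree
  exact ((exclusionOf_iff_isLittleO hy).1 ((exclusionOf_iff_near hT hy hx).2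
    ⟨⟨hij, h.leaf_ne hT.isTree, hjk.leaf_ne hT.isTree⟩, c, h.left_liesOver, hj, hkc⟩)).2.2

theorem isLittleO_diff_of_splitsAt {v c d d' : T.V} {i j k p : Fin n}
    (h : T.SplitsAt k p v d d') (hc : T.Child v c) (hi : T.LiesOver (T.leaf i) c)
    (hj : T.LiesOver (T.leaf j) c) :
    (fun t => diff (y t) i j) =o[l] fun t => diff (y t) k p := by
  by_cases hcd : c = d
  · have hip : T.SplitsAt i p v c d' := ⟨hc, h.child_right, hcd ▸ h.ne, hi, h.right_liesOver⟩
    exact (isLittleO_diff_left hT hy hx hip hj).trans_isBigO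
      (isBigO_diff_of_splitsAt hT hy hx h hc h.child_right hi h.right_liesOver)
  · have hik : T.SplitsAt i k v c d := ⟨hc, h.child_left, hcd, hi, h.left_liesOver⟩
    exact (isLittleO_diff_left hT hy hx hik hj).trans_isBigO
      (isBigO_diff_of_splitsAt hT hy hx h hc h.child_left hi h.left_liesOver)

section Internal

variable {v : T.V} (hv : T.IsInternal v)
include hv

theorem ratioOf_baseLeaf_ne_top (c : T.EdgesAt v) :
    ratioOf x (baseLeaf hT hv) (edgeLeaf hT c) (scaleLeaf hT hv) ≠ ⊤ := by
  by_cases hc : edgeLeaf hT c = baseLeaf hT hv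
  · simp [ratioOf, hc]
  have hne := baseLeaf_ne_scaleLeaf hT hv
  rw [ratioOf_swap hy hne (Ne.symm hc), ENNReal.inv_ne_top, Ne,
    ratioOf_eq_zero_iff hy hne (Ne.symm hc)]
  intro hlittleO
  have hbigO := isBigO_diff_left hT hy hx (splitsAt_baseLeaf_scaleLeaf hT hv) c.2
    (liesOver_edgeLeaf hT c)
  exact Asymptotics.isLittleO_irrefl (Eventually.of_forall fun t =>
    diff_ne_zero (y t) (Ne.symm hc)).frequently (hbigO.trans_isLittleO hlittleO)

theorem tendsto_smul_diff_baseLeaf (c : T.EdgesAt v) :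
    Tendsto (fun t => ‖diff (y t) (baseLeaf hT hv) (scaleLeaf hT hv)‖⁻¹ •
      diff (y t) (edgeLeaf hT c) (baseLeaf hT hv)) l (𝓝 ((dataOf hT x).vec c.1)) := by
  rw [vec_dataOf hT x hv]
  by_cases hc : edgeLeaf hT c = baseLeaf hT hv
  · simp [hc, dirOf, diff_self]
  refine ((tendsto_ratio_toReal hy (Ne.symm hc) (baseLeaf_ne_scaleLeaf hT hv)
    (ratioOf_baseLeaf_ne_top hT hy hx hv c)).smul (tendsto_dir hy _ _)).congr fun t => ?_
  have hnorm := norm_ne_zero_iff.2 (diff_ne_zero (y t) hc)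
  rw [← neg_diff (y t) (edgeLeaf hT c) (baseLeaf hT hv), norm_neg, smul_smul, div_eq_inv_mul,
    mul_assoc, mul_inv_cancel₀ hnorm, mul_one]

theorem tendsto_smul_diff_edgeLeaf (c : T.EdgesAt v) {i : Fin n} (hi : T.LiesOver (T.leaf i) c.1) :
    Tendsto (fun t => ‖diff (y t) (baseLeaf hT hv) (scaleLeaf hT hv)‖⁻¹ •
      diff (y t) i (edgeLeaf hT c)) l (𝓝 0) :=
  (isLittleO_diff_of_splitsAt hT hy hx (splitsAt_baseLeaf_scaleLeaf hT hv) c.2 hi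
    (liesOver_edgeLeaf hT c)).norm_right.tendsto_inv_smul_nhds_zero

theorem tendsto_smul_diff {c c' : T.V} (hc : T.Child v c) (hc' : T.Child v c') {i j : Fin n}
    (hi : T.LiesOver (T.leaf i) c) (hj : T.LiesOver (T.leaf j) c') :
    Tendsto (fun t => ‖diff (y t) (baseLeaf hT hv) (scaleLeaf hT hv)‖⁻¹ • diff (y t) i j) l
      (𝓝 ((dataOf hT x).vec c - (dataOf hT x).vec c')) := by
  have from_baseLeaf {k w} (hw : T.Child v w) (hk : T.LiesOver (T.leaf k) w) :
      Tendsto (fun t => ‖diff (y t) (baseLeaf hT hv) (scaleLeaf hT hv)‖⁻¹ •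
        diff (y t) k (baseLeaf hT hv)) l (𝓝 ((dataOf hT x).vec w)) := by
    have := (tendsto_smul_diff_edgeLeaf hT hy hx hv ⟨w, hw⟩ hk).add
      (tendsto_smul_diff_baseLeaf hT hy hx hv ⟨w, hw⟩)
    simpa only [← smul_add, diff, sub_add_sub_cancel, zero_add] using this
  refine ((from_baseLeaf hc hi).sub (from_baseLeaf hc' hj)).congr fun t => ?_
  simp only [← smul_sub, diff, sub_sub_sub_cancel_right]

theorem vec_dataOf_ne {c c' : T.EdgesAt v} (hne : c ≠ c') :
    (dataOf hT x).vec c.1 ≠ (dataOf hT x).vec c'.1 := by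
  intro heq
  have hsplit := splitsAt_edgeLeaf hT hne
  have hscale := splitsAt_baseLeaf_scaleLeaf hT hv
  have hbigO := isBigO_diff_of_splitsAt hT hy hx hsplit hscale.child_left hscale.child_right
    hscale.left_liesOver hscale.right_liesOver
  have hlim := tendsto_smul_diff hT hy hx hv c.2 c'.2 (liesOver_edgeLeaf hT c)
    (liesOver_edgeLeaf hT c')
  rw [heq, sub_self] at hlim
  have hlittleO : (fun t => diff (y t) (edgeLeaf hT c) (edgeLeaf hT c')) =o[l]
      fun t => diff (y t) (baseLeaf hT hv) (scaleLeaf hT hv) := by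
    refine (Asymptotics.isLittleO_of_tendsto (fun t ht => absurd ht (norm_ne_zero_iff.2
      (diff_ne_zero _ (baseLeaf_ne_scaleLeaf hT hv)))) ?_).of_norm_norm
    rw [← norm_zero (E := Euc m)]
    refine hlim.norm.congr fun t => ?_
    rw [norm_smul, norm_inv, norm_norm, div_eq_inv_mul]
  exact Asymptotics.isLittleO_irrefl (Eventually.of_forall fun t => diff_ne_zero (y t)
    (hsplit.leaf_ne hT.isTree)).frequently (hlittleO.trans_isBigO hbigO)

theorem vec_dataOf_mem_tangent (hM : IsSmoothSubmanifold d M) {e : T.EdgesAt T.root}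
    (hve : T.LiesOver v e.1) (c : T.EdgesAt v) :
    (dataOf hT x).vec c.1 ∈ tangentSpaceAt M (x.1 (edgeLeaf hT e)) := by
  have tendsto_base {i : Fin n} (hi : T.LiesOver (T.leaf i) v) :
      Tendsto (fun t => ((y t).1 i : Euc m)) l (𝓝 (x.1 (edgeLeaf hT e))) := by
    rw [← eq_of_liesOver hT hy hx (Child.ne_root hT.isTree e.2) (hi.trans hT.isTree hve)
      (liesOver_edgeLeaf hT e)]
    exact tendsto_point hy i
  exact hM.mem_tangentSpaceAt_of_secant (x.1 (edgeLeaf hT e)).2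
    (tendsto_base ((liesOver_edgeLeaf hT c).trans hT.isTree c.2.2))
    (tendsto_base ((splitsAt_baseLeaf_scaleLeaf hT hv).left_liesOver_vertex hT.isTree))
    (fun t => ((y t).1 _).2) (fun t => ((y t).1 _).2) (tendsto_smul_diff_baseLeaf hT hy hx hv c)

end Internal

theorem injective_point_edgeLeaf :
    Function.Injective fun e : T.EdgesAt T.root => x.1 (edgeLeaf hT e) := by
  intro e e' heq
  by_contra hne
  have hsplit := splitsAt_edgeLeaf hT hne
  obtain ⟨v, hv, hev, hev'⟩ := (((treeOf_iso_iff_of_tendsto hy hT).1 hx).2 _ _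
    (hsplit.leaf_ne hT.isTree)).1 heq
  obtain ⟨c, hc, hvc⟩ := exists_child_of_liesOver hT.isTree (liesOver_root hT.isTree v) hv
  have hec := hsplit.child_left.eq_of_liesOver hT.isTree hc (liesOver_edgeLeaf hT e)
    (LiesOver.trans hT.isTree hev hvc)
  have hec' := hsplit.child_right.eq_of_liesOver hT.isTree hc (liesOver_edgeLeaf hT e')
    (LiesOver.trans hT.isTree hev' hvc)
  exact hsplit.ne (hec.trans hec'.symm)

theorem isLimit_dataOf : (dataOf hT x).IsLimit hT (fun t i => (y t).1 i) l := by
  refine ⟨fun i => ?_, fun v hv => ⟨fun t => ‖diff (y t) (baseLeaf hT hv) (scaleLeaf hT hv)‖⁻¹,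
    Eventually.of_forall fun t => inv_pos.2 (norm_pos_iff.2 (diff_ne_zero _
      (baseLeaf_ne_scaleLeaf hT hv))),
    fun c c' i j hc hc' hi hj => tendsto_smul_diff hT hy hx hv hc hc' hi hj⟩⟩
  have hbase : (dataOf hT x).vec (trunk hT i) = x.1 i := by
    rw [InfData.vec_root _ ⟨_, child_trunk hT i⟩]
    exact congrArg Subtype.val (eq_of_liesOver hT hy hx ((child_trunk hT i).ne_root hT.isTree)
      (liesOver_edgeLeaf hT _) (liesOver_trunk hT i))
  rw [hbase]
  exact tendsto_point hy i

theorem isValid_dataOf (hM : IsSmoothSubmanifold d M) : (dataOf hT x).IsValid M where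
  mem e := (x.1 _).2
  base_injective := Subtype.val_injective.comp (injective_point_edgeLeaf hT hy hx)
  base_eq e v := rfl
  injective e v c c' heq := by
    by_contra hne
    refine vec_dataOf_ne hT hy hx v.2.1 hne ?_
    rwa [vec_dataOf hT x v.2.1, vec_dataOf hT x v.2.1]
  mem_tangent e v c := by
    have := vec_dataOf_mem_tangent hT hy hx v.2.1 hM v.2.2 c
    rwa [vec_dataOf hT x v.2.1] at this

end Limit

end DataOf

/-! ### The bijection between `C_T(M)` and `D_T(M)` -/

section Bijection

open RootedGraph SmoothParam

variable {m n d : ℕ} {T : RootedGraph n} {M : Set (Euc m)}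

namespace InfData

theorem IsLimit.congr {hT : T.IsFTree} {b b' : InfData T m} {hb : b.IsValid M}
    {hb' : b'.IsValid M} {α : Type*} {y : α → Fin n → Euc m} {l : Filter α}
    (h : b.IsLimit hT y l) (heq : b.toInfStratum hb = b'.toInfStratum hb') :
    b'.IsLimit hT y l := by
  obtain ⟨base_eq, exists_vec_eq⟩ := (toInfStratum_eq_iff hb hb').1 heq
  refine ⟨fun i => ?_, fun v hv => ?_⟩
  · rw [vec_root b' ⟨_, child_trunk hT i⟩, ← base_eq, ← vec_root b ⟨_, child_trunk hT i⟩]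
    exact h.point i
  · obtain ⟨r, hr, hlim⟩ := h.isLimitAt_of_isInternal v hv
    obtain ⟨s, hs, w, hw⟩ := exists_vec_eq _ (Internal.over hT.isTree ⟨v, hv⟩)
    have vec_eq {c : T.V} (hc : T.Child v c) : b'.vec c = s • b.vec c + w := by
      rw [vec_of_isInternal hT.isTree b' hv ⟨c, hc⟩, vec_of_isInternal hT.isTree b hv ⟨c, hc⟩]
      exact hw ⟨c, hc⟩
    refine ⟨fun t => s * r t, hr.mono fun t ht => mul_pos hs ht, fun c c' i j hc hc' hi hj => ?_⟩
    rw [vec_eq hc, vec_eq hc', add_sub_add_right_eq_sub, ← smul_sub]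
    exact ((hlim c c' i j hc hc' hi hj).const_smul s).congr fun t => smul_smul ..

theorem ratio_eq_zero_iff (hT : T.IsFTree) {i j k : Fin n} (hij : i ≠ j) (hik : i ≠ k)
    {b : InfData T m} (hb : b.IsValid M) : b.ratio i j k = 0 ↔ T.Near i j k := by
  rw [ratio]
  split_ifs with hbr hnear
  · have := norm_pos_iff.2 (hb.gap_ne_zero hT hij)
    have := norm_pos_iff.2 (hb.gap_ne_zero hT hik)
    refine iff_of_false (fun h => ?_) (not_near_of_branch_eq hT hij hik hbr)
    exact absurd (ENNReal.ofReal_eq_zero.1 h) (not_le.2 (by positivity))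
  · exact iff_of_true rfl hnear
  · exact iff_of_false ENNReal.top_ne_zero hnear

theorem IsValid.vec_trunk_eq_iff {b : InfData T m} (hb : b.IsValid M) (hT : T.IsFTree)
    {i j : Fin n} : b.vec (trunk hT i) = b.vec (trunk hT j) ↔
      ∃ v, v ≠ T.root ∧ T.LiesOver (T.leaf i) v ∧ T.LiesOver (T.leaf j) v := by
  constructor
  · intro h
    have htrunk : trunk hT i = trunk hT j := by
      by_contra hne
      exact hb.vec_ne hT (child_trunk hT i) (child_trunk hT j) hne h
    exact ⟨trunk hT i, (child_trunk hT i).ne_root hT.isTree, liesOver_trunk hT i,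
      htrunk ▸ liesOver_trunk hT j⟩
  · rintro ⟨v, hv, hi, hj⟩
    obtain ⟨c, hc, hvc⟩ := exists_child_of_liesOver hT.isTree (liesOver_root hT.isTree v) hv
    rw [trunk_eq hT hc (LiesOver.trans hT.isTree hi hvc),
      trunk_eq hT hc (LiesOver.trans hT.isTree hj hvc)]

variable (hM : IsSmoothSubmanifold d M) (hT : T.IsFTree)

section

include hM

theorem treeOf_toAmbient_iso {b : InfData T m} (hb : b.IsValid M) :
    (treeOf (b.toAmbient hT hb)).Iso T := by
  obtain ⟨α, l, y, hl, hy⟩ := exists_isLimit hM hT hb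
  refine (treeOf_iso_iff_of_tendsto (hy.tendsto_confEmbed hb) hT).2 ⟨fun i j k => ?_,
    fun i j _ => Subtype.ext_iff.trans (hb.vec_trunk_eq_iff hT)⟩
  rw [exclusionOf_iff]
  refine and_congr_right fun h => ?_
  rw [ratioOf_toAmbient hT hb h.1 h.2.1 h.2.2, ratio_eq_zero_iff hT h.1 h.2.1 hb]

theorem toAmbient_mem {b : InfData T m} (hb : b.IsValid M) :
    b.toAmbient hT hb ∈ canonicalCompactification n M := by
  obtain ⟨α, l, y, hl, hy⟩ := exists_isLimit hM hT hb
  exact mem_closure_of_tendsto (hy.tendsto_confEmbed hb) (Eventually.of_forall fun t => ⟨y t, rfl⟩)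

end

/-- The point of `C_T(M)` that corresponds to given data. -/
noncomputable def toStratum (b : InfData T m) (hb : b.IsValid M) : Stratum T M :=
  ⟨b.toAmbient hT hb, toAmbient_mem hM hT hb, treeOf_toAmbient_iso hM hT hb⟩

theorem toStratum_congr {b b' : InfData T m} (hb : b.IsValid M) (hb' : b'.IsValid M)
    (h : b.toInfStratum hb = b'.toInfStratum hb') :
    b.toStratum hM hT hb = b'.toStratum hM hT hb' := by
  obtain ⟨α, l, y, hl, hy⟩ := exists_isLimit hM hT hb
  exact Subtype.ext (tendsto_nhds_unique (hy.tendsto_confEmbed hb)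
    ((hy.congr h).tendsto_confEmbed hb'))

end InfData

variable (hM : IsSmoothSubmanifold d M) (hT : T.IsFTree)

section

include hM

theorem isValid_dataOf_stratum (x : Stratum T M) : (dataOf hT x.1).IsValid M := by
  obtain ⟨l, hl, hy⟩ := exists_tendsto_of_mem_canonicalCompactification x.2.1
  exact isValid_dataOf hT (y := fun t => t) hy x.2.2 hM

end

theorem toStratum_dataOf (x : Stratum T M) :
    (dataOf hT x.1).toStratum hM hT (isValid_dataOf_stratum hM hT x) = x := by
  obtain ⟨l, hl, hy⟩ := exists_tendsto_of_mem_canonicalCompactification x.2.1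
  exact Subtype.ext (tendsto_nhds_unique
    ((isLimit_dataOf hT (y := fun t => t) hy x.2.2).tendsto_confEmbed
      (isValid_dataOf_stratum hM hT x)) hy)

include hM in
theorem vec_dataOf_toAmbient {b : InfData T m} (hb : b.IsValid M) {v : T.V}
    (hv : T.IsInternal v) (c : T.EdgesAt v) : (dataOf hT (b.toAmbient hT hb)).vec c.1 =
      ‖b.gap (baseLeaf hT hv) (scaleLeaf hT hv)‖⁻¹ • (b.vec c.1 - b.vec (baseEdge hT hv).1) := by
  obtain ⟨α, l, y, hl, hy⟩ := InfData.exists_isLimit hM hT hb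
  obtain ⟨r, hr, hlim⟩ := hy.isLimitAt_of_isInternal v hv
  have hscale := splitsAt_baseLeaf_scaleLeaf hT hv
  have tendsto_vec := hlim _ _ _ _ c.2 hscale.child_left (liesOver_edgeLeaf hT c)
    hscale.left_liesOver
  have tendsto_gap := hlim _ _ _ _ hscale.child_left hscale.child_right hscale.left_liesOver
    hscale.right_liesOver
  rw [← b.gap_eq hT.isTree hscale] at tendsto_gap
  refine tendsto_nhds_unique (tendsto_smul_diff_baseLeaf hT (hy.tendsto_confEmbed hb)
    (InfData.treeOf_toAmbient_iso hM hT hb) hv c) (((tendsto_gap.norm.inv₀ (norm_ne_zero_iff.2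
    (hb.gap_ne_zero hT (baseLeaf_ne_scaleLeaf hT hv)))).smul tendsto_vec).congr' ?_)
  filter_upwards [hr] with t ht
  rw [norm_smul, Real.norm_of_nonneg ht.le, smul_smul, mul_inv_rev, inv_mul_cancel_right₀ ht.ne']
  rfl

theorem toInfStratum_dataOf {b : InfData T m} (hb : b.IsValid M) :
    (dataOf hT (b.toStratum hM hT hb).1).toInfStratum (isValid_dataOf_stratum hM hT _) =
      b.toInfStratum hb := by
  refine ((InfData.toInfStratum_eq_iff hb _).2 ⟨fun e => ?_, fun e v => ?_⟩).symm
  · exact (InfData.vec_root b e).symm.trans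
      (congrArg b.vec (trunk_eq hT e.2 (liesOver_edgeLeaf hT e)).symm)
  · set s := ‖b.gap (baseLeaf hT v.2.1) (scaleLeaf hT v.2.1)‖⁻¹
    have hs : 0 < s :=
      inv_pos.2 (norm_pos_iff.2 (hb.gap_ne_zero hT (baseLeaf_ne_scaleLeaf hT v.2.1)))
    refine ⟨s, hs, -(s • b.vec (baseEdge hT v.2.1).1), fun c => ?_⟩
    rw [← InfData.vec_internal hT.isTree _ e v c, ← InfData.vec_internal hT.isTree _ e v c,
      ← sub_eq_add_neg, ← smul_sub]
    exact vec_dataOf_toAmbient hM hT hb v.2.1 c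

/-- The bijection between `C_T(M)` and `D_T(M)`. -/
noncomputable def stratumEquiv : Stratum T M ≃ InfStratum T M where
  toFun x := (dataOf hT x.1).toInfStratum (isValid_dataOf_stratum hM hT x)
  invFun p := InfData.toStratum hM hT _ (InfData.isValid_of_rep (rep_exists p).choose_spec)
  left_inv x := (InfData.toStratum_congr hM hT _ _ (InfData.toInfStratum_of_rep
    (rep_exists (X := InfStratum T M) _).choose_spec)).trans (toStratum_dataOf hM hT x)
  right_inv p := (toInfStratum_dataOf hM hT _).trans (InfData.toInfStratum_of_rep
    (rep_exists p).choose_spec)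

theorem stratumEquiv_symm_of_rep {b : InfData T m} {p : InfStratum T M}
    (h : Rep (X := InfStratum T M) b p) :
    (stratumEquiv hM hT).symm p = b.toStratum hM hT (InfData.isValid_of_rep h) :=
  InfData.toStratum_congr hM hT _ _ ((InfData.toInfStratum_of_rep
    (rep_exists p).choose_spec).trans (InfData.toInfStratum_of_rep h).symm)

end Bijection

/-! ### Smoothness of the bijection -/

section Smoothness

open RootedGraph SmoothParam

variable {m n d : ℕ} {T : RootedGraph n} {M : Set (Euc m)}

/-- The parameters of `A_n[M]`: the points, the directions, and the coordinates `t / (1 + t)` of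
the ratios. -/
abbrev AmbientData (n m : ℕ) : Type :=
  (Fin n → Euc m) × (Conf (Fin 2) (Fin n) → Euc m) × (Conf (Fin 3) (Fin n) → ℝ)

namespace AmbientData

/-- The direction `u_ij`; zero if `i = j`. -/
noncomputable def dir (a : AmbientData n m) (i j : Fin n) : Euc m :=
  if h : i ≠ j then a.2.1 ⟨![i, j], injective_pair_iff.2 h⟩ else 0

/-- The coordinate of the ratio `d_ijk`; that of one if the indices are not distinct. -/
noncomputable def coord (a : AmbientData n m) (i j k : Fin n) : ℝ :=
  if h : i ≠ j ∧ i ≠ k ∧ j ≠ k then a.2.2 ⟨![i, j, k], injective_triple_iff.2 h⟩ else 1 / 2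

/-- `dataOf` in terms of parameters. -/
noncomputable def toInfData (hT : T.IsFTree) (a : AmbientData n m) : InfData T m := fun e =>
  (a.1 (edgeLeaf hT e), fun v => (a.1 (edgeLeaf hT e), fun c =>
    (a.coord (baseLeaf hT v.2.1) (edgeLeaf hT c) (scaleLeaf hT v.2.1) /
      (1 - a.coord (baseLeaf hT v.2.1) (edgeLeaf hT c) (scaleLeaf hT v.2.1))) •
      a.dir (edgeLeaf hT c) (baseLeaf hT v.2.1)))

section Rep

variable {a : AmbientData n m} {x : CompactAmbient n M} (h : Rep (X := CompactAmbient n M) a x)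
include h

theorem point_of_rep (i : Fin n) : a.1 i = x.1 i := h.1 i

theorem dir_of_rep (i j : Fin n) : a.dir i j = dirOf x i j := by
  rw [dir, dirOf]
  split_ifs with hij
  · exact h.2.1 _
  · rfl

theorem coord_of_rep (i j k : Fin n) : a.coord i j k = birationalCoord (ratioOf x i j k) := by
  rw [coord, ratioOf]
  split_ifs with hijk
  · exact h.2.2 _
  · rw [← ENNReal.ofReal_one, ← div_one (1 : ℝ), birationalCoord_ofReal_div one_pos one_pos]
    norm_num

theorem toInfData_of_rep (hT : T.IsFTree) : a.toInfData hT = dataOf hT x := by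
  funext e
  refine Prod.ext (point_of_rep h _) (funext fun v => Prod.ext (point_of_rep h _)
    (funext fun c => ?_))
  simp only [toInfData, dataOf, coord_of_rep h, dir_of_rep h, toReal_eq_birationalCoord]

end Rep

theorem contDiff_point (i : Fin n) :
    @ContDiff ℝ _ (Param (Stratum T M)) _ _ (Euc m) _ _ ∞ fun a : AmbientData n m => a.1 i :=
  (contDiff_param_apply (Z := fun _ : Fin n => M) i).comp (contDiff_param_fst (X := Fin n → M)
    (Y := (Conf (Fin 2) (Fin n) → Metric.sphere (0 : Euc m) 1) × (Conf (Fin 3) (Fin n) → ENNReal)))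

theorem contDiff_dir (i j : Fin n) :
    @ContDiff ℝ _ (Param (Stratum T M)) _ _ (Euc m) _ _ ∞ fun a : AmbientData n m => a.dir i j := by
  by_cases h : i ≠ j
  · simp only [dir, dif_pos h]
    exact (contDiff_param_apply (Z := fun _ : Conf (Fin 2) (Fin n) => Metric.sphere (0 : Euc m) 1)
      _).comp ((contDiff_param_fst (X := Conf (Fin 2) (Fin n) → Metric.sphere (0 : Euc m) 1)
      (Y := Conf (Fin 3) (Fin n) → ENNReal)).comp (contDiff_param_snd (X := Fin n → M)
      (Y := (Conf (Fin 2) (Fin n) → Metric.sphere (0 : Euc m) 1) ×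
        (Conf (Fin 3) (Fin n) → ENNReal))))
  · simp only [dir, dif_neg h]
    exact contDiff_const

theorem contDiff_coord (i j k : Fin n) :
    @ContDiff ℝ _ (Param (Stratum T M)) _ _ ℝ _ _ ∞ fun a : AmbientData n m => a.coord i j k := by
  by_cases h : i ≠ j ∧ i ≠ k ∧ j ≠ k
  · simp only [coord, dif_pos h]
    exact (contDiff_param_apply (Z := fun _ : Conf (Fin 3) (Fin n) => ENNReal)
      _).comp ((contDiff_param_snd (X := Conf (Fin 2) (Fin n) → Metric.sphere (0 : Euc m) 1)
      (Y := Conf (Fin 3) (Fin n) → ENNReal)).comp (contDiff_param_snd (X := Fin n → M)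
      (Y := (Conf (Fin 2) (Fin n) → Metric.sphere (0 : Euc m) 1) ×
        (Conf (Fin 3) (Fin n) → ENNReal))))
  · simp only [coord, dif_neg h]
    exact contDiff_const

theorem contDiffOn_toInfData (hT : T.IsFTree) {U : Set (Param (Stratum T M))}
    (hU : ∀ a ∈ U, ∀ (v : T.Internal) (c : T.EdgesAt v.1),
      coord a (baseLeaf hT v.2) (edgeLeaf hT c) (scaleLeaf hT v.2) ≠ 1) :
    @ContDiffOn ℝ _ (Param (Stratum T M)) _ _ (Param (InfStratum T M)) _ _ ∞
      (fun a : AmbientData n m => a.toInfData hT) U := by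
  refine contDiffOn_param_pi (Z := fun e => InfConfOver T M e) fun e =>
    contDiffOn_param_prod (X := M) (Y := ∀ v : T.InternalOver e, InfConf M (T.EdgesAt v.1))
      (contDiff_point _).contDiffOn (contDiffOn_param_pi
        (Z := fun v : T.InternalOver e => InfConf M (T.EdgesAt v.1)) fun v =>
          contDiffOn_param_prod (X := M) (Y := T.EdgesAt v.1 → Euc m)
            (contDiff_point _).contDiffOn (contDiffOn_param_pi
              (Z := fun _ : T.EdgesAt v.1 => Euc m) fun c => ?_))
  exact ((contDiff_coord _ _ _).contDiffOn.div (contDiff_const.sub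
    (contDiff_coord _ _ _)).contDiffOn fun a ha =>
      sub_ne_zero.2 (hU a ha ⟨v.1, v.2.1⟩ c).symm).smul (contDiff_dir _ _).contDiffOn

end AmbientData

theorem isSmooth_stratumEquiv (hM : IsSmoothSubmanifold d M) (hT : T.IsFTree) :
    IsSmooth (stratumEquiv hM hT) := by
  intro x a ha
  let U : Set (Param (Stratum T M)) := {a | ∀ (v : T.Internal) (c : T.EdgesAt v.1),
    AmbientData.coord a (baseLeaf hT v.2) (edgeLeaf hT c) (scaleLeaf hT v.2) ≠ 1}
  have isOpen_U : IsOpen U := by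
    simp only [U, Set.ofPred_forall]
    exact isOpen_iInter_of_finite fun v => isOpen_iInter_of_finite fun c =>
      isOpen_ne_fun (AmbientData.contDiff_coord _ _ _).continuous continuous_const
  have mem_U : a ∈ U := by
    obtain ⟨l, hl, hy⟩ := exists_tendsto_of_mem_canonicalCompactification x.2.1
    intro v c
    rw [AmbientData.coord_of_rep ha]
    exact birationalCoord_ne_one
      (ratioOf_baseLeaf_ne_top hT (y := fun t => t) hy x.2.2 v.2 c)
  refine ⟨U, AmbientData.toInfData hT, isOpen_U, mem_U,
    AmbientData.contDiffOn_toInfData hT fun _ h => h, fun b _ y hy => ?_⟩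
  rw [AmbientData.toInfData_of_rep hy hT]
  exact InfData.rep_toInfStratum _ (isValid_dataOf_stratum hM hT y)

namespace InfData

theorem contDiff_gap (i j : Fin n) :
    @ContDiff ℝ _ (Param (InfStratum T M)) _ _ (Euc m) _ _ ∞ fun b : InfData T m => b.gap i j :=
  (contDiff_vec _).sub (contDiff_vec _)

open Classical in
/-- The coordinate of the ratio `d_ijk`, as a smooth function of the data. -/
noncomputable def ratioCoord (b : InfData T m) (i j k : Fin n) : ℝ :=
  if T.branch i j = T.branch i k then ‖b.gap i j‖ / (‖b.gap i j‖ + ‖b.gap i k‖)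
  else if T.Near i j k then 0 else 1

theorem ratioCoord_eq (hT : T.IsFTree) {b : InfData T m} (hb : b.IsValid M) {i j k : Fin n}
    (hij : i ≠ j) (hik : i ≠ k) : b.ratioCoord i j k = birationalCoord (b.ratio i j k) := by
  rw [ratioCoord, ratio]
  split_ifs
  · exact (birationalCoord_ofReal_div (norm_pos_iff.2 (hb.gap_ne_zero hT hij))
      (norm_pos_iff.2 (hb.gap_ne_zero hT hik))).symm
  · exact birationalCoord_zero.symm
  · exact birationalCoord_top.symm

/-- `toAmbient` in terms of parameters. -/
noncomputable def toAmbientData (hT : T.IsFTree) (b : InfData T m) : AmbientData n m :=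
  (fun i => b.vec (trunk hT i), fun p => ‖b.gap (p.1 0) (p.1 1)‖⁻¹ • b.gap (p.1 0) (p.1 1),
    fun q => b.ratioCoord (q.1 0) (q.1 1) (q.1 2))

theorem rep_toStratum (hM : IsSmoothSubmanifold d M) (hT : T.IsFTree) {b : InfData T m}
    (hb : b.IsValid M) :
    Rep (X := Stratum T M) (b.toAmbientData hT) (b.toStratum hM hT hb) :=
  ⟨fun _ => rfl, fun _ => rfl, fun q => ratioCoord_eq hT hb
    (q.2.ne (by decide)) (q.2.ne (by decide))⟩

section GapNeZero

variable {U : Set (Param (InfStratum T M))}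
  (hU : ∀ b ∈ U, ∀ i j : Fin n, i ≠ j → gap b i j ≠ 0)
include hU

theorem contDiffOn_norm_gap {i j : Fin n} (hij : i ≠ j) :
    @ContDiffOn ℝ _ (Param (InfStratum T M)) _ _ ℝ _ _ ∞ (fun b : InfData T m => ‖b.gap i j‖) U :=
  (contDiff_gap i j).contDiffOn.norm ℝ fun b hb => hU b hb i j hij

theorem contDiffOn_ratioCoord {i j k : Fin n} (hij : i ≠ j) (hik : i ≠ k) :
    @ContDiffOn ℝ _ (Param (InfStratum T M)) _ _ ℝ _ _ ∞
      (fun b : InfData T m => b.ratioCoord i j k) U := by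
  classical
  by_cases hbr : T.branch i j = T.branch i k
  · have hij_norm := contDiffOn_norm_gap hU hij
    exact (hij_norm.div (hij_norm.add (contDiffOn_norm_gap hU hik)) fun b hb =>
      (add_pos (norm_pos_iff.2 (hU b hb _ _ hij)) (norm_pos_iff.2 (hU b hb _ _ hik))).ne').congr
        fun b _ => if_pos hbr
  · exact (contDiffOn_const (c := if T.Near i j k then (0 : ℝ) else 1)).congr
      fun b _ => if_neg hbr

theorem contDiffOn_toAmbientData (hT : T.IsFTree) :
    @ContDiffOn ℝ _ (Param (InfStratum T M)) _ _ (Param (Stratum T M)) _ _ ∞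
      (fun b : InfData T m => b.toAmbientData hT) U := by
  refine contDiffOn_param_prod (X := Fin n → M)
    (Y := (Conf (Fin 2) (Fin n) → Metric.sphere (0 : Euc m) 1) × (Conf (Fin 3) (Fin n) → ENNReal))
    (contDiffOn_param_pi (Z := fun _ : Fin n => M) fun i => (contDiff_vec _).contDiffOn)
    (contDiffOn_param_prod (X := Conf (Fin 2) (Fin n) → Metric.sphere (0 : Euc m) 1)
      (Y := Conf (Fin 3) (Fin n) → ENNReal)
      (contDiffOn_param_pi (Z := fun _ : Conf (Fin 2) (Fin n) => Metric.sphere (0 : Euc m) 1)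
        fun p => ?_)
      (contDiffOn_param_pi (Z := fun _ : Conf (Fin 3) (Fin n) => ENNReal) fun q =>
        contDiffOn_ratioCoord hU (q.2.ne (by decide)) (q.2.ne (by decide))))
  have hne : p.1 0 ≠ p.1 1 := p.2.ne (by decide)
  exact ((contDiffOn_norm_gap hU hne).inv fun b hb => norm_ne_zero_iff.2 (hU b hb _ _ hne)).smul
    (contDiff_gap _ _).contDiffOn

end GapNeZero

end InfData

theorem isSmooth_stratumEquiv_symm (hM : IsSmoothSubmanifold d M) (hT : T.IsFTree) :
    IsSmooth (stratumEquiv hM hT).symm := by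
  intro p a ha
  let U : Set (Param (InfStratum T M)) := {b | ∀ i j : Fin n, i ≠ j → InfData.gap b i j ≠ 0}
  have isOpen_U : IsOpen U := by
    simp only [U, Set.ofPred_forall]
    exact isOpen_iInter_of_finite fun i => isOpen_iInter_of_finite fun j =>
      isOpen_iInter_of_finite fun _ =>
        isOpen_ne_fun (InfData.contDiff_gap _ _).continuous continuous_const
  refine ⟨U, InfData.toAmbientData hT, isOpen_U,
    fun i j hij => (InfData.isValid_of_rep ha).gap_ne_zero hT hij,
    InfData.contDiffOn_toAmbientData (fun _ h => h) hT, fun b _ q hq => ?_⟩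
  rw [stratumEquiv_symm_of_rep hM hT hq]
  exact InfData.rep_toStratum hM hT _

theorem diffeomorphic_stratum (hM : IsSmoothSubmanifold d M) (hT : T.IsFTree) :
    Diffeomorphic (Stratum T M) (InfStratum T M) := by
  have := hM.hasParamTopology_infStratum T
  obtain ⟨g, hg, -⟩ := exists_isDiffeo_of_equiv (stratumEquiv hM hT) (isSmooth_stratumEquiv hM hT)
    (isSmooth_stratumEquiv_symm hM hT)
  exact ⟨g, hg⟩

end Smoothness

theorem mainTheorem1 (n : ℕ) (T : RootedGraph n) (hT : T.IsFTree) (m : ℕ) :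
    (∀ (d : ℕ) (M : Set (Euc m)), IsSmoothSubmanifold d M →
      SmoothParam.Diffeomorphic (Stratum T M) (InfStratum T M)) ∧
    (∃ Φ : InfStratum T (Set.univ : Set (Euc m)) ≃ₜ
        Conf (T.EdgesAt T.root) (Euc m) × (∀ v : T.Internal, ConfModSim m (T.EdgesAt v.1)),
      SmoothParam.IsDiffeo Φ ∧
      ∀ (p : InfStratum T (Set.univ : Set (Euc m))) (e : T.EdgesAt T.root),
        (Φ p).1.1 e = ((p.1 e).1.1 : Euc m) ∧
        ∀ v : T.InternalOver e, (Φ p).2 ⟨v.1, v.2.1⟩ = ((p.1 e).1.2 v).toConfModSim) :=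
  ⟨fun _ _ hM => diffeomorphic_stratum hM hT, exists_isDiffeo_infStratum_univ hT.isTree m⟩
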